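/- Let $p,k\in\mathbb R$ with $p\neq 0,-1,-2$ and $k\neq 0$, let $s_1,s_2\in\{1,-1\}$, and consider the scaled gKdV--LS system $$u_t+s_1u^pu_x+u_{xxx}+s_2(|\psi|^2)_x=0,\qquad i\psi_t+\psi_{xx}+ku\psi=0$$ for real $u(t,x)$ and complex $\psi(t,x)$, where $u$ takes its values in a nonempty open interval $I$ on which the power $u^p$ is smooth ($u>0$; or $u<0$ as well when $p$ is an integer; or all real $u$ when $p$ is a natural number). A conserved current is a pair $(T,X)$ of smooth real functions of $t,x,u,\psi,\bar\psi$ and finitely many $x$-derivatives of $u,\psi,\bar\psi$ such that $D_tT+D_xX=0$ on all formal solutions ($D_t,D_x$ are the total derivatives; $t$-derivatives of $u,\psi$ are eliminated through the system). It is trivial if $T=D_x\Theta$, $X=-D_t\Theta$ on all formal solutions for some function $\Theta$ of the same kind. Two currents are locally equivalent if they differ by a trivial one. A conservation law has differential order at most $1$ if it is locally equivalent to one whose density $T$ depends at most on $t,x,u,\psi,\bar\psi,u_x,\psi_x,\bar\psi_x$. Below, $|\psi|^2\arg(\psi)_x$ and $|\psi|^2\arg(\psi)_t$ stand for the smooth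 expressions $\mathrm{Im}(\bar\psi\psi_x)$ and $\mathrm{Im}(\bar\psi\psi_t)$. Put $$T_1=u,\qquad X_1=u_{xx}+\tfrac{s_1}{p+1}u^{p+1}+s_2|\psi|^2;$$ $$T_2=\tfrac12|\psi|^2,\qquad X_2=|\psi|^2\arg(\psi)_x;$$ $$T_3=\tfrac12ku^2-s_2|\psi|^2\arg(\psi)_x,\qquad X_3=k\big(uu_{xx}-\tfrac12u_x^2+\tfrac{s_1}{p+2}u^{p+2}\big)-s_2|\psi_x|^2+s_2|\psi|^2\arg(\psi)_t;$$ $$T_4=\tfrac12u_x^2-\tfrac{s_1}{(p+1)(p+2)}u^{p+2}+\tfrac{s_2}{k}|\psi_x|^2-s_2u|\psi|^2,$$ $$X_4=-\tfrac12\big(u_{xx}+\tfrac{s_1}{p+1}u^{p+1}+s_2|\psi|^2\big)^2-u_tu_x-\tfrac{s_2}{k}(\psi_t\bar\psi_x+\psi_x\bar\psi_t);$$ $$T_5=s_2k(\tfrac12tu^2-s_1xu)-t|\psi|^2\arg(\psi)_x+(s_1kt+\tfrac12x)|\psi|^2,$$ $$X_5=s_2k\big((tu-s_1x)u_{xx}+s_1u_x-\tfrac12tu_x^2-\tfrac12xu^2+\tfrac{s_1}{3}tu^3\big)-t|\psi_x|^2-s_1kx|\psi|^2+t|\psi|^2\arg(\psi)_t+(2s_1kt+x)|\psi|^2\arg(\psi)_x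 .$$ (a) If $p\neq1$, then $(T_1,X_1),\dots,(T_4,X_4)$ are conserved currents, they are linearly independent modulo trivial currents (in particular non-trivial), and every conservation law of differential order at most $1$ is locally equivalent to a real linear combination of them. Moreover $T_5$ is then not a conserved density, whatever the flux. (b) If $p=1$, the same holds for the five currents $(T_1,X_1),\dots,(T_5,X_5)$. (c) The corresponding conserved integrals are the mass $M=\int_{\mathbb R}u\,dx$, the charge $J=\int_{\mathbb R}\frac12|\psi|^2dx$, the momentum $P=\int_{\mathbb R}(\frac12u^2-\frac{s_2}{k}|\psi|^2\arg(\psi)_x)dx$, the energy $H=\int_{\mathbb R}T_4\,dx$ and, for $p=1$, the Galilean momentum $G=\int_{\mathbb R}T_5\,dx$: they are $\int T_1\,dx$, $\int T_2\,dx$, $\frac1k\int T_3\,dx$, $\int T_4\,dx$, $\int T_5\,dx$, respectively, and each of them is constant in time along every smooth solution on $\mathbb R^2$ with $u\in I$ for which the density is integrable in $x$ at each time and the flux tends to $0$ as $|x|\to\infty$, uniformly for $t$ in bounded intervals. -/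

import Mathlib

namespace GKdVLS

open scoped ContDiff ComplexConjugate

/-- The constants of the scaled gKdV-LS system
`u_t + s₁ u^p u_x + u_xxx + s₂ (|ψ|²)_x = 0`, `i ψ_t + ψ_xx + k u ψ = 0`. -/
structure Params where
  /-- nonlinearity power -/
  p : ℝ
  /-- coupling constant -/
  k : ℝ
  /-- sign of the convective term -/
  s₁ : ℝ
  /-- sign of the coupling term -/
  s₂ : ℝ

/-- The real number `v` is one at which the power function with exponent `p` is smooth:
any positive `v`, any negative `v` if `p` is an integer, and `v = 0` if `p` is a natural number. -/
def PowerSmoothAt (p v : ℝ) : Prop :=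
  0 < v ∨ (v < 0 ∧ ∃ m : ℤ, p = m) ∨ (v = 0 ∧ ∃ n : ℕ, p = n)

/-- `I` is an admissible range of values of `u`: a nonempty open interval on which the power `u ^ p`
is smooth. (`I = ℝ` is admissible when `p` is a natural number, `I = (0, ∞)` for every `p`.) -/
structure AdmissibleRange (p : ℝ) (I : Set ℝ) : Prop where
  isOpen : IsOpen I
  ordConnected : I.OrdConnected
  nonempty : I.Nonempty
  power : ∀ v ∈ I, PowerSmoothAt p v

/-! ### Jet space, differential functions and total derivatives -/

/-- The solution jet space, with coordinates `t`, `x`, `∂ₓⁿ u` (real) and `∂ₓⁿ ψ` (complex),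
`n = 0, 1, 2, …`. The `t`-derivatives have been eliminated through the system, so that
the points of this space are the jets of the formal solutions. A function of `ψ`, `ψ̄` and
their derivatives is a function of the complex coordinates `∂ₓⁿ ψ`. -/
abbrev Jet := ℝ × ℝ × (ℕ → ℝ) × (ℕ → ℂ)

namespace Jet

/-- time -/
def t (j : Jet) : ℝ := j.1
/-- space -/
def x (j : Jet) : ℝ := j.2.1
/-- the coordinate `∂ₓⁿ u` -/
def u (j : Jet) (n : ℕ) : ℝ := j.2.2.1 n
/-- the coordinate `∂ₓⁿ ψ` -/
def ψ (j : Jet) (n : ℕ) : ℂ := j.2.2.2 n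

end Jet

/-- The part of the jet space on which `u` takes its values in `I`. -/
def jetDomain (I : Set ℝ) : Set Jet := {j | j.u 0 ∈ I}

/-- `F` is on `jetDomain I` a smooth function of `t`, `x` and the `x`-derivatives of `u`, `ψ`, `ψ̄`
of order at most `N`. -/
def IsDiffFunction (I : Set ℝ) (N : ℕ) (F : Jet → ℝ) : Prop :=
  ∃ G : ℝ × ℝ × (Fin (N + 1) → ℝ) × (Fin (N + 1) → ℂ) → ℝ,
    ContDiffOn ℝ ∞ G {q | q.2.2.1 0 ∈ I} ∧
    ∀ j ∈ jetDomain I, F j = G (j.t, j.x, fun n => j.u n, fun n => j.ψ n)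

/-- The total derivative `D_x`: by the chain rule, it is the derivative in the direction
`∂_x + ∑ₙ (∂ₓⁿ⁺¹ u ∂_{∂ₓⁿ u} + ∂ₓⁿ⁺¹ ψ ∂_{∂ₓⁿ ψ})`. -/
noncomputable def Dx {E : Type*} [NormedAddCommGroup E] [NormedSpace ℝ E]
    (F : Jet → E) (j : Jet) : E :=
  lineDeriv ℝ F j (0, 1, fun n => j.u (n + 1), fun n => j.ψ (n + 1))

/-- `u_t` as eliminated through the system; `2 Re (ψ̄ ψ_x)` is `(|ψ|²)_x`. -/
noncomputable def ut (P : Params) (j : Jet) : ℝ :=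
  -(P.s₁ * j.u 0 ^ P.p * j.u 1 + j.u 3 + P.s₂ * (2 * (conj (j.ψ 0) * j.ψ 1).re))

/-- `ψ_t` as eliminated through the system. -/
noncomputable def ψt (P : Params) (j : Jet) : ℂ :=
  Complex.I * (j.ψ 2 + P.k * j.u 0 * j.ψ 0)

/-- The total derivative `D_t` on formal solutions: the derivative in the direction
`∂_t + ∑ₙ (D_xⁿ u_t ∂_{∂ₓⁿ u} + D_xⁿ ψ_t ∂_{∂ₓⁿ ψ})`, with `u_t`, `ψ_t` given by the system. -/
noncomputable def Dt (P : Params) (F : Jet → ℝ) (j : Jet) : ℝ :=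
  lineDeriv ℝ F j (1, 0, fun n => (Dx^[n] (ut P)) j, fun n => (Dx^[n] (ψt P)) j)

/-! ### Conservation laws -/

/-- A current `(T, X)`: density and spatial flux. -/
abbrev Current := (Jet → ℝ) × (Jet → ℝ)

/-- `(T, X)` is a conserved current: `T`, `X` are differential functions (of any finite order) and
`D_t T + D_x X = 0` on all formal solutions. -/
def IsConservationLaw (P : Params) (I : Set ℝ) (C : Current) : Prop :=
  (∃ N, IsDiffFunction I N C.1) ∧ (∃ N, IsDiffFunction I N C.2) ∧
    ∀ j ∈ jetDomain I, Dt P C.1 j + Dx C.2 j = 0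

/-- `(T, X)` is trivial: `T = D_x Θ`, `X = - D_t Θ` on all formal solutions, for some differential
function `Θ`. -/
def IsTrivial (P : Params) (I : Set ℝ) (C : Current) : Prop :=
  ∃ Θ : Jet → ℝ, (∃ N, IsDiffFunction I N Θ) ∧
    ∀ j ∈ jetDomain I, C.1 j = Dx Θ j ∧ C.2 j = -Dt P Θ j

/-- Local equivalence: the currents differ by a trivial one. -/
def LocallyEquivalent (P : Params) (I : Set ℝ) (C C' : Current) : Prop :=
  IsTrivial P I (C - C')

/-- The conservation law has differential order at most `n`: some locally equivalent conserved
current has a density of order at most `n`. -/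
def HasOrderLE (P : Params) (I : Set ℝ) (n : ℕ) (C : Current) : Prop :=
  ∃ C' : Current, IsConservationLaw P I C' ∧ LocallyEquivalent P I C C' ∧ IsDiffFunction I n C'.1

/-- The currents `B i` form a basis, up to local equivalence, of the conservation laws of
differential order at most `n`: they are conserved currents with densities of order at most `n`,
every conservation law of order at most `n` is locally equivalent to a linear combination of them,
and only the zero combination is trivial (in particular, each `B i` is non-trivial). -/
structure IsBasisOfConservationLaws (P : Params) (I : Set ℝ) (n : ℕ) {m : ℕ}
    (B : Fin m → Current) : Prop where
  conserved : ∀ i, IsConservationLaw P I (B i)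
  order_le : ∀ i, IsDiffFunction I n (B i).1
  spans : ∀ C : Current, IsConservationLaw P I C → HasOrderLE P I n C →
    ∃ c : Fin m → ℝ, LocallyEquivalent P I C (∑ i, c i • B i)
  independent : ∀ c : Fin m → ℝ, IsTrivial P I (∑ i, c i • B i) → c = 0

/-! ### The five currents -/

/-- `|z|² arg(z)'` for a complex quantity `z` with derivative `z'`, in its smooth form `Im (z̄ z')`;
see `absSqDArg_eq`. -/
noncomputable def absSqDArg (z z' : ℂ) : ℝ := (conj z * z').im

/-- For `f = r exp (i θ)` with `r`, `θ` differentiable, `absSqDArg` is `|f|² θ'`. -/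
theorem absSqDArg_eq {r θ : ℝ → ℝ} {r' θ' x : ℝ} (hr : HasDerivAt r r' x)
    (hθ : HasDerivAt θ θ' x) :
    absSqDArg (r x * Complex.exp (θ x * Complex.I))
      (deriv (fun y => (r y : ℂ) * Complex.exp (θ y * Complex.I)) x) = r x ^ 2 * θ' := by
  have hd : HasDerivAt (fun y => (r y : ℂ) * Complex.exp (θ y * Complex.I))
      (r' * Complex.exp (θ x * Complex.I)
        + r x * (Complex.exp (θ x * Complex.I) * (θ' * Complex.I))) x :=
    hr.ofReal_comp.mul (hθ.ofReal_comp.mul_const Complex.I).cexp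
  rw [hd.deriv]
  have hc := Real.sin_sq_add_cos_sq (θ x)
  simp only [absSqDArg, map_mul, Complex.conj_ofReal, ← Complex.exp_conj, Complex.conj_I]
  simp [Complex.exp_re, Complex.exp_im]
  linear_combination (r x ^ 2 * θ') * hc

/-- Mass current. -/
noncomputable def massCurrent (P : Params) : Current :=
  (fun j => j.u 0,
   fun j => j.u 2 + P.s₁ * (1 / (P.p + 1)) * j.u 0 ^ (P.p + 1) + P.s₂ * ‖j.ψ 0‖ ^ 2)

/-- Charge current. -/
noncomputable def chargeCurrent : Current :=
  (fun j => 1 / 2 * ‖j.ψ 0‖ ^ 2,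
   fun j => absSqDArg (j.ψ 0) (j.ψ 1))

/-- Momentum current. -/
noncomputable def momentumCurrent (P : Params) : Current :=
  (fun j => 1 / 2 * P.k * j.u 0 ^ 2 - P.s₂ * absSqDArg (j.ψ 0) (j.ψ 1),
   fun j => P.k * (j.u 0 * j.u 2 - 1 / 2 * j.u 1 ^ 2
        + P.s₁ * (1 / (P.p + 2)) * j.u 0 ^ (P.p + 2))
      - P.s₂ * ‖j.ψ 1‖ ^ 2 + P.s₂ * absSqDArg (j.ψ 0) (ψt P j))

/-- Energy current; `ψ_t ψ̄_x + ψ_x ψ̄_t` is real. -/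
noncomputable def energyCurrent (P : Params) : Current :=
  (fun j => 1 / 2 * j.u 1 ^ 2 - P.s₁ * (1 / ((P.p + 1) * (P.p + 2))) * j.u 0 ^ (P.p + 2)
      + P.s₂ / P.k * ‖j.ψ 1‖ ^ 2 - P.s₂ * j.u 0 * ‖j.ψ 0‖ ^ 2,
   fun j => -(1 / 2) * (j.u 2 + P.s₁ * (1 / (P.p + 1)) * j.u 0 ^ (P.p + 1)
        + P.s₂ * ‖j.ψ 0‖ ^ 2) ^ 2
      - ut P j * j.u 1
      - P.s₂ / P.k * (ψt P j * conj (j.ψ 1) + j.ψ 1 * conj (ψt P j)).re)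

/-- Galilean-momentum current. -/
noncomputable def galileanCurrent (P : Params) : Current :=
  (fun j => P.s₂ * P.k * (1 / 2 * j.t * j.u 0 ^ 2 - P.s₁ * j.x * j.u 0)
      - j.t * absSqDArg (j.ψ 0) (j.ψ 1)
      + (P.s₁ * P.k * j.t + 1 / 2 * j.x) * ‖j.ψ 0‖ ^ 2,
   fun j => P.s₂ * P.k * ((j.t * j.u 0 - P.s₁ * j.x) * j.u 2 + P.s₁ * j.u 1
        - 1 / 2 * j.t * j.u 1 ^ 2 - 1 / 2 * j.x * j.u 0 ^ 2
        + P.s₁ * (1 / 3) * j.t * j.u 0 ^ 3)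
      - j.t * ‖j.ψ 1‖ ^ 2 - P.s₁ * P.k * j.x * ‖j.ψ 0‖ ^ 2
      + j.t * absSqDArg (j.ψ 0) (ψt P j)
      + (P.s₁ * 2 * P.k * j.t + j.x) * absSqDArg (j.ψ 0) (j.ψ 1))

/-! ### Solutions and conserved integrals -/

/-- `(u, ψ)` is a smooth solution of the scaled gKdV-LS system on the whole plane, with `u` taking
its values in `I`; the arguments are `t`, `x` in this order. -/
structure IsSolution (P : Params) (I : Set ℝ) (u : ℝ → ℝ → ℝ) (ψ : ℝ → ℝ → ℂ) : Prop where
  smooth_u : ContDiff ℝ ∞ (fun q : ℝ × ℝ => u q.1 q.2)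
  smooth_ψ : ContDiff ℝ ∞ (fun q : ℝ × ℝ => ψ q.1 q.2)
  range : ∀ t x, u t x ∈ I
  eqn_u : ∀ t x, deriv (fun t' => u t' x) t + P.s₁ * u t x ^ P.p * deriv (u t) x
    + iteratedDeriv 3 (u t) x + P.s₂ * deriv (fun x' => ‖ψ t x'‖ ^ 2) x = 0
  eqn_ψ : ∀ t x, Complex.I * deriv (fun t' => ψ t' x) t + iteratedDeriv 2 (ψ t) x
    + P.k * u t x * ψ t x = 0

/-- The jet of `(u, ψ)` at `(t, x)`. -/
noncomputable def jetOf (u : ℝ → ℝ → ℝ) (ψ : ℝ → ℝ → ℂ) (t x : ℝ) : Jet :=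
  (t, x, fun n => iteratedDeriv n (u t) x, fun n => iteratedDeriv n (ψ t) x)

/-- The functional `Q` (of the solution and the time) is a conserved integral belonging to the
current `C = (T, X)`: it is a nonzero constant multiple of the integral of `T` over the line, and
it does not depend on time for any solution for which that integral exists at all times
and `X → 0` as `|x| → ∞`, uniformly on bounded time intervals. -/
def IsConservedIntegral (P : Params) (I : Set ℝ) (C : Current)
    (Q : (ℝ → ℝ → ℝ) → (ℝ → ℝ → ℂ) → ℝ → ℝ) : Prop :=
  (∃ a : ℝ, a ≠ 0 ∧ ∀ u ψ, IsSolution P I u ψ →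
    ∀ t, Q u ψ t = a * ∫ x, C.1 (jetOf u ψ t x)) ∧
  ∀ u ψ, IsSolution P I u ψ →
    (∀ t, MeasureTheory.Integrable (fun x => C.1 (jetOf u ψ t x))) →
    (∀ a b : ℝ, TendstoUniformlyOn (fun x t => C.2 (jetOf u ψ t x)) (fun _ => 0)
      (Filter.cocompact ℝ) (Set.Icc a b)) →
    ∀ t t', Q u ψ t = Q u ψ t'

/-- Mass. -/
noncomputable def massIntegral (u : ℝ → ℝ → ℝ) (_ψ : ℝ → ℝ → ℂ) (t : ℝ) : ℝ :=
  ∫ x, u t x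

/-- Charge. -/
noncomputable def chargeIntegral (_u : ℝ → ℝ → ℝ) (ψ : ℝ → ℝ → ℂ) (t : ℝ) : ℝ :=
  ∫ x, 1 / 2 * ‖ψ t x‖ ^ 2

/-- Momentum. -/
noncomputable def momentumIntegral (P : Params) (u : ℝ → ℝ → ℝ) (ψ : ℝ → ℝ → ℂ) (t : ℝ) : ℝ :=
  ∫ x, (1 / 2 * u t x ^ 2 - P.s₂ * (1 / P.k) * absSqDArg (ψ t x) (deriv (ψ t) x))

/-- Energy. -/
noncomputable def energyIntegral (P : Params) (u : ℝ → ℝ → ℝ) (ψ : ℝ → ℝ → ℂ) (t : ℝ) : ℝ :=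
  ∫ x, (1 / 2 * deriv (u t) x ^ 2
    - P.s₁ * (1 / ((P.p + 1) * (P.p + 2))) * u t x ^ (P.p + 2)
    + P.s₂ * (1 / P.k) * ‖deriv (ψ t) x‖ ^ 2 - P.s₂ * u t x * ‖ψ t x‖ ^ 2)

/-- Galilean momentum. -/
noncomputable def galileanIntegral (P : Params) (u : ℝ → ℝ → ℝ) (ψ : ℝ → ℝ → ℂ) (t : ℝ) : ℝ :=
  ∫ x, (P.s₂ * P.k * (1 / 2 * t * u t x ^ 2 - P.s₁ * x * u t x)
    - t * absSqDArg (ψ t x) (deriv (ψ t) x)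
    + (P.s₁ * P.k * t + 1 / 2 * x) * ‖ψ t x‖ ^ 2)

end GKdVLS

/-!
The system serves only to eliminate the `t`-derivatives, so the claims on currents are claims about
the commutative ring `DiffFun I` of smooth functions of finitely many of the coordinates `t`, `x`,
`∂ₓⁿ u`, `Re ∂ₓⁿ ψ`, `Im ∂ₓⁿ ψ`, with its partial derivatives `pd c` and the commuting derivations
`totalX`, `totalT`. In this ring the power `w = u ^ p` is known through `u ∂w/∂u = p w`
(`coord_mul_pd_upow`) and the fact that it is not a zero divisor.

Let `T` be a conserved density of order at most one. After summation by parts its conservation law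
reads `∂_t T + u_t E_u + Re ψ_t E_Re + Im ψ_t E_Im + D_x Y = 0` with the Euler operators of `T`
(`ReducedLaw`). Comparison of the coefficients of the highest derivatives expresses the first
partial derivatives of `Y` by the Euler operators, and the symmetry of the second partial derivatives
of `Y` then gives equations for these. They force

* `E_u = -A (u_xx + s₁ u^(p+1) / (p+1) + s₂ |ψ|²) + e u + f`,
* `E_ψ = -C (ψ_xx + k u ψ) - i κ ψ_x + σ ψ` for `E_ψ = E_Re + i E_Im`,

where `A` is a constant, `C` and `κ` are multiples of `A` and `e`, and `e`, `f`, `σ` are functions of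
`t`, `x` which satisfy the linear equations `determining_u` and `determining_ψ`. For `p ≠ 1` the
functions `1`, `u`, `u ^ p` are linearly independent and `e`, `f`, `σ` are constants; for `p = 1`
there is one more solution. In all cases the Euler operators of `T` are those of a linear combination
of the given densities. The difference is a null Lagrangian, which is a total `x`-derivative
(`IsNull.exists_eq_totalX`); here the functions are integrated in one coordinate at a time
(`primitive`), which is possible as `I` is an interval. The fluxes then differ by a `t`-derivative
up to an element of the kernel of `D_x`, that is a function of `t`, which is trivial as well
(`exists_potential`).

Linear independence holds because the Euler operators annihilate total derivatives and take
independent values at the densities. For `p ≠ 1` the Galilean-momentum density is conserved up to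
`s₂ k (u² / 2 - u^(p+1) / (p+1))`, which is not a total derivative (`galilean_not_conserved`).

For the conserved integrals, `D_t` and `D_x` become the partial derivatives along a solution
(`IsSolution.hasDerivAt_eval_fst`, `IsSolution.hasDerivAt_eval_snd`), and the divergence theorem on
`[a, b] × [-R, R]` shows, as `R → ∞`, that the integral of the density is the same at the times `a`
and `b`.
-/

namespace GKdVLS

open scoped ContDiff ComplexConjugate

/-! ### The ring of differential functions -/

/-- Jets truncated at order `N`. -/
abbrev FinJet (N : ℕ) := ℝ × ℝ × (Fin (N + 1) → ℝ) × (Fin (N + 1) → ℂ)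

/-- Truncation of jets at order `N`, as a linear map. -/
def trunc (N : ℕ) : Jet →ₗ[ℝ] FinJet N where
  toFun j := (j.1, j.2.1, fun n => j.2.2.1 n, fun n => j.2.2.2 n)
  map_add' _ _ := rfl
  map_smul' _ _ := rfl

/-- The truncated jets on which `u` takes its values in `I`. -/
def finDomain (I : Set ℝ) (N : ℕ) : Set (FinJet N) := {q | q.2.2.1 0 ∈ I}

theorem isOpen_finDomain {I : Set ℝ} (hI : IsOpen I) (N : ℕ) : IsOpen (finDomain I N) :=
  hI.preimage (by fun_prop : Continuous fun q : FinJet N => q.2.2.1 0)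

theorem trunc_mem_finDomain {I : Set ℝ} {N : ℕ} {j : Jet} :
    trunc N j ∈ finDomain I N ↔ j ∈ jetDomain I := Iff.rfl

theorem isDiffFunction_iff {I : Set ℝ} {N : ℕ} {F : Jet → ℝ} :
    IsDiffFunction I N F ↔ ∃ G : FinJet N → ℝ, ContDiffOn ℝ ∞ G (finDomain I N) ∧
      ∀ j ∈ jetDomain I, F j = G (trunc N j) := Iff.rfl

namespace IsDiffFunction

variable {I : Set ℝ} {N M : ℕ} {F F' : Jet → ℝ}

theorem mono (h : IsDiffFunction I N F) (hNM : N ≤ M) : IsDiffFunction I M F := by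
  obtain ⟨G, hG, hF⟩ := h
  let r : FinJet M → FinJet N := fun q =>
    (q.1, q.2.1, fun n => q.2.2.1 (Fin.castLE (by omega) n),
      fun n => q.2.2.2 (Fin.castLE (by omega) n))
  refine ⟨fun q => G (r q), hG.comp (f := r) ?_ ?_, fun j hj => hF j hj⟩
  · exact ContDiff.contDiffOn (by fun_prop)
  · intro q hq
    exact hq

theorem congr (h : IsDiffFunction I N F) (h' : ∀ j ∈ jetDomain I, F' j = F j) :
    IsDiffFunction I N F' := by
  obtain ⟨G, hG, hF⟩ := h
  exact ⟨G, hG, fun j hj => (h' j hj).trans (hF j hj)⟩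

theorem const (c : ℝ) : IsDiffFunction I N fun _ => c :=
  ⟨fun _ => c, contDiffOn_const, fun _ _ => rfl⟩

theorem add (h : IsDiffFunction I N F) (h' : IsDiffFunction I N F') :
    IsDiffFunction I N fun j => F j + F' j := by
  obtain ⟨G, hG, hF⟩ := h
  obtain ⟨G', hG', hF'⟩ := h'
  exact ⟨fun q => G q + G' q, hG.add hG', fun j hj => by simp only [hF j hj, hF' j hj]⟩

theorem mul (h : IsDiffFunction I N F) (h' : IsDiffFunction I N F') :
    IsDiffFunction I N fun j => F j * F' j := by
  obtain ⟨G, hG, hF⟩ := h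
  obtain ⟨G', hG', hF'⟩ := h'
  exact ⟨fun q => G q * G' q, hG.mul hG', fun j hj => by simp only [hF j hj, hF' j hj]⟩

end IsDiffFunction

/-- The real coordinates of the jet space; `ψ` enters through its real and imaginary parts. -/
inductive Coord
  | t
  | x
  | u (n : ℕ)
  | re (n : ℕ)
  | im (n : ℕ)

namespace Coord

noncomputable instance : DecidableEq Coord := Classical.decEq _

/-- The number of `x`-derivatives in a coordinate. -/
def order : Coord → ℕ
  | t => 0
  | x => 0
  | u n => n
  | re n => n
  | im n => n

/-- The value of a coordinate at a jet. -/
def val : Coord → Jet → ℝ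
  | t, j => j.t
  | x, j => j.x
  | u n, j => j.u n
  | re n, j => (j.ψ n).re
  | im n, j => (j.ψ n).im

/-- The unit vector of a coordinate. -/
noncomputable def vec : Coord → Jet
  | t => (1, 0, 0, 0)
  | x => (0, 1, 0, 0)
  | u n => (0, 0, Pi.single n 1, 0)
  | re n => (0, 0, 0, Pi.single n 1)
  | im n => (0, 0, 0, Pi.single n Complex.I)

theorem val_vec (c d : Coord) : val d (vec c) = if c = d then 1 else 0 := by
  cases c <;> cases d <;> simp [val, vec, Jet.t, Jet.x, Jet.u, Jet.ψ, Pi.single_apply, eq_comm,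
    apply_ite Complex.re, apply_ite Complex.im]

theorem val_add (c : Coord) (j j' : Jet) : val c (j + j') = val c j + val c j' := by
  cases c <;> simp [val, Jet.t, Jet.x, Jet.u, Jet.ψ]

theorem val_smul (c : Coord) (a : ℝ) (j : Jet) : val c (a • j) = a * val c j := by
  cases c <;> simp [val, Jet.t, Jet.x, Jet.u, Jet.ψ]

theorem trunc_vec_eq_zero {N : ℕ} {c : Coord} (h : N < c.order) : trunc N (vec c) = 0 := by
  cases c with
  | t => simp [order] at h
  | x => simp [order] at h
  | u n | re n | im n =>
    have (m : Fin (N + 1)) : (m : ℕ) ≠ n := by have := m.2; simp only [order] at h; omega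
    simp only [trunc, vec, LinearMap.coe_mk, AddHom.coe_mk]
    refine Prod.ext rfl (Prod.ext rfl (Prod.ext ?_ ?_)) <;> funext m <;>
      simp [this]

/-- The finitely many coordinates of order at most `N`. -/
noncomputable def upTo (N : ℕ) : Finset Coord :=
  {t, x} ∪ ((Finset.range (N + 1)).image u ∪ ((Finset.range (N + 1)).image re ∪
    (Finset.range (N + 1)).image im))

theorem mem_upTo {N : ℕ} {c : Coord} : c ∈ upTo N ↔ c.order ≤ N := by
  cases c <;> simp [upTo, order]

theorem sum_upTo {E : Type*} [AddCommMonoid E] (N : ℕ) (f : Coord → E) :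
    ∑ c ∈ upTo N, f c = f t + f x + (∑ n ∈ Finset.range (N + 1), f (u n) +
      (∑ n ∈ Finset.range (N + 1), f (re n) + ∑ n ∈ Finset.range (N + 1), f (im n))) := by
  rw [upTo, Finset.sum_union, Finset.sum_union, Finset.sum_union, Finset.sum_pair,
    Finset.sum_image, Finset.sum_image, Finset.sum_image]
  all_goals simp [Finset.disjoint_left, Set.InjOn]

theorem trunc_eq_sum (N : ℕ) (v : Jet) :
    trunc N v = ∑ c ∈ upTo N, val c v • trunc N (vec c) := by
  rw [sum_upTo]
  refine Prod.ext ?_ (Prod.ext ?_ (Prod.ext ?_ ?_))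
  · simp [trunc, vec, val, Jet.t, Prod.fst_sum]
  · simp [trunc, vec, val, Jet.x, Prod.fst_sum, Prod.snd_sum]
  · funext m
    have := m.2
    simp [trunc, vec, val, Jet.u, Prod.fst_sum, Prod.snd_sum, Pi.single_apply]
    omega
  · funext m
    have := m.2
    simp [trunc, vec, val, Jet.ψ, Prod.snd_sum, Pi.single_apply]
    apply Complex.ext <;> simp [apply_ite Complex.re, apply_ite Complex.im] <;> omega

end Coord

/-- A nonempty open interval. -/
class OpenInterval (I : Set ℝ) : Prop where
  isOpen : IsOpen I
  ordConnected : I.OrdConnected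
  nonempty : I.Nonempty

/-- Extension by zero from `jetDomain I` to the whole jet space. -/
noncomputable def extend {I : Set ℝ} (f : jetDomain I → ℝ) (j : Jet) : ℝ :=
  open Classical in if h : j ∈ jetDomain I then f ⟨j, h⟩ else 0

theorem extend_of_mem {I : Set ℝ} (f : jetDomain I → ℝ) {j : Jet} (h : j ∈ jetDomain I) :
    extend f j = f ⟨j, h⟩ := dif_pos h

/-- The differential functions (of any finite order) on `jetDomain I`, as a subalgebra. -/
def diffSubalgebra (I : Set ℝ) : Subalgebra ℝ (jetDomain I → ℝ) where
  carrier := {f | ∃ N, IsDiffFunction I N (extend f)}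
  mul_mem' := by
    rintro f g ⟨N, hf⟩ ⟨M, hg⟩
    refine ⟨max N M, ((hf.mono (le_max_left N M)).mul (hg.mono (le_max_right N M))).congr ?_⟩
    intro j hj
    simp [extend_of_mem _ hj]
  add_mem' := by
    rintro f g ⟨N, hf⟩ ⟨M, hg⟩
    refine ⟨max N M, ((hf.mono (le_max_left N M)).add (hg.mono (le_max_right N M))).congr ?_⟩
    intro j hj
    simp [extend_of_mem _ hj]
  algebraMap_mem' a := ⟨0, (IsDiffFunction.const a).congr fun j hj => by
    simp [extend_of_mem _ hj]⟩

/-- The ring of differential functions on `jetDomain I`. -/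
def DiffFun (I : Set ℝ) : Type := diffSubalgebra I

namespace DiffFun

variable {I : Set ℝ}

noncomputable instance : CommRing (DiffFun I) := inferInstanceAs (CommRing (diffSubalgebra I))

noncomputable instance : Algebra ℝ (DiffFun I) := inferInstanceAs (Algebra ℝ (diffSubalgebra I))

instance : FunLike (DiffFun I) (jetDomain I) ℝ where
  coe f := f.1
  coe_injective _ _ h := Subtype.ext h

theorem add_apply (f g : DiffFun I) (j : jetDomain I) : (f + g) j = f j + g j := rfl
theorem sub_apply (f g : DiffFun I) (j : jetDomain I) : (f - g) j = f j - g j := rfl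
theorem neg_apply (f : DiffFun I) (j : jetDomain I) : (-f) j = -f j := rfl
theorem mul_apply (f g : DiffFun I) (j : jetDomain I) : (f * g) j = f j * g j := rfl
theorem zero_apply (j : jetDomain I) : (0 : DiffFun I) j = 0 := rfl
theorem one_apply (j : jetDomain I) : (1 : DiffFun I) j = 1 := rfl
theorem smul_apply (a : ℝ) (f : DiffFun I) (j : jetDomain I) : (a • f) j = a * f j := rfl
theorem algebraMap_apply (a : ℝ) (j : jetDomain I) : (algebraMap ℝ (DiffFun I) a) j = a := rfl

theorem sum_apply {ι : Type*} (s : Finset ι) (f : ι → DiffFun I) (j : jetDomain I) :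
    (∑ i ∈ s, f i) j = ∑ i ∈ s, f i j := by
  classical
  induction s using Finset.induction_on with
  | empty => rfl
  | insert a s ha ih => rw [Finset.sum_insert ha, Finset.sum_insert ha, add_apply, ih]

theorem exists_isDiffFunction (f : DiffFun I) : ∃ N, IsDiffFunction I N (extend f) := f.2

/-- The differential function given by a function on the jet space. -/
def ofJet (F : Jet → ℝ) (hF : ∃ N, IsDiffFunction I N F) : DiffFun I :=
  ⟨fun j => F j, hF.imp fun _ h => h.congr fun _ hj => extend_of_mem _ hj⟩

@[simp] theorem ofJet_apply (F : Jet → ℝ) (hF : ∃ N, IsDiffFunction I N F) (j : jetDomain I) :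
    ofJet F hF j = F j := rfl

/-- A coordinate as a differential function. -/
noncomputable def coord (c : Coord) : DiffFun I := ofJet c.val <| by
  refine ⟨c.order, ?_⟩
  cases c with
  | t => exact ⟨fun q => q.1, by fun_prop, fun j _ => rfl⟩
  | x => exact ⟨fun q => q.2.1, by fun_prop, fun j _ => rfl⟩
  | u n => exact ⟨fun q => q.2.2.1 (Fin.last n), ContDiff.contDiffOn (by fun_prop), fun j _ => rfl⟩
  | re n => exact ⟨fun q => Complex.reCLM (q.2.2.2 (Fin.last n)),
      ContDiff.contDiffOn (by fun_prop), fun j _ => rfl⟩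
  | im n => exact ⟨fun q => Complex.imCLM (q.2.2.2 (Fin.last n)),
      ContDiff.contDiffOn (by fun_prop), fun j _ => rfl⟩

@[simp] theorem coord_apply (c : Coord) (j : jetDomain I) : coord c j = c.val j := rfl

/-! ### Partial derivatives -/

theorem eventually_add_smul_mem [OpenInterval I] {j : Jet} (hj : j ∈ jetDomain I) (v : Jet) :
    ∀ᶠ s : ℝ in nhds 0, j + s • v ∈ jetDomain I := by
  have hc : Continuous fun s : ℝ => j.u 0 + s * v.u 0 := by fun_prop
  exact hc.continuousAt.preimage_mem_nhds
    ((OpenInterval.isOpen (I := I)).mem_nhds (by simpa [jetDomain] using hj))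

theorem contDiffAt_of_mem [OpenInterval I] {N : ℕ} {G : FinJet N → ℝ}
    (hG : ContDiffOn ℝ ∞ G (finDomain I N)) {q : FinJet N} (hq : q ∈ finDomain I N) :
    ContDiffAt ℝ ∞ G q :=
  hG.contDiffAt ((isOpen_finDomain OpenInterval.isOpen N).mem_nhds hq)

theorem hasLineDerivAt_of_eq [OpenInterval I] {N : ℕ} {F : Jet → ℝ} {G : FinJet N → ℝ}
    (hG : ContDiffOn ℝ ∞ G (finDomain I N)) (hF : ∀ j ∈ jetDomain I, F j = G (trunc N j))
    {j : Jet} (hj : j ∈ jetDomain I) (v : Jet) :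
    HasLineDerivAt ℝ F (fderiv ℝ G (trunc N j) (trunc N v)) j v := by
  have h1 := (contDiffAt_of_mem hG (trunc_mem_finDomain.2 hj)).differentiableAt
    (by simp) |>.hasFDerivAt
  have h2 := h1.hasLineDerivAt (trunc N v)
  refine HasDerivAt.congr_of_eventuallyEq h2 ?_
  filter_upwards [eventually_add_smul_mem hj v] with s hs
  rw [hF _ hs, map_add, map_smul]

theorem contDiffOn_fderiv_apply [OpenInterval I] {N : ℕ} {G : FinJet N → ℝ}
    (hG : ContDiffOn ℝ ∞ G (finDomain I N)) (v : FinJet N) :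
    ContDiffOn ℝ ∞ (fun q => fderiv ℝ G q v) (finDomain I N) :=
  (hG.fderiv_of_isOpen (isOpen_finDomain OpenInterval.isOpen N) (by simp)).clm_apply
    contDiffOn_const

theorem exists_eq (f : DiffFun I) : ∃ N, ∃ G : FinJet N → ℝ, ContDiffOn ℝ ∞ G (finDomain I N) ∧
    ∀ j ∈ jetDomain I, extend f j = G (trunc N j) := f.2

theorem extend_add (f g : DiffFun I) {j : Jet} (hj : j ∈ jetDomain I) :
    extend (f + g : DiffFun I) j = extend f j + extend g j := by
  simp [extend_of_mem _ hj, add_apply]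

theorem extend_mul (f g : DiffFun I) {j : Jet} (hj : j ∈ jetDomain I) :
    extend (f * g : DiffFun I) j = extend f j * extend g j := by
  simp [extend_of_mem _ hj, mul_apply]

theorem hasLineDerivAt [OpenInterval I] (f : DiffFun I) {j : Jet} (hj : j ∈ jetDomain I)
    (v : Jet) : HasLineDerivAt ℝ (extend f) (lineDeriv ℝ (extend f) j v) j v := by
  obtain ⟨N, G, hG, hF⟩ := f.exists_eq
  have := hasLineDerivAt_of_eq hG hF hj v
  rwa [this.lineDeriv]

theorem lineDeriv_congr [OpenInterval I] {E : Type*} [NormedAddCommGroup E] [NormedSpace ℝ E]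
    {F F' : Jet → E} (h : ∀ j ∈ jetDomain I, F j = F' j)
    {j : Jet} (hj : j ∈ jetDomain I) (v : Jet) : lineDeriv ℝ F j v = lineDeriv ℝ F' j v := by
  refine Filter.EventuallyEq.deriv_eq ?_
  filter_upwards [eventually_add_smul_mem hj v] with s hs using h _ hs

/-- The partial derivative with respect to a coordinate. -/
noncomputable def pd [OpenInterval I] (c : Coord) : Derivation ℝ (DiffFun I) (DiffFun I) :=
  Derivation.mk'
    { toFun := fun f => ofJet (fun j => lineDeriv ℝ (extend f) j c.vec) (by
        obtain ⟨N, G, hG, hF⟩ := f.exists_eq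
        exact ⟨N, _, contDiffOn_fderiv_apply hG (trunc N c.vec), fun j hj =>
          (hasLineDerivAt_of_eq hG hF hj c.vec).lineDeriv⟩)
      map_add' := fun f g => by
        refine DFunLike.ext _ _ fun ⟨j, hj⟩ => ?_
        simp only [ofJet_apply, add_apply]
        rw [lineDeriv_congr (fun j hj => extend_add f g hj) hj]
        have hf : HasDerivAt _ _ _ := f.hasLineDerivAt hj c.vec
        have hg : HasDerivAt _ _ _ := g.hasLineDerivAt hj c.vec
        exact (hf.add hg).deriv
      map_smul' := fun a f => by
        refine DFunLike.ext _ _ fun ⟨j, hj⟩ => ?_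
        simp only [ofJet_apply, smul_apply, RingHom.id_apply]
        have : ∀ j ∈ jetDomain I, extend (a • f : DiffFun I) j = a • extend f j := fun j hj => by
          simp [extend_of_mem _ hj, smul_apply]
        rw [lineDeriv_congr this hj]
        have hf : HasDerivAt _ _ _ := f.hasLineDerivAt hj c.vec
        exact (hf.const_smul a).deriv }
    (fun f g => by
        refine DFunLike.ext _ _ fun ⟨j, hj⟩ => ?_
        simp only [LinearMap.coe_mk, AddHom.coe_mk, ofJet_apply, smul_eq_mul, add_apply, mul_apply]
        rw [lineDeriv_congr (fun j hj => extend_mul f g hj) hj]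
        have hf : HasDerivAt _ _ _ := f.hasLineDerivAt hj c.vec
        have hg : HasDerivAt _ _ _ := g.hasLineDerivAt hj c.vec
        have := (hf.mul hg).deriv
        simp only [zero_smul, add_zero, extend_of_mem _ hj] at this
        exact this.trans (by ring))

variable [OpenInterval I]

theorem pd_apply (c : Coord) (f : DiffFun I) (j : jetDomain I) :
    pd c f j = lineDeriv ℝ (extend f) j c.vec := rfl

theorem extend_pd (c : Coord) (f : DiffFun I) {j : Jet} (hj : j ∈ jetDomain I) :
    extend (pd c f) j = lineDeriv ℝ (extend f) j c.vec := by
  rw [extend_of_mem _ hj, pd_apply]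

theorem pd_comm (c d : Coord) (f : DiffFun I) : pd c (pd d f) = pd d (pd c f) := by
  refine DFunLike.ext _ _ fun ⟨j, hj⟩ => ?_
  obtain ⟨N, G, hG, hF⟩ := f.exists_eq
  have key (c d : Coord) : pd c (pd d f) ⟨j, hj⟩ =
      fderiv ℝ (fderiv ℝ G) (trunc N j) (trunc N c.vec) (trunc N d.vec) := by
    have h := hasLineDerivAt_of_eq (contDiffOn_fderiv_apply hG (trunc N d.vec))
      (fun j hj => (extend_pd d f hj).trans (hasLineDerivAt_of_eq hG hF hj d.vec).lineDeriv)
      hj c.vec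
    rw [pd_apply, h.lineDeriv]
    have h2 : DifferentiableAt ℝ (fderiv ℝ G) (trunc N j) :=
      ((contDiffAt_of_mem hG (trunc_mem_finDomain.2 hj)).fderiv_right (m := 1)
        (by norm_cast)).differentiableAt (by simp)
    rw [fderiv_clm_apply h2 (differentiableAt_const _)]
    simp
  rw [key, key]
  exact ((contDiffAt_of_mem hG (trunc_mem_finDomain.2 hj)).isSymmSndFDerivAt
    (by simpa using WithTop.coe_le_coe.2 (le_top : (2 : ℕ∞) ≤ ⊤))).eq _ _

/-- The partial derivatives with respect to the coordinates of order greater than `n` vanish. -/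
def OrderLE (n : ℕ) (f : DiffFun I) : Prop := ∀ c : Coord, n < c.order → pd c f = 0

theorem orderLE_of_isDiffFunction {f : DiffFun I} {N : ℕ} (h : IsDiffFunction I N (extend f)) :
    OrderLE N f := by
  obtain ⟨G, hG, hF⟩ := h
  intro c hc
  refine DFunLike.ext _ _ fun ⟨j, hj⟩ => ?_
  rw [pd_apply, (hasLineDerivAt_of_eq hG hF hj c.vec).lineDeriv, Coord.trunc_vec_eq_zero hc,
    map_zero, zero_apply]

theorem exists_orderLE (f : DiffFun I) : ∃ N, OrderLE N f :=
  f.exists_isDiffFunction.imp fun _ => orderLE_of_isDiffFunction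

theorem OrderLE.mono {f : DiffFun I} {n m : ℕ} (h : OrderLE n f) (hnm : n ≤ m) : OrderLE m f :=
  fun c hc => h c (hnm.trans_lt hc)

theorem OrderLE.pd {f : DiffFun I} {n : ℕ} (h : OrderLE n f) (c : Coord) :
    OrderLE n (pd c f) := fun d hd => by rw [pd_comm, h d hd, map_zero]

theorem OrderLE.support_subset {f : DiffFun I} {n : ℕ} (h : OrderLE n f)
    (V : Coord → DiffFun I) :
    Function.support (fun c => V c * DiffFun.pd c f) ⊆ Coord.upTo n := by
  intro c hc
  rw [Finset.mem_coe, Coord.mem_upTo]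
  by_contra hlt
  exact hc (by simp [h c (not_le.1 hlt)])

theorem support_finite (V : Coord → DiffFun I) (f : DiffFun I) :
    (Function.support fun c => V c * pd c f).Finite :=
  let ⟨_, h⟩ := f.exists_orderLE
  (Finset.finite_toSet _).subset (h.support_subset V)

/-- The derivation `∑ V c * ∂/∂c`, where `c` runs over the coordinates; only finitely many terms are
nonzero at a differential function. -/
noncomputable def vectorField (V : Coord → DiffFun I) : Derivation ℝ (DiffFun I) (DiffFun I) :=
  Derivation.mk'
    { toFun := fun f => ∑ᶠ c, V c * pd c f
      map_add' := fun f g => by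
        rw [← finsum_add_distrib (support_finite V f) (support_finite V g)]
        exact finsum_congr fun c => by rw [map_add, mul_add]
      map_smul' := fun a f => by
        rw [RingHom.id_apply, smul_finsum' _ (support_finite V f)]
        exact finsum_congr fun c => by
          rw [Derivation.map_smul, mul_smul_comm] }
    (fun f g => by
      simp only [LinearMap.coe_mk, AddHom.coe_mk, smul_eq_mul]
      rw [mul_finsum' _ _ (support_finite V g), mul_finsum' _ _ (support_finite V f),
        ← finsum_add_distrib]
      · exact finsum_congr fun c => by simp only [Derivation.leibniz, smul_eq_mul]; ring
      · exact (support_finite V g).subset fun c hc h0 => hc (by simp only at h0; simp [h0])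
      · exact (support_finite V f).subset fun c hc h0 => hc (by simp only at h0; simp [h0]))

theorem vectorField_eq_sum (V : Coord → DiffFun I) {f : DiffFun I} {n : ℕ} (h : OrderLE n f) :
    vectorField V f = ∑ c ∈ Coord.upTo n, V c * pd c f :=
  finsum_eq_sum_of_support_subset _ (h.support_subset V)

/-- A directional derivative is the derivative along a vector field with the same coordinates. -/
theorem hasLineDerivAt_vectorField (f : DiffFun I) (V : Coord → DiffFun I) {j : Jet}
    (hj : j ∈ jetDomain I) {v : Jet} (hv : ∀ c, c.val v = V c ⟨j, hj⟩) :
    HasLineDerivAt ℝ (extend f) (vectorField V f ⟨j, hj⟩) j v := by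
  obtain ⟨N, G, hG, hF⟩ := f.exists_eq
  have h := hasLineDerivAt_of_eq hG hF hj v
  have h' : vectorField V f ⟨j, hj⟩ = fderiv ℝ G (trunc N j) (trunc N v) := by
    rw [vectorField_eq_sum V (orderLE_of_isDiffFunction ⟨G, hG, hF⟩), Coord.trunc_eq_sum N v, map_sum,
      sum_apply]
    refine Finset.sum_congr rfl fun c _ => ?_
    rw [mul_apply, map_smul, hv, pd_apply, (hasLineDerivAt_of_eq hG hF hj c.vec).lineDeriv,
      smul_eq_mul]
  rwa [h']

/-- The composition of two vector fields, up to a term symmetric in them. -/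
theorem vectorField_comm (V W : Coord → DiffFun I) (f : DiffFun I) :
    vectorField V (vectorField W f) - vectorField W (vectorField V f) =
      vectorField (fun c => vectorField V (W c) - vectorField W (V c)) f := by
  obtain ⟨n, h⟩ := f.exists_orderLE
  simp only [vectorField_eq_sum _ h, map_sum, Derivation.leibniz, smul_eq_mul, sub_mul,
    Finset.sum_sub_distrib, Finset.sum_add_distrib, vectorField_eq_sum _ (h.pd _)]
  have : ∑ d ∈ Coord.upTo n, W d * ∑ c ∈ Coord.upTo n, V c * pd c (pd d f) =
      ∑ d ∈ Coord.upTo n, V d * ∑ c ∈ Coord.upTo n, W c * pd c (pd d f) := by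
    simp only [Finset.mul_sum]
    rw [Finset.sum_comm]
    refine Finset.sum_congr rfl fun c _ => Finset.sum_congr rfl fun d _ => ?_
    rw [pd_comm]
    ring
  rw [this]
  simp only [mul_comm (pd _ f)]
  ring

@[simp] theorem pd_coord (c d : Coord) : pd c (coord d : DiffFun I) = if c = d then 1 else 0 := by
  refine DFunLike.ext _ _ fun ⟨j, hj⟩ => ?_
  have h (j) (hj : j ∈ jetDomain I) : extend (coord d : DiffFun I) j = d.val j :=
    extend_of_mem _ hj
  rw [pd_apply, lineDeriv_congr h hj, lineDeriv]
  simp only [Coord.val_add, Coord.val_smul, Coord.val_vec]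
  split_ifs <;> simp [one_apply, zero_apply]

@[simp] theorem vectorField_coord (V : Coord → DiffFun I) (c : Coord) :
    vectorField V (coord c) = V c := by
  refine (finsum_eq_single _ c fun d hd => ?_).trans ?_
  · simp [hd]
  · simp

end DiffFun

/-! ### Integrals depending smoothly on a parameter -/

section ParametricIntegral

variable {H : Type} [NormedAddCommGroup H] [NormedSpace ℝ H]

/-- Differentiation under the integral sign over `[0, 1]`, for an integrand of class `C¹` on an open
set which contains the segment over the parameter. -/
theorem hasFDerivAt_integral_of_contDiffOn {E : Type} [NormedAddCommGroup E] [NormedSpace ℝ E]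
    [CompleteSpace E]
    {W : Set (H × ℝ)} (hW : IsOpen W) {g : H × ℝ → E} (hg : ContDiffOn ℝ 1 g W) {q : H}
    (hq : ∀ s ∈ Set.Icc (0 : ℝ) 1, (q, s) ∈ W) :
    HasFDerivAt (fun q => ∫ s in (0 : ℝ)..1, g (q, s))
      (∫ s in (0 : ℝ)..1, (fderiv ℝ g (q, s)).comp (ContinuousLinearMap.inl ℝ H ℝ)) q := by
  set g' : H × ℝ → (H →L[ℝ] E) := fun y => (fderiv ℝ g y).comp (ContinuousLinearMap.inl ℝ H ℝ)
  have hg' : ContinuousOn g' W :=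
    (hg.continuousOn_fderiv_of_isOpen hW (by simp)).clm_comp continuousOn_const
  have hK : IsCompact ((fun s : ℝ => (q, s)) '' Set.Icc 0 1) :=
    isCompact_Icc.image (by fun_prop)
  have hKW : (fun s : ℝ => (q, s)) '' Set.Icc 0 1 ⊆ W := by
    rintro _ ⟨s, hs, rfl⟩
    exact hq s hs
  obtain ⟨M, hM⟩ := hK.exists_bound_of_continuousOn (hg'.mono hKW)
  -- a neighbourhood of `q` over which the derivative in the parameter is bounded
  have hV : IsOpen (W ∩ (fun y => ‖g' y‖) ⁻¹' Set.Iio (M + 1)) :=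
    hg'.norm.isOpen_inter_preimage hW isOpen_Iio
  obtain ⟨u, v, hu, -, hqu, hv, huv⟩ := generalized_tube_lemma
    (isCompact_singleton (x := q)) (isCompact_Icc (a := (0 : ℝ)) (b := 1)) hV (by
      rintro ⟨q', s⟩ ⟨hq', hs⟩
      obtain rfl : q' = q := hq'
      exact ⟨hq s hs, (hM _ ⟨s, hs, rfl⟩).trans_lt (lt_add_one M)⟩)
  have hmem (y : H) (hy : y ∈ u) (s : ℝ) (hs : s ∈ Set.Icc (0 : ℝ) 1) :
      (y, s) ∈ W ∧ ‖g' (y, s)‖ < M + 1 := huv ⟨hy, hv hs⟩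
  have hgc (y : H) (hy : y ∈ u) : ContinuousOn (fun s : ℝ => g (y, s)) (Set.Icc 0 1) :=
    hg.continuousOn.comp (by fun_prop) fun s hs => (hmem y hy s hs).1
  have hu' : u ∈ nhds q := hu.mem_nhds (hqu rfl)
  have hI : Set.uIoc (0 : ℝ) 1 = Set.Ioc 0 1 := Set.uIoc_of_le zero_le_one
  refine intervalIntegral.hasFDerivAt_integral_of_dominated_of_fderiv_le (s := u)
    (F := fun y s => g (y, s)) (F' := fun y s => g' (y, s)) (bound := fun _ => M + 1) hu' ?_ ?_ ?_
    ?_ ?_ ?_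
  · filter_upwards [hu'] with y hy
    rw [hI]
    exact ((hgc y hy).mono Set.Ioc_subset_Icc_self).aestronglyMeasurable measurableSet_Ioc
  · exact ContinuousOn.intervalIntegrable (by simpa using hgc q (hqu rfl))
  · rw [hI]
    exact ((hg'.comp (by fun_prop) fun s hs => hq s hs :
      ContinuousOn (fun s : ℝ => g' (q, s)) (Set.Icc 0 1)).mono
      Set.Ioc_subset_Icc_self).aestronglyMeasurable measurableSet_Ioc
  · refine .of_forall fun s hs y hy => (hmem y hy s ?_).2.le
    exact Set.Ioc_subset_Icc_self (hI ▸ hs)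
  · exact intervalIntegrable_const
  · refine .of_forall fun s hs y hy => ?_
    have hys := (hmem y hy s (Set.Ioc_subset_Icc_self (hI ▸ hs))).1
    have h1 := ((hg.contDiffAt (hW.mem_nhds hys)).differentiableAt (by simp)).hasFDerivAt
    exact h1.comp y (hasFDerivAt_prodMk_left y s)

theorem contDiffOn_integral {W : Set (H × ℝ)} (hW : IsOpen W) {U : Set H} (hU : IsOpen U)
    (hUW : ∀ q ∈ U, ∀ s ∈ Set.Icc (0 : ℝ) 1, (q, s) ∈ W) (n : ℕ) :
    ∀ {E : Type} [NormedAddCommGroup E] [NormedSpace ℝ E] [CompleteSpace E] {g : H × ℝ → E},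
      ContDiffOn ℝ ∞ g W → ContDiffOn ℝ n (fun q => ∫ s in (0 : ℝ)..1, g (q, s)) U := by
  induction n with
  | zero =>
    intro E _ _ _ g hg
    exact contDiffOn_zero.2 fun q hq => (hasFDerivAt_integral_of_contDiffOn hW
      (hg.of_le (by simp)) (hUW q hq)).continuousAt.continuousWithinAt
  | succ n ih =>
    intro E _ _ _ g hg
    have h1 (q) (hq : q ∈ U) := hasFDerivAt_integral_of_contDiffOn hW
      (hg.of_le (by simp)) (hUW q hq)
    push_cast
    refine (contDiffOn_succ_iff_fderiv_of_isOpen hU).2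
      ⟨fun q hq => (h1 q hq).differentiableAt.differentiableWithinAt, by simp, ?_⟩
    refine (ih (g := fun y => (fderiv ℝ g y).comp (ContinuousLinearMap.inl ℝ H ℝ)) ?_).congr
      fun q hq => (h1 q hq).fderiv
    exact (hg.fderiv_of_isOpen hW (by simp)).clm_comp contDiffOn_const

end ParametricIntegral

namespace DiffFun

variable {I : Set ℝ} [OpenInterval I]

/-! ### Integration in one coordinate -/

/-- A coordinate is a linear function of the jet truncated at its order. -/
theorem exists_truncVal {N : ℕ} {c : Coord} (hc : c.order ≤ N) :
    ∃ l : FinJet N →L[ℝ] ℝ, ∀ j, l (trunc N j) = c.val j := by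
  cases c with
  | t => exact ⟨.fst ℝ _ _, fun _ => rfl⟩
  | x => exact ⟨(ContinuousLinearMap.fst ℝ _ _).comp (.snd ℝ _ _), fun _ => rfl⟩
  | u n => exact ⟨(ContinuousLinearMap.proj (R := ℝ) (φ := fun _ : Fin (N + 1) => ℝ)
      ⟨n, Nat.lt_succ_of_le hc⟩).comp ((ContinuousLinearMap.fst ℝ _ _).comp
      ((ContinuousLinearMap.snd ℝ _ _).comp (.snd ℝ _ _))), fun _ => rfl⟩
  | re n => exact ⟨Complex.reCLM.comp ((ContinuousLinearMap.proj (R := ℝ)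
      (φ := fun _ : Fin (N + 1) => ℂ) ⟨n, Nat.lt_succ_of_le hc⟩).comp
      ((ContinuousLinearMap.snd ℝ _ _).comp
      ((ContinuousLinearMap.snd ℝ _ _).comp (.snd ℝ _ _)))), fun _ => rfl⟩
  | im n => exact ⟨Complex.imCLM.comp ((ContinuousLinearMap.proj (R := ℝ)
      (φ := fun _ : Fin (N + 1) => ℂ) ⟨n, Nat.lt_succ_of_le hc⟩).comp
      ((ContinuousLinearMap.snd ℝ _ _).comp
      ((ContinuousLinearMap.snd ℝ _ _).comp (.snd ℝ _ _)))), fun _ => rfl⟩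

/-- The jet with a given truncation whose higher coordinates vanish. -/
def padZero (n : ℕ) (q : FinJet n) : Jet :=
  (q.1, q.2.1, fun m => if h : m < n + 1 then q.2.2.1 ⟨m, h⟩ else 0,
    fun m => if h : m < n + 1 then q.2.2.2 ⟨m, h⟩ else 0)

theorem trunc_surjective (N : ℕ) : Function.Surjective (trunc N) := fun q =>
  ⟨padZero N q, Prod.ext rfl (Prod.ext rfl
    (Prod.ext (funext fun n => dif_pos n.2) (funext fun n => dif_pos n.2)))⟩

/-- The base value from which a coordinate is integrated: a point of `I` for `u`. -/
noncomputable def base (I : Set ℝ) [OpenInterval I] : Coord → ℝ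
  | .u 0 => (OpenInterval.nonempty (I := I)).some
  | _ => 0

/-- The point at proportion `s` of the segment from the base value to `j` in the coordinate `c`. -/
noncomputable def slide (I : Set ℝ) [OpenInterval I] (c : Coord) (j : Jet) (s : ℝ) : Jet :=
  j + ((s - 1) * (c.val j - base I c)) • c.vec

theorem slide_mem (c : Coord) {j : Jet} (hj : j ∈ jetDomain I) {s : ℝ}
    (hs : s ∈ Set.Icc (0 : ℝ) 1) : slide I c j s ∈ jetDomain I := by
  change Coord.val (.u 0) (slide I c j s) ∈ I
  rw [slide, Coord.val_add, Coord.val_smul, Coord.val_vec]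
  split_ifs with h
  · subst h
    have h0 : base I (.u 0) ∈ I := (OpenInterval.nonempty (I := I)).some_mem
    have hc : Convex ℝ I := (OpenInterval.ordConnected (I := I)).convex
    have := hc h0 (show Coord.val (.u 0) j ∈ I from hj) (sub_nonneg.2 hs.2) hs.1 (by ring)
    simp only [smul_eq_mul] at this
    convert this using 1
    ring
  · rw [mul_zero, add_zero]
    exact hj

/-- On truncated jets, the integrand of `primitive` is smooth in all variables. -/
theorem exists_slide_data (c : Coord) (f : DiffFun I) :
    ∃ N, ∃ G : FinJet N → ℝ, ∃ l : FinJet N →L[ℝ] ℝ, ∃ W : Set (FinJet N × ℝ),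
      ContDiffOn ℝ ∞ G (finDomain I N) ∧ (∀ j ∈ jetDomain I, extend f j = G (trunc N j)) ∧
      (∀ j, l (trunc N j) = c.val j) ∧ IsOpen W ∧
      (∀ q ∈ finDomain I N, ∀ s ∈ Set.Icc (0 : ℝ) 1, (q, s) ∈ W) ∧
      ContDiffOn ℝ ∞ (fun y : FinJet N × ℝ =>
        G (y.1 + ((y.2 - 1) * (l y.1 - base I c)) • trunc N c.vec)) W ∧
      (∀ j s, trunc N (slide I c j s) =
        trunc N j + ((s - 1) * (l (trunc N j) - base I c)) • trunc N c.vec) := by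
  obtain ⟨M, hf⟩ := f.exists_isDiffFunction
  obtain ⟨G, hG, hF⟩ := hf.mono (le_max_left M c.order)
  obtain ⟨l, hl⟩ := exists_truncVal (le_max_right M c.order)
  have hsl : ∀ j s, trunc (max M c.order) (slide I c j s) = trunc (max M c.order) j +
      ((s - 1) * (l (trunc _ j) - base I c)) • trunc _ c.vec := fun j s => by
    rw [slide, map_add, map_smul, hl]
  have hsm : ContDiff ℝ ∞ fun y : FinJet (max M c.order) × ℝ =>
      y.1 + ((y.2 - 1) * (l y.1 - base I c)) • trunc (max M c.order) c.vec := by fun_prop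
  refine ⟨max M c.order, G, l, _, hG, hF, hl,
    (isOpen_finDomain OpenInterval.isOpen _).preimage hsm.continuous, ?_,
    hG.comp hsm.contDiffOn fun _ h => h, hsl⟩
  intro q hq s hs
  obtain ⟨j, rfl⟩ := trunc_surjective _ q
  rw [Set.mem_preimage]
  simp only
  rw [← hsl, trunc_mem_finDomain]
  exact slide_mem c (trunc_mem_finDomain.1 hq) hs

/-- The integral of a differential function in the coordinate `c`, from the base value. -/
noncomputable def primitive (c : Coord) (f : DiffFun I) : DiffFun I :=
  ofJet (fun j => (c.val j - base I c) * ∫ s in (0 : ℝ)..1, extend f (slide I c j s)) <| by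
    obtain ⟨N, G, l, W, hG, hF, hl, hW, hmem, hg, hsl⟩ := exists_slide_data c f
    refine ⟨N, isDiffFunction_iff.2 ⟨fun q => (l q - base I c) * ∫ s in (0 : ℝ)..1,
      G (q + ((s - 1) * (l q - base I c)) • trunc N c.vec), ?_, fun j hj => ?_⟩⟩
    · refine ContDiffOn.mul (ContDiff.contDiffOn (by fun_prop)) ?_
      exact contDiffOn_infty.2 fun n => contDiffOn_integral hW
        (isOpen_finDomain OpenInterval.isOpen N) hmem n hg
    · beta_reduce
      rw [hl]
      congr 1
      refine intervalIntegral.integral_congr fun s hs => ?_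
      rw [hF _ (slide_mem c hj (by simpa using hs)), hsl, hl]

theorem primitive_zero (c : Coord) : primitive c (0 : DiffFun I) = 0 := by
  refine DFunLike.ext _ _ fun ⟨j, hj⟩ => ?_
  have : ∀ j, extend (0 : DiffFun I) j = 0 := fun j => by
    unfold extend
    split_ifs <;> rfl
  simp [primitive, this, zero_apply]

theorem pd_primitive_of_ne {c d : Coord} (hcd : d ≠ c) (f : DiffFun I) :
    pd d (primitive c f) = primitive c (pd d f) := by
  refine DFunLike.ext _ _ fun ⟨j, hj⟩ => ?_
  obtain ⟨N, G, l, W, hG, hF, hl, hW, hmem, hg, hsl⟩ := exists_slide_data c f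
  have hvd : c.val d.vec = 0 := by rw [Coord.val_vec, if_neg hcd]
  have hval (τ : ℝ) : c.val (j + τ • d.vec) = c.val j := by
    rw [Coord.val_add, Coord.val_smul, hvd, mul_zero, add_zero]
  have h1 := (hasFDerivAt_integral_of_contDiffOn hW (hg.of_le (by simp))
    (hmem _ (trunc_mem_finDomain.2 hj))).hasLineDerivAt (trunc N d.vec)
  have h2 : HasDerivAt (fun τ : ℝ => extend (primitive c f) (j + τ • d.vec)) _ 0 :=
    (HasDerivAt.const_mul (c.val j - base I c) h1).congr_of_eventuallyEq (by
      filter_upwards [eventually_add_smul_mem hj d.vec] with τ hτ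
      rw [extend_of_mem _ hτ, primitive, ofJet_apply, hval]
      congr 1
      refine intervalIntegral.integral_congr fun s hs => ?_
      simp only
      rw [hF _ (slide_mem c hτ (by simpa using hs)), hsl, map_add, map_smul])
  rw [pd_apply, lineDeriv, h2.deriv, primitive, ofJet_apply]
  congr 1
  have hint : IntervalIntegrable (fun s : ℝ => (fderiv ℝ (fun y : FinJet N × ℝ =>
      G (y.1 + ((y.2 - 1) * (l y.1 - base I c)) • trunc N c.vec)) (trunc N j, s)).comp
      (ContinuousLinearMap.inl ℝ _ ℝ)) MeasureTheory.volume 0 1 := by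
    refine ContinuousOn.intervalIntegrable ?_
    refine ContinuousOn.clm_comp ?_ continuousOn_const
    refine (hg.continuousOn_fderiv_of_isOpen hW (by simp)).comp (by fun_prop) fun s hs => ?_
    exact hmem _ (trunc_mem_finDomain.2 hj) s (by simpa using hs)
  rw [ContinuousLinearMap.intervalIntegral_apply hint]
  refine intervalIntegral.integral_congr fun s hs => ?_
  have hs' : s ∈ Set.Icc (0 : ℝ) 1 := by simpa using hs
  have hm := slide_mem c hj hs'
  simp only [ContinuousLinearMap.comp_apply, ContinuousLinearMap.inl_apply]
  rw [extend_pd d f hm, (hasLineDerivAt_of_eq hG hF hm d.vec).lineDeriv]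
  -- both sides are the derivative at `0` of the same function of one variable
  have h3 := ((hg.contDiffAt (hW.mem_nhds (hmem _ (trunc_mem_finDomain.2 hj) s hs'))
    ).differentiableAt (by simp)).hasFDerivAt.hasLineDerivAt (trunc N d.vec, (0 : ℝ))
  have h4 := ((contDiffAt_of_mem hG (trunc_mem_finDomain.2 hm)).differentiableAt
    (by simp)).hasFDerivAt.hasLineDerivAt (trunc N d.vec)
  refine HasDerivAt.unique h3 (HasDerivAt.congr_of_eventuallyEq h4 (.of_forall fun τ => ?_))
  simp only [Prod.fst_add, Prod.snd_add, Prod.smul_fst, Prod.smul_snd, smul_zero, add_zero]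
  rw [hsl, map_add, map_smul, hl, hl, hvd]
  congr 1
  simp only [smul_zero, add_zero]
  abel

theorem pd_primitive_self (c : Coord) (f : DiffFun I) : pd c (primitive c f) = f := by
  refine DFunLike.ext _ _ fun ⟨j, hj⟩ => ?_
  obtain ⟨N, G, hG, hF⟩ := f.exists_eq
  have hvc : c.val c.vec = 1 := by rw [Coord.val_vec, if_pos rfl]
  set b := base I c
  set a := c.val j
  -- the restriction of `f` to the line through `j`, parametrised by the coordinate `c`
  set h : ℝ → ℝ := fun r => extend f (j + (r - a) • c.vec)
  set R : Set ℝ := {r | j + (r - a) • c.vec ∈ jetDomain I}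
  have hRo : IsOpen R := by
    have : Continuous fun r : ℝ => (j + (r - a) • c.vec).u 0 := by
      change Continuous fun r : ℝ => j.u 0 + (r - a) * c.vec.u 0
      fun_prop
    exact (OpenInterval.isOpen (I := I)).preimage this
  have hhR : ContinuousOn h R := by
    have h1 : ContinuousOn (fun r : ℝ => G (trunc N j + (r - a) • trunc N c.vec)) R :=
      hG.continuousOn.comp (by fun_prop) fun r hr => by
        rw [← map_smul, ← map_add]
        exact trunc_mem_finDomain.2 hr
    refine h1.congr fun r hr => ?_
    simp only [h]
    rw [hF _ hr, map_add, map_smul]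
  have hseg (s : ℝ) : slide I c j s = j + (b + s * (a - b) - a) • c.vec := by
    rw [slide]
    congr 2
    ring
  have hsub : Set.uIcc b a ⊆ R := by
    intro r hr
    rw [← segment_eq_uIcc, segment_eq_image'] at hr
    obtain ⟨s, hs, rfl⟩ := hr
    have := slide_mem c hj hs
    rw [hseg] at this
    exact this
  have haR : a ∈ R := by simpa [R] using hj
  have h1 := intervalIntegral.integral_hasDerivAt_right (hhR.mono hsub).intervalIntegrable
    (hhR.stronglyMeasurableAtFilter hRo a haR) (hhR.continuousAt (hRo.mem_nhds haR))
  have h2 : HasDerivAt (fun τ : ℝ => extend (primitive c f) (j + τ • c.vec)) (h a) 0 := by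
    have h1' : HasDerivAt (fun τ : ℝ => ∫ r in b..a + τ, h r) (h a) 0 := by
      have := HasDerivAt.comp_const_add a 0 (f := fun r => ∫ x in b..r, h x) (f' := h a)
        (by simpa using h1)
      exact this
    refine h1'.congr_of_eventuallyEq ?_
    filter_upwards [eventually_add_smul_mem hj c.vec] with τ hτ
    have hv : c.val (j + τ • c.vec) = a + τ := by
      rw [Coord.val_add, Coord.val_smul, hvc, mul_one]
    rw [extend_of_mem _ hτ, primitive, ofJet_apply, hv]
    have h3 := intervalIntegral.mul_integral_comp_mul_add (a := 0) (b := 1) (f := h)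
      (c := a + τ - b) (d := b)
    rw [mul_zero, zero_add, mul_one, sub_add_cancel] at h3
    rw [← h3]
    congr 1
    refine intervalIntegral.integral_congr fun s _ => ?_
    simp only [h, slide, hv]
    congr 1
    rw [add_assoc, ← add_smul]
    congr 2
    ring
  rw [pd_apply, lineDeriv, h2.deriv]
  simp [h, extend_of_mem _ hj]

/-- A differential function whose partial derivatives all vanish is constant. -/
theorem eq_algebraMap_of_pd_eq_zero {f : DiffFun I} (h : ∀ c, pd c f = 0) :
    ∃ a : ℝ, f = algebraMap ℝ (DiffFun I) a := by
  obtain ⟨N, G, hG, hF⟩ := f.exists_eq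
  have hconv : Convex ℝ (finDomain I N) :=
    (OpenInterval.ordConnected (I := I)).convex.is_linear_preimage
      (f := fun q : FinJet N => q.2.2.1 0) ⟨fun _ _ => rfl, fun _ _ => rfl⟩
  have hd : ∀ q ∈ finDomain I N, fderiv ℝ G q = 0 := by
    intro q hq
    obtain ⟨j, rfl⟩ := trunc_surjective N q
    refine ContinuousLinearMap.ext fun v => ?_
    obtain ⟨v, rfl⟩ := trunc_surjective N v
    rw [Coord.trunc_eq_sum N v, map_sum]
    refine Finset.sum_eq_zero fun c _ => ?_
    have hj := trunc_mem_finDomain.1 hq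
    have := (hasLineDerivAt_of_eq hG hF hj c.vec).lineDeriv
    rw [← extend_pd _ _ hj, h, extend_of_mem _ hj, zero_apply] at this
    rw [map_smul, ← this, smul_zero]
  have hc {q q' : FinJet N} (hq : q ∈ finDomain I N) (hq' : q' ∈ finDomain I N) : G q = G q' :=
    (isOpen_finDomain (I := I) OpenInterval.isOpen N).is_const_of_fderiv_eq_zero
      hconv.isPreconnected (hG.differentiableOn (by simp)) hd hq hq'
  obtain ⟨v, hv⟩ := OpenInterval.nonempty (I := I)
  have hv' : ((0, 0, fun _ => v, 0) : Jet) ∈ jetDomain I := hv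
  refine ⟨G (trunc N (0, 0, fun _ => v, 0)), DFunLike.ext _ _ fun ⟨j, hj⟩ => ?_⟩
  rw [algebraMap_apply, ← extend_of_mem f hj, hF _ hj]
  exact hc (trunc_mem_finDomain.2 hj) (trunc_mem_finDomain.2 hv')

end DiffFun

namespace DiffFun

variable {I : Set ℝ} [OpenInterval I]

/-! ### The total derivative in `x` -/

theorem vectorField_single (c : Coord) (f : DiffFun I) :
    vectorField (Pi.single c 1) f = pd c f := by
  refine (finsum_eq_single _ c fun d hd => ?_).trans ?_
  · simp [hd]
  · simp

theorem pd_vectorField (c : Coord) (V : Coord → DiffFun I) (f : DiffFun I) :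
    pd c (vectorField V f) = vectorField V (pd c f) + vectorField (fun d => pd c (V d)) f := by
  have h := vectorField_comm (Pi.single c 1) V f
  simp only [vectorField_single] at h
  rw [← sub_eq_iff_eq_add', h]
  congr 2
  funext d
  by_cases hd : d = c
  · subst hd
    simp
  · simp [hd]

theorem vectorField_zero_apply (f : DiffFun I) : vectorField (fun _ => 0) f = 0 :=
  (finsum_congr fun _ => zero_mul _).trans finsum_zero

/-- The components of the total derivative `D_x`. -/
noncomputable def shift (I : Set ℝ) : Coord → DiffFun I
  | .t => 0
  | .x => 1
  | .u n => coord (.u (n + 1))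
  | .re n => coord (.re (n + 1))
  | .im n => coord (.im (n + 1))

/-- The total derivative `D_x` on the ring of differential functions. -/
noncomputable def totalX : Derivation ℝ (DiffFun I) (DiffFun I) := vectorField (shift I)

theorem totalX_coord (c : Coord) : totalX (coord c : DiffFun I) = shift I c :=
  vectorField_coord _ _

section
variable (n : ℕ) (f : DiffFun I)

@[simp] theorem totalX_t : totalX (coord .t : DiffFun I) = 0 := totalX_coord _
@[simp] theorem totalX_x : totalX (coord .x : DiffFun I) = 1 := totalX_coord _
@[simp] theorem totalX_u : totalX (coord (.u n) : DiffFun I) = coord (.u (n + 1)) := totalX_coord _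
@[simp] theorem totalX_re : totalX (coord (.re n) : DiffFun I) = coord (.re (n + 1)) :=
  totalX_coord _
@[simp] theorem totalX_im : totalX (coord (.im n) : DiffFun I) = coord (.im (n + 1)) :=
  totalX_coord _

/-- `∂/∂c` commutes with `D_x` if no component of `D_x` depends on `c`. -/
theorem pd_totalX_of_forall {c : Coord} (h : ∀ d, pd c (shift I d) = 0) :
    pd c (totalX f) = totalX (pd c f) := by
  rw [totalX, pd_vectorField, add_eq_left]
  simp only [h, vectorField_zero_apply]

/-- If `c` occurs in the components of `D_x` only as `D_x b = c`, then `[∂/∂c, D_x] = ∂/∂b`. -/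
theorem pd_totalX_of_single {c b : Coord} (h : ∀ d, pd c (shift I d) = if d = b then 1 else 0) :
    pd c (totalX f) = totalX (pd c f) + pd b f := by
  rw [totalX, pd_vectorField, ← vectorField_single b f]
  have : (fun d => pd c (shift I d)) = Pi.single b 1 := by
    funext d
    rw [h, Pi.single_apply]
  rw [this]

@[simp] theorem pd_t_totalX : pd .t (totalX f) = totalX (pd .t f) :=
  pd_totalX_of_forall f fun d => by cases d <;> simp [shift]
@[simp] theorem pd_u_zero_totalX : pd (.u 0) (totalX f) = totalX (pd (.u 0) f) :=
  pd_totalX_of_forall f fun d => by cases d <;> simp [shift]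
@[simp] theorem pd_re_zero_totalX : pd (.re 0) (totalX f) = totalX (pd (.re 0) f) :=
  pd_totalX_of_forall f fun d => by cases d <;> simp [shift]
@[simp] theorem pd_im_zero_totalX : pd (.im 0) (totalX f) = totalX (pd (.im 0) f) :=
  pd_totalX_of_forall f fun d => by cases d <;> simp [shift]
theorem pd_u_succ_totalX :
    pd (.u (n + 1)) (totalX f) = totalX (pd (.u (n + 1)) f) + pd (.u n) f :=
  pd_totalX_of_single f fun d => by cases d <;> simp [shift, eq_comm]
theorem pd_re_succ_totalX :
    pd (.re (n + 1)) (totalX f) = totalX (pd (.re (n + 1)) f) + pd (.re n) f :=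
  pd_totalX_of_single f fun d => by cases d <;> simp [shift, eq_comm]
theorem pd_im_succ_totalX :
    pd (.im (n + 1)) (totalX f) = totalX (pd (.im (n + 1)) f) + pd (.im n) f :=
  pd_totalX_of_single f fun d => by cases d <;> simp [shift, eq_comm]

@[simp] theorem pd_u_one_totalX : pd (.u 1) (totalX f) = totalX (pd (.u 1) f) + pd (.u 0) f :=
  pd_u_succ_totalX 0 f
@[simp] theorem pd_u_two_totalX : pd (.u 2) (totalX f) = totalX (pd (.u 2) f) + pd (.u 1) f :=
  pd_u_succ_totalX 1 f
@[simp] theorem pd_u_three_totalX : pd (.u 3) (totalX f) = totalX (pd (.u 3) f) + pd (.u 2) f :=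
  pd_u_succ_totalX 2 f
@[simp] theorem pd_re_one_totalX : pd (.re 1) (totalX f) = totalX (pd (.re 1) f) + pd (.re 0) f :=
  pd_re_succ_totalX 0 f
@[simp] theorem pd_re_two_totalX : pd (.re 2) (totalX f) = totalX (pd (.re 2) f) + pd (.re 1) f :=
  pd_re_succ_totalX 1 f
@[simp] theorem pd_im_one_totalX : pd (.im 1) (totalX f) = totalX (pd (.im 1) f) + pd (.im 0) f :=
  pd_im_succ_totalX 0 f
@[simp] theorem pd_im_two_totalX : pd (.im 2) (totalX f) = totalX (pd (.im 2) f) + pd (.im 1) f :=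
  pd_im_succ_totalX 1 f

end

theorem totalX_eq_sum {f : DiffFun I} {n : ℕ} (h : OrderLE n f) :
    totalX f = pd .x f + (∑ m ∈ Finset.range (n + 1), coord (.u (m + 1)) * pd (.u m) f +
      (∑ m ∈ Finset.range (n + 1), coord (.re (m + 1)) * pd (.re m) f +
        ∑ m ∈ Finset.range (n + 1), coord (.im (m + 1)) * pd (.im m) f)) := by
  rw [totalX, vectorField_eq_sum _ h, Coord.sum_upTo]
  simp [shift]

/-- If the total derivative of `f` does not depend on the derivatives of `u`, `ψ` of order `> n`,
then `f` does not depend on those of order `≥ n`. This is the statement for one field at a time,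
with `v` ranging over the derivatives of the field. -/
theorem pd_eq_zero_of_totalX {v : ℕ → Coord} (hv : ∀ n, (v n).order = n)
    (hc : ∀ n (f : DiffFun I), pd (v (n + 1)) (totalX f) = totalX (pd (v (n + 1)) f) + pd (v n) f)
    {f : DiffFun I} {n : ℕ} (h : ∀ m, n < m → pd (v m) (totalX f) = 0) :
    ∀ m, n ≤ m → pd (v m) f = 0 := by
  obtain ⟨N, hN⟩ := f.exists_orderLE
  have key : ∀ i m, n ≤ m → N < m + i → pd (v m) f = 0 := by
    intro i
    induction i with
    | zero => exact fun m _ hm => hN _ (by rw [hv]; omega)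
    | succ i ih =>
      intro m hnm hm
      have h1 := h (m + 1) (by omega)
      rwa [hc, ih (m + 1) (by omega) (by omega), map_zero, zero_add] at h1
  exact fun m hm => key (N + 1) m hm (by omega)

theorem pd_u_eq_zero_of_totalX {f : DiffFun I} {n : ℕ}
    (h : ∀ m, n < m → pd (.u m) (totalX f) = 0) : ∀ m, n ≤ m → pd (.u m) f = 0 :=
  pd_eq_zero_of_totalX (v := .u) (fun _ => rfl) pd_u_succ_totalX h

theorem pd_re_eq_zero_of_totalX {f : DiffFun I} {n : ℕ}
    (h : ∀ m, n < m → pd (.re m) (totalX f) = 0) : ∀ m, n ≤ m → pd (.re m) f = 0 :=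
  pd_eq_zero_of_totalX (v := .re) (fun _ => rfl) pd_re_succ_totalX h

theorem pd_im_eq_zero_of_totalX {f : DiffFun I} {n : ℕ}
    (h : ∀ m, n < m → pd (.im m) (totalX f) = 0) : ∀ m, n ≤ m → pd (.im m) f = 0 :=
  pd_eq_zero_of_totalX (v := .im) (fun _ => rfl) pd_im_succ_totalX h

/-- If the total derivative of `f` has order at most `n + 1`, then `f` has order at most `n`. -/
theorem orderLE_of_totalX {f : DiffFun I} {n : ℕ} (h : OrderLE (n + 1) (totalX f)) :
    OrderLE n f := by
  intro c hc
  cases c with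
  | t => simp [Coord.order] at hc
  | x => simp [Coord.order] at hc
  | u m => exact pd_u_eq_zero_of_totalX (n := n + 1) (fun m hm => h _ hm) m hc
  | re m => exact pd_re_eq_zero_of_totalX (n := n + 1) (fun m hm => h _ hm) m hc
  | im m => exact pd_im_eq_zero_of_totalX (n := n + 1) (fun m hm => h _ hm) m hc

/-- The kernel of `D_x` consists of the functions of `t`. -/
theorem pd_eq_zero_of_totalX_eq_zero {f : DiffFun I} (h : totalX f = 0) {c : Coord}
    (hc : c ≠ .t) : pd c f = 0 := by
  have h0 : ∀ c : Coord, pd c (totalX f) = 0 := fun c => by rw [h, map_zero]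
  have hu := pd_u_eq_zero_of_totalX (f := f) (n := 0) fun m _ => h0 _
  have hr := pd_re_eq_zero_of_totalX (f := f) (n := 0) fun m _ => h0 _
  have hi := pd_im_eq_zero_of_totalX (f := f) (n := 0) fun m _ => h0 _
  obtain ⟨N, hN⟩ := f.exists_orderLE
  cases c with
  | t => exact absurd rfl hc
  | x =>
    rw [totalX_eq_sum hN] at h
    simpa [hu, hr, hi] using h
  | u m => exact hu m (Nat.zero_le m)
  | re m => exact hr m (Nat.zero_le m)
  | im m => exact hi m (Nat.zero_le m)

/-- For a function of `t`, `x` only, `D_x` is the partial derivative. -/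
theorem totalX_eq_pd_x {f : DiffFun I} (h : ∀ c, c ≠ .t → c ≠ .x → pd c f = 0) :
    totalX f = pd .x f := by
  have h0 : OrderLE 0 f := fun c hc => h c (by rintro rfl; simp [Coord.order] at hc)
    (by rintro rfl; simp [Coord.order] at hc)
  rw [totalX_eq_sum h0]
  simp [h]

/-! ### Null Lagrangians -/

/-- The density `T` of order one is annihilated by the Euler operators of `u`, `Re ψ`, `Im ψ`. -/
structure IsNull (T : DiffFun I) : Prop where
  order : OrderLE 1 T
  u : pd (.u 0) T = totalX (pd (.u 1) T)
  re : pd (.re 0) T = totalX (pd (.re 1) T)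
  im : pd (.im 0) T = totalX (pd (.im 1) T)

theorem OrderLE.sub {f g : DiffFun I} {n : ℕ} (hf : OrderLE n f) (hg : OrderLE n g) :
    OrderLE n (f - g) := fun c hc => by rw [map_sub, hf c hc, hg c hc, sub_zero]

theorem OrderLE.totalX {f : DiffFun I} {n : ℕ} (hf : OrderLE n f) :
    OrderLE (n + 1) (DiffFun.totalX f) := by
  intro c hc
  cases c with
  | t => simp [Coord.order] at hc
  | x => simp [Coord.order] at hc
  | u m | re m | im m =>
    obtain ⟨m, rfl⟩ : ∃ i, m = i + 1 := ⟨m - 1, by simp only [Coord.order] at hc; omega⟩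
    simp only [pd_u_succ_totalX, pd_re_succ_totalX, pd_im_succ_totalX]
    simp only [Coord.order] at hc
    rw [hf _ (by simp only [Coord.order]; omega), hf _ (by simp only [Coord.order]; omega),
      map_zero, zero_add]

/-- A total derivative of order at most one is a null Lagrangian. -/
theorem isNull_totalX {Θ : DiffFun I} (h : OrderLE 1 (totalX Θ)) : IsNull (totalX Θ) := by
  have h0 := orderLE_of_totalX h
  have hu : pd (.u 1) Θ = 0 := h0 _ (by simp [Coord.order])
  have hr : pd (.re 1) Θ = 0 := h0 _ (by simp [Coord.order])
  have hi : pd (.im 1) Θ = 0 := h0 _ (by simp [Coord.order])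
  exact ⟨h, by simp [hu], by simp [hr], by simp [hi]⟩

theorem IsNull.sub {T T' : DiffFun I} (h : IsNull T) (h' : IsNull T') : IsNull (T - T') :=
  ⟨h.order.sub h'.order, by simp only [map_sub, h.u, h'.u], by simp only [map_sub, h.re, h'.re],
    by simp only [map_sub, h.im, h'.im]⟩

theorem OrderLE.primitive {f : DiffFun I} {n : ℕ} (hf : OrderLE n f) (c : Coord)
    (hc : c.order ≤ n) : OrderLE n (primitive c f) := by
  intro d hd
  rw [pd_primitive_of_ne (by rintro rfl; omega), hf d hd, primitive_zero]

/-- A null Lagrangian is affine in the first-order coordinates. -/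
theorem IsNull.pd_pd {T : DiffFun I} (h : IsNull T) {c d : Coord} (hc : 0 < c.order)
    (hd : 0 < d.order) : pd d (pd c T) = 0 := by
  by_cases hd1 : 1 < d.order
  · rw [pd_comm, h.order d hd1, map_zero]
  by_cases hc1 : 1 < c.order
  · rw [h.order c hc1, map_zero]
  have hu := h.u
  have hr := h.re
  have hi := h.im
  have z : ∀ b c : Coord, 1 < b.order → pd b (pd c T) = 0 := fun b c hb => by
    rw [pd_comm, h.order b hb, map_zero]
  have zu := fun c => z (.u 2) c (by simp [Coord.order])
  have zr := fun c => z (.re 2) c (by simp [Coord.order])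
  have zi := fun c => z (.im 2) c (by simp [Coord.order])
  have key : ∀ c ∈ ({.u 1, .re 1, .im 1} : Set Coord), ∀ e : Coord,
      pd e T = totalX (pd c T) → ∀ d ∈ ({.u 1, .re 1, .im 1} : Set Coord), pd d (pd c T) = 0 := by
    rintro c - e he d (rfl | rfl | rfl)
    · simpa [zu] using (congrArg (pd (.u 2)) he).symm
    · simpa [zr] using (congrArg (pd (.re 2)) he).symm
    · simpa [zi] using (congrArg (pd (.im 2)) he).symm
  have mem : ∀ c : Coord, 0 < c.order → ¬ 1 < c.order →
      c ∈ ({.u 1, .re 1, .im 1} : Set Coord) := by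
    intro c h0 h1
    have h1 : c.order = 1 := by omega
    cases c <;> simp_all [Coord.order]
  have hcm := mem c hc hc1
  have hdm := mem d hd hd1
  obtain rfl | rfl | rfl := hcm
  · exact key _ (by simp) _ hu d hdm
  · exact key _ (by simp) _ hr d hdm
  · exact key _ (by simp) _ hi d hdm

/-- A null Lagrangian of order one is a total derivative. -/
theorem IsNull.exists_eq_totalX {T : DiffFun I} (h : IsNull T) : ∃ Θ, T = totalX Θ := by
  -- subtracting total derivatives removes `u_x`, `Re ψ_x`, `Im ψ_x` from the density in turn
  have step (T : DiffFun I) (h : IsNull T) (c c' : Coord) (h0 : c.order = 0) (h1 : c'.order = 1)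
      (hcomm : ∀ f : DiffFun I, pd c' (totalX f) = totalX (pd c' f) + pd c f) :
      IsNull (T - totalX (primitive c (pd c' T))) ∧
      pd c' (T - totalX (primitive c (pd c' T))) = 0 ∧
      ∀ d d' : Coord, d'.order = 1 → d ≠ c → pd d T = 0 → pd d' T = 0 →
        (∀ f : DiffFun I, pd d' (totalX f) = totalX (pd d' f) + pd d f) →
        pd d' (T - totalX (primitive c (pd c' T))) = 0 := by
    have hΘ : OrderLE 0 (primitive c (pd c' T)) := by
      refine OrderLE.primitive (fun d hd => ?_) c h0.le
      exact h.pd_pd (by omega) hd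
    refine ⟨h.sub (isNull_totalX hΘ.totalX), ?_, fun d d' h1' hdc hd hd' hcomm' => ?_⟩
    · rw [map_sub, hcomm, pd_primitive_self, hΘ _ (by omega), map_zero, zero_add, sub_self]
    · rw [map_sub, hcomm', hΘ _ (by omega), pd_primitive_of_ne hdc, pd_comm, hd, hd', map_zero,
        map_zero, primitive_zero, zero_add, sub_self]
  obtain ⟨n1, e1, -⟩ := step T h (.u 0) (.u 1) rfl rfl pd_u_one_totalX
  set Θ₁ := primitive (.u 0) (pd (.u 1) T)
  have e1' : pd (.u 0) (T - totalX Θ₁) = 0 := by rw [n1.u, e1, map_zero]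
  obtain ⟨n2, e2, k2⟩ := step _ n1 (.re 0) (.re 1) rfl rfl pd_re_one_totalX
  have f2 := k2 (.u 0) (.u 1) rfl (by simp) e1' e1 pd_u_one_totalX
  set Θ₂ := primitive (.re 0) (pd (.re 1) (T - totalX Θ₁))
  have e2' : pd (.re 0) (T - totalX Θ₁ - totalX Θ₂) = 0 := by rw [n2.re, e2, map_zero]
  have f2' : pd (.u 0) (T - totalX Θ₁ - totalX Θ₂) = 0 := by rw [n2.u, f2, map_zero]
  obtain ⟨n3, e3, k3⟩ := step _ n2 (.im 0) (.im 1) rfl rfl pd_im_one_totalX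
  have f3 := k3 (.u 0) (.u 1) rfl (by simp) f2' f2 pd_u_one_totalX
  have g3 := k3 (.re 0) (.re 1) rfl (by simp) e2' e2 pd_re_one_totalX
  set Θ₃ := primitive (.im 0) (pd (.im 1) (T - totalX Θ₁ - totalX Θ₂))
  set T₃ := T - totalX Θ₁ - totalX Θ₂ - totalX Θ₃ with hT₃
  have hz : ∀ c : Coord, c ≠ .t → c ≠ .x → pd c T₃ = 0 := by
    intro c ht hx
    by_cases hc : 1 < c.order
    · exact n3.order c hc
    cases c with
    | t => exact absurd rfl ht
    | x => exact absurd rfl hx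
    | u m | re m | im m =>
      obtain rfl | rfl : m = 0 ∨ m = 1 := by simp only [Coord.order] at hc; omega
      · first
          | rw [n3.u, f3, map_zero]
          | rw [n3.re, g3, map_zero]
          | rw [n3.im, e3, map_zero]
      · assumption
  refine ⟨Θ₁ + Θ₂ + Θ₃ + primitive .x T₃, ?_⟩
  have h4 : totalX (primitive .x T₃) = T₃ := by
    rw [totalX_eq_pd_x fun c ht hx => ?_, pd_primitive_self]
    rw [pd_primitive_of_ne hx, hz c ht hx, primitive_zero]
  rw [map_add, map_add, map_add, h4, hT₃]
  ring

end DiffFun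

/-! ### The power `u ^ p` -/

theorem PowerSmoothAt.contDiffAt {p v : ℝ} (h : PowerSmoothAt p v) (n : ℕ) :
    ContDiffAt ℝ ∞ (fun r : ℝ => r ^ (p + n)) v := by
  rcases eq_or_ne v 0 with rfl | hv
  · obtain ⟨m, rfl⟩ : ∃ m : ℕ, p = m := by
      rcases h with h | h | h
      · exact absurd h (lt_irrefl _)
      · exact absurd h.1 (lt_irrefl _)
      · exact h.2
    have : (fun r : ℝ => r ^ ((m : ℝ) + n)) = fun r => r ^ (m + n) := by
      funext r
      rw [← Nat.cast_add, Real.rpow_natCast]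
    rw [this]
    fun_prop
  · exact Real.contDiffAt_rpow_const_of_ne hv

theorem AdmissibleRange.openInterval {p : ℝ} {I : Set ℝ} (h : AdmissibleRange p I) :
    OpenInterval I := ⟨h.isOpen, h.ordConnected, h.nonempty⟩

theorem AdmissibleRange.pos_of_mem_zero {p : ℝ} {I : Set ℝ} (h : AdmissibleRange p I) (hp : p ≠ 0)
    (h0 : (0 : ℝ) ∈ I) : 0 < p := by
  rcases h.power 0 h0 with h | h | ⟨-, n, rfl⟩
  · exact absurd h (lt_irrefl _)
  · exact absurd h.1 (lt_irrefl _)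
  · exact lt_of_le_of_ne n.cast_nonneg hp.symm

theorem AdmissibleRange.isDiffFunction_rpow {p : ℝ} {I : Set ℝ} (h : AdmissibleRange p I) (n N : ℕ) :
    IsDiffFunction I N fun j => j.u 0 ^ (p + n) :=
  ⟨fun q => q.2.2.1 0 ^ (p + n), fun q hq => (((h.power _ hq).contDiffAt n).comp q
    (f := fun q : FinJet N => q.2.2.1 0) (by fun_prop)).contDiffWithinAt, fun _ _ => rfl⟩

namespace DiffFun

variable {I : Set ℝ} {p : ℝ}

/-- The power `u ^ p` as a differential function. -/
noncomputable def upow (h : AdmissibleRange p I) : DiffFun I :=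
  ofJet (fun j => j.u 0 ^ p) ⟨0, by simpa using h.isDiffFunction_rpow 0 0⟩

variable (h : AdmissibleRange p I)

theorem upow_apply (j : jetDomain I) : upow h j = j.1.u 0 ^ p := rfl

theorem upow_eq_coord (hp : p = 1) : upow h = coord (.u 0) := by
  subst hp
  exact DFunLike.ext _ _ fun j => by rw [upow_apply, Real.rpow_one]; rfl

variable [OpenInterval I]

@[simp] theorem pd_upow_of_ne {c : Coord} (hc : c ≠ .u 0) : pd c (upow h) = 0 := by
  refine DFunLike.ext _ _ fun ⟨j, hj⟩ => ?_
  have h1 : ∀ j ∈ jetDomain I, extend (upow h) j = Coord.val (.u 0) j ^ p :=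
    fun j hj => extend_of_mem _ hj
  rw [pd_apply, lineDeriv_congr h1 hj, lineDeriv, zero_apply]
  simp [Coord.val_add, Coord.val_smul, Coord.val_vec, hc]

/-- `u ∂(u ^ p)/∂u = p u ^ p`, which characterises the power without dividing by `u`. -/
theorem coord_mul_pd_upow (hp : p ≠ 0) :
    coord (.u 0) * pd (.u 0) (upow h) = algebraMap ℝ _ p * upow h := by
  refine DFunLike.ext _ _ fun ⟨j, hj⟩ => ?_
  have h1 : ∀ j ∈ jetDomain I, extend (upow h) j = Coord.val (.u 0) j ^ p :=
    fun j hj => extend_of_mem _ hj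
  simp only [mul_apply, coord_apply, algebraMap_apply, upow_apply]
  rw [pd_apply, lineDeriv_congr h1 hj, lineDeriv]
  simp only [Coord.val_add, Coord.val_smul, Coord.val_vec, if_true, mul_one]
  change Coord.val (.u 0) j * _ = p * Coord.val (.u 0) j ^ p
  have hv : Coord.val (.u 0) j ∈ I := hj
  rcases eq_or_ne (Coord.val (.u 0) j) 0 with h0 | h0
  · rw [h0, zero_mul, Real.zero_rpow hp, mul_zero]
  · have h2 : HasDerivAt (fun s : ℝ => (Coord.val (.u 0) j + s) ^ p)
        (p * Coord.val (.u 0) j ^ (p - 1)) 0 := by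
      have := HasDerivAt.comp_const_add (Coord.val (.u 0) j) 0
        (f := fun r : ℝ => r ^ p) (f' := p * Coord.val (.u 0) j ^ (p - 1))
        (by simpa using Real.hasDerivAt_rpow_const (Or.inl h0))
      exact this
    rw [h2.deriv, Real.rpow_sub_one h0]
    field_simp

/-- The power `u ^ p` is not a zero divisor. -/
theorem eq_zero_of_upow_mul_eq_zero {f : DiffFun I} (hf : upow h * f = 0) : f = 0 := by
  have h1 : ∀ j : jetDomain I, j.1.u 0 ≠ 0 → f j = 0 := by
    intro j hj
    have := DFunLike.congr_fun hf j
    rw [mul_apply, upow_apply, zero_apply] at this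
    rcases mul_eq_zero.1 this with h2 | h2
    · rcases hj.lt_or_gt with h3 | h3
      · obtain ⟨m, rfl⟩ : ∃ m : ℤ, p = m := by
          rcases h.power _ j.2 with h4 | h4 | h4
          · exact absurd h4 h3.not_gt
          · exact h4.2
          · exact absurd h4.1 hj
        rw [Real.rpow_intCast] at h2
        exact absurd h2 (zpow_ne_zero _ hj)
      · exact absurd h2 (Real.rpow_pos_of_pos h3 p).ne'
    · exact h2
  refine DFunLike.ext _ _ fun ⟨j, hj⟩ => ?_
  by_cases h0 : j.u 0 = 0
  · -- at `u = 0` by continuity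
    have hc : ContinuousAt (fun s : ℝ => extend f (j + s • Coord.vec (.u 0))) 0 :=
      HasDerivAt.continuousAt (f.hasLineDerivAt hj (Coord.vec (.u 0)))
    have h2 : Filter.Tendsto (fun s : ℝ => extend f (j + s • Coord.vec (.u 0)))
        (nhdsWithin 0 {0}ᶜ) (nhds (extend f j)) := by
      simpa using hc.tendsto.mono_left nhdsWithin_le_nhds
    have h3 : Filter.Tendsto (fun s : ℝ => extend f (j + s • Coord.vec (.u 0)))
        (nhdsWithin 0 {0}ᶜ) (nhds 0) := by
      refine tendsto_const_nhds.congr' ?_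
      filter_upwards [self_mem_nhdsWithin,
        nhdsWithin_le_nhds (eventually_add_smul_mem hj (Coord.vec (.u 0)))] with s hs hs'
      rw [extend_of_mem _ hs', h1]
      change Coord.val (.u 0) _ ≠ 0
      rw [Coord.val_add, Coord.val_smul, Coord.val_vec, if_pos rfl,
        show Coord.val (.u 0) j = 0 from h0]
      simpa using hs
    have := tendsto_nhds_unique h2 h3
    rwa [extend_of_mem _ hj] at this
  · exact h1 _ h0

theorem orderLE_upow : OrderLE 0 (upow h) := fun c hc =>
  pd_upow_of_ne h (by rintro rfl; simp [Coord.order] at hc)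

@[simp] theorem totalX_upow : totalX (upow h) = coord (.u 1) * pd (.u 0) (upow h) := by
  rw [totalX_eq_sum (orderLE_upow h)]
  simp

end DiffFun

/-! ### The gKdV-LS system in the ring of differential functions -/

namespace DiffFun

variable {I : Set ℝ} {P : Params} (h : AdmissibleRange P.p I)

/-- A real constant as a differential function. -/
noncomputable abbrev const (I : Set ℝ) (a : ℝ) : DiffFun I := algebraMap ℝ (DiffFun I) a

theorem eq_zero_of_const_mul {a : ℝ} (ha : a ≠ 0) {f : DiffFun I} (hf : const I a * f = 0) :
    f = 0 := by
  have h1 : const I a⁻¹ * const I a = 1 := by rw [← map_mul, inv_mul_cancel₀ ha, map_one]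
  linear_combination const I a⁻¹ * hf - f * h1

theorem const_inv_add_one_mul {p : ℝ} (hp1 : p ≠ -1) :
    const I (p + 1)⁻¹ * (const I p + 1) = 1 := by
  have : p + 1 ≠ 0 := fun h => hp1 (by linarith)
  rw [← map_one (algebraMap ℝ (DiffFun I)), ← map_add, ← map_mul, inv_mul_cancel₀ this]

theorem eq_zero_of_two_mul {f : DiffFun I} (hf : 2 * f = 0) : f = 0 :=
  eq_zero_of_const_mul two_ne_zero
    (by rwa [show const I 2 = 2 from map_ofNat (algebraMap ℝ (DiffFun I)) 2])

theorem eq_zero_of_three_mul {f : DiffFun I} (hf : 3 * f = 0) : f = 0 :=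
  eq_zero_of_const_mul three_ne_zero
    (by rwa [show const I 3 = 3 from map_ofNat (algebraMap ℝ (DiffFun I)) 3])

/-- `u_t` as eliminated through the system. -/
noncomputable def utFun : DiffFun I :=
  -(const I P.s₁ * upow h * coord (.u 1) + coord (.u 3) +
    const I P.s₂ * (2 * (coord (.re 0) * coord (.re 1) + coord (.im 0) * coord (.im 1))))

/-- `Re ψ_t` as eliminated through the system. -/
noncomputable def reψtFun (P : Params) (I : Set ℝ) : DiffFun I :=
  -(coord (.im 2) + const I P.k * coord (.u 0) * coord (.im 0))

/-- `Im ψ_t` as eliminated through the system. -/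
noncomputable def imψtFun (P : Params) (I : Set ℝ) : DiffFun I :=
  coord (.re 2) + const I P.k * coord (.u 0) * coord (.re 0)

variable [OpenInterval I]

/-- The components of the total derivative `D_t` on formal solutions: `D_xⁿ u_t` and `D_xⁿ ψ_t` for
the coordinates `∂ₓⁿ u` and `∂ₓⁿ ψ`. -/
noncomputable def evolution : Coord → DiffFun I
  | .t => 1
  | .x => 0
  | .u n => totalX^[n] (utFun h)
  | .re n => totalX^[n] (reψtFun P I)
  | .im n => totalX^[n] (imψtFun P I)

/-- The total derivative `D_t` on formal solutions. -/
noncomputable def totalT : Derivation ℝ (DiffFun I) (DiffFun I) := vectorField (evolution h)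

theorem totalT_coord (c : Coord) : totalT h (coord c : DiffFun I) = evolution h c :=
  vectorField_coord _ _

@[simp] theorem totalT_t : totalT h (coord .t) = 1 := totalT_coord h _
@[simp] theorem totalT_x : totalT h (coord .x) = 0 := totalT_coord h _
@[simp] theorem totalT_u_zero : totalT h (coord (.u 0)) = utFun h := totalT_coord h _
@[simp] theorem totalT_re_zero : totalT h (coord (.re 0)) = reψtFun P I := totalT_coord h _
@[simp] theorem totalT_im_zero : totalT h (coord (.im 0)) = imψtFun P I := totalT_coord h _
@[simp] theorem totalT_u_one : totalT h (coord (.u 1)) = totalX (utFun h) := totalT_coord h _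
@[simp] theorem totalT_re_one : totalT h (coord (.re 1)) = totalX (reψtFun P I) := totalT_coord h _
@[simp] theorem totalT_im_one : totalT h (coord (.im 1)) = totalX (imψtFun P I) := totalT_coord h _

/-- The total derivatives `D_t` and `D_x` commute on formal solutions. -/
theorem totalT_totalX (f : DiffFun I) : totalT h (totalX f) = totalX (totalT h f) := by
  rw [← sub_eq_zero, totalT, totalX, vectorField_comm]
  refine Eq.trans ?_ (vectorField_zero_apply f)
  congr 2
  funext d
  change totalT h (shift I d) - totalX (evolution h d) = 0
  cases d with
  | t => simp [shift, evolution]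
  | x => simp [shift, evolution]
  | u n | re n | im n =>
    simp only [shift, totalT_coord, evolution, Function.iterate_succ_apply', sub_self]

theorem totalT_eq_of_orderLE_one {f : DiffFun I} (hf : OrderLE 1 f) :
    totalT h f = pd .t f + (utFun h * pd (.u 0) f + totalX (utFun h) * pd (.u 1) f) +
      (reψtFun P I * pd (.re 0) f + totalX (reψtFun P I) * pd (.re 1) f) +
      (imψtFun P I * pd (.im 0) f + totalX (imψtFun P I) * pd (.im 1) f) := by
  rw [totalT, vectorField_eq_sum _ hf, Coord.sum_upTo]
  simp only [evolution, Finset.sum_range_succ, Finset.sum_range_zero, Function.iterate_zero, id,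
    Function.iterate_one]
  ring

end DiffFun

namespace DiffFun

variable {I : Set ℝ} [OpenInterval I] {P : Params} (h : AdmissibleRange P.p I)

/-! ### Orders -/

section Order

variable {f g : DiffFun I} {n : ℕ}

theorem OrderLE.add (hf : OrderLE n f) (hg : OrderLE n g) : OrderLE n (f + g) := fun c hc => by
  rw [map_add, hf c hc, hg c hc, add_zero]

theorem OrderLE.neg (hf : OrderLE n f) : OrderLE n (-f) := fun c hc => by
  rw [map_neg, hf c hc, neg_zero]

theorem OrderLE.mul (hf : OrderLE n f) (hg : OrderLE n g) : OrderLE n (f * g) := fun c hc => by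
  rw [Derivation.leibniz, hf c hc, hg c hc, smul_zero, smul_zero, add_zero]

theorem orderLE_const (a : ℝ) : OrderLE n (const I a) := fun _ _ => Derivation.map_algebraMap _ _

theorem orderLE_coord (c : Coord) (hc : c.order ≤ n) : OrderLE n (coord c : DiffFun I) :=
  fun d hd => by rw [pd_coord, if_neg (by rintro rfl; omega)]

end Order

/-! ### The Euler operators and the reduced conservation law -/

/-- The Euler operator of `u` on densities of order one. -/
noncomputable def eulerU (T : DiffFun I) : DiffFun I := pd (.u 0) T - totalX (pd (.u 1) T)

/-- The Euler operator of `Re ψ` on densities of order one. -/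
noncomputable def eulerRe (T : DiffFun I) : DiffFun I := pd (.re 0) T - totalX (pd (.re 1) T)

/-- The Euler operator of `Im ψ` on densities of order one. -/
noncomputable def eulerIm (T : DiffFun I) : DiffFun I := pd (.im 0) T - totalX (pd (.im 1) T)

/-- The conservation law for a density `T` of order one, after summation by parts: the factors of
`u_t`, `Re ψ_t`, `Im ψ_t` are the Euler operators of `T`. -/
structure ReducedLaw (T Y : DiffFun I) : Prop where
  order : OrderLE 1 T
  eq : pd .t T + utFun h * eulerU T + reψtFun P I * eulerRe T + imψtFun P I * eulerIm T +
    totalX Y = 0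

/-- The new flux is `X + u_t ∂T/∂u_x + Re ψ_t ∂T/∂(Re ψ_x) + Im ψ_t ∂T/∂(Im ψ_x)`. -/
theorem exists_reducedLaw {T X : DiffFun I} (hT : OrderLE 1 T)
    (hX : totalT h T + totalX X = 0) : ∃ Y, ReducedLaw h T Y := by
  refine ⟨X + (utFun h * pd (.u 1) T + reψtFun P I * pd (.re 1) T + imψtFun P I * pd (.im 1) T),
    hT, ?_⟩
  rw [← hX, totalT_eq_of_orderLE_one h hT, eulerU, eulerRe, eulerIm]
  simp only [map_add, Derivation.leibniz, smul_eq_mul]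
  ring

section Table

@[simp] theorem pd_const (c : Coord) (a : ℝ) : pd c (const I a) = 0 := Derivation.map_algebraMap _ _
@[simp] theorem pd_two (c : Coord) : pd c (2 : DiffFun I) = 0 := Derivation.map_natCast _ 2
@[simp] theorem totalX_two : totalX (2 : DiffFun I) = 0 := Derivation.map_natCast _ 2

@[simp] theorem pd_u_zero_utFun : pd (.u 0) (utFun h) =
    -(const I P.s₁ * pd (.u 0) (upow h) * coord (.u 1)) := by simp [utFun]; ring
@[simp] theorem pd_u_one_utFun : pd (.u 1) (utFun h) = -(const I P.s₁ * upow h) := by simp [utFun]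
@[simp] theorem pd_u_two_utFun : pd (.u 2) (utFun h) = 0 := by simp [utFun]
@[simp] theorem pd_u_three_utFun : pd (.u 3) (utFun h) = -1 := by simp [utFun]
@[simp] theorem pd_re_zero_utFun : pd (.re 0) (utFun h) = -(const I P.s₂ * (2 * coord (.re 1))) := by
  simp [utFun]
@[simp] theorem pd_re_one_utFun : pd (.re 1) (utFun h) = -(const I P.s₂ * (2 * coord (.re 0))) := by
  simp [utFun]
@[simp] theorem pd_im_one_utFun : pd (.im 1) (utFun h) = -(const I P.s₂ * (2 * coord (.im 0))) := by
  simp [utFun]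
@[simp] theorem pd_re_two_utFun : pd (.re 2) (utFun h) = 0 := by simp [utFun]
@[simp] theorem pd_im_two_utFun : pd (.im 2) (utFun h) = 0 := by simp [utFun]
@[simp] theorem pd_re_three_utFun : pd (.re 3) (utFun h) = 0 := by simp [utFun]
@[simp] theorem pd_im_three_utFun : pd (.im 3) (utFun h) = 0 := by simp [utFun]

@[simp] theorem pd_u_reψtFun (n : ℕ) : pd (.u n) (reψtFun P I) =
    if n = 0 then -(const I P.k * coord (.im 0)) else 0 := by
  by_cases hn : n = 0 <;> simp [reψtFun, hn, mul_comm]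
@[simp] theorem pd_re_reψtFun (n : ℕ) : pd (.re n) (reψtFun P I) = 0 := by simp [reψtFun]
@[simp] theorem pd_im_reψtFun (n : ℕ) : pd (.im n) (reψtFun P I) =
    if n = 2 then -1 else if n = 0 then -(const I P.k * coord (.u 0)) else 0 := by
  by_cases hn : n = 0
  · simp [reψtFun, hn]
  · by_cases hn' : n = 2 <;> simp [reψtFun, hn, hn']

@[simp] theorem pd_u_imψtFun (n : ℕ) : pd (.u n) (imψtFun P I) =
    if n = 0 then const I P.k * coord (.re 0) else 0 := by
  by_cases hn : n = 0 <;> simp [imψtFun, hn, mul_comm]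
@[simp] theorem pd_im_imψtFun (n : ℕ) : pd (.im n) (imψtFun P I) = 0 := by simp [imψtFun]
@[simp] theorem pd_re_imψtFun (n : ℕ) : pd (.re n) (imψtFun P I) =
    if n = 2 then 1 else if n = 0 then const I P.k * coord (.u 0) else 0 := by
  by_cases hn : n = 0
  · simp [imψtFun, hn]
  · by_cases hn' : n = 2 <;> simp [imψtFun, hn, hn']

variable {F : DiffFun I} (hF : OrderLE 1 F)
include hF
theorem OrderLE.pd_u_two : DiffFun.pd (.u 2) F = 0 := hF _ (by decide)
theorem OrderLE.pd_u_three : DiffFun.pd (.u 3) F = 0 := hF _ (by decide)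
theorem OrderLE.pd_re_two : DiffFun.pd (.re 2) F = 0 := hF _ (by decide)
theorem OrderLE.pd_re_three : DiffFun.pd (.re 3) F = 0 := hF _ (by decide)
theorem OrderLE.pd_im_two : DiffFun.pd (.im 2) F = 0 := hF _ (by decide)
theorem OrderLE.pd_im_three : DiffFun.pd (.im 3) F = 0 := hF _ (by decide)

end Table

@[simp] theorem pd_re_three_totalX (f : DiffFun I) :
    pd (.re 3) (totalX f) = totalX (pd (.re 3) f) + pd (.re 2) f := pd_re_succ_totalX 2 f
@[simp] theorem pd_im_three_totalX (f : DiffFun I) :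
    pd (.im 3) (totalX f) = totalX (pd (.im 3) f) + pd (.im 2) f := pd_im_succ_totalX 2 f

section Order

theorem orderLE_utFun : OrderLE 3 (utFun h) := by
  unfold utFun
  have h2 : OrderLE 3 (2 : DiffFun I) := fun _ _ => pd_two _
  exact ((((orderLE_const _).mul ((orderLE_upow h).mono (by simp))).mul
    (orderLE_coord _ (by decide))).add (orderLE_coord _ (by decide))).add
    ((orderLE_const _).mul (h2.mul (((orderLE_coord _ (by decide)).mul
    (orderLE_coord _ (by decide))).add ((orderLE_coord _ (by decide)).mul
    (orderLE_coord _ (by decide)))))) |>.neg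

theorem orderLE_reψtFun : OrderLE 3 (reψtFun P I) :=
  ((orderLE_coord _ (by decide)).add (((orderLE_const _).mul (orderLE_coord _ (by decide))).mul
    (orderLE_coord _ (by decide)))).neg

theorem orderLE_imψtFun : OrderLE 3 (imψtFun P I) :=
  (orderLE_coord _ (by decide)).add (((orderLE_const _).mul (orderLE_coord _ (by decide))).mul
    (orderLE_coord _ (by decide)))

end Order

namespace ReducedLaw

variable {h} {T Y : DiffFun I} (H : ReducedLaw h T Y)
include H

theorem totalX_eq : totalX Y = -(pd .t T + utFun h * eulerU T + reψtFun P I * eulerRe T +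
    imψtFun P I * eulerIm T) := eq_neg_of_add_eq_zero_right H.eq

theorem orderLE_totalX : OrderLE 3 (totalX Y) := by
  have hT := H.order
  have hE : ∀ c d : Coord, OrderLE 3 (pd c T - totalX (pd d T)) := fun c d =>
    ((hT.pd c).mono (by simp)).sub ((hT.pd d).totalX.mono (by simp))
  rw [H.totalX_eq]
  exact ((((hT.pd _).mono (by simp)).add ((orderLE_utFun h).mul (hE _ _))).add
    (orderLE_reψtFun.mul (hE _ _))).add (orderLE_imψtFun.mul (hE _ _)) |>.neg

/-- As `D_x Y` has order three in `u` and order two in `ψ`, the flux `Y` has one order less. -/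
theorem pd_u_flux {m : ℕ} (hm : 3 ≤ m) : pd (.u m) Y = 0 :=
  pd_u_eq_zero_of_totalX (fun _ hn => H.orderLE_totalX _ hn) m hm

theorem pd_re_flux {m : ℕ} (hm : 2 ≤ m) : pd (.re m) Y = 0 := by
  refine pd_re_eq_zero_of_totalX (n := 2) (fun n hn => ?_) m hm
  obtain rfl | hn := Nat.eq_or_lt_of_le hn
  · have hT := H.order
    rw [H.totalX_eq]
    simp [eulerU, eulerRe, eulerIm, OrderLE.pd_re_two, OrderLE.pd_re_three, hT, OrderLE.pd]
  · exact H.orderLE_totalX _ hn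

theorem pd_im_flux {m : ℕ} (hm : 2 ≤ m) : pd (.im m) Y = 0 := by
  refine pd_im_eq_zero_of_totalX (n := 2) (fun n hn => ?_) m hm
  obtain rfl | hn := Nat.eq_or_lt_of_le hn
  · have hT := H.order
    rw [H.totalX_eq]
    simp [eulerU, eulerRe, eulerIm, OrderLE.pd_im_two, OrderLE.pd_im_three, hT, OrderLE.pd]
  · exact H.orderLE_totalX _ hn

/-- The coefficient of `u_xxx` in the reduced conservation law. -/
theorem pd_u_two_flux : pd (.u 2) Y = eulerU T := by
  have h1 := congrArg (pd (.u 3)) H.eq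
  have hT := H.order
  simp [eulerU, eulerRe, eulerIm, OrderLE.pd_u_two, OrderLE.pd_u_three, hT, OrderLE.pd,
    H.pd_u_flux] at h1
  rw [eulerU]
  linear_combination h1

end ReducedLaw
end DiffFun

namespace DiffFun

variable {I : Set ℝ} [OpenInterval I] {P : Params} {h : AdmissibleRange P.p I}

namespace ReducedLaw

variable {T Y : DiffFun I} (H : ReducedLaw h T Y)
include H

/-! ### Symmetry of the second derivatives of the flux -/

/-- Like most identities below, this is the symmetry of a mixed second derivative of the flux `Y`,
whose first derivatives are coefficients of the reduced conservation law. -/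
theorem pd_re_one_pd_u_one : pd (.re 1) (pd (.u 1) T) = 0 := by
  have h1 := pd_comm (.re 2) (.u 2) Y
  have hT := H.order
  simpa [H.pd_u_two_flux, H.pd_re_flux, eulerU, OrderLE.pd_re_two, hT, OrderLE.pd] using h1

theorem pd_im_one_pd_u_one : pd (.im 1) (pd (.u 1) T) = 0 := by
  have h1 := pd_comm (.im 2) (.u 2) Y
  have hT := H.order
  simpa [H.pd_u_two_flux, H.pd_im_flux, eulerU, OrderLE.pd_im_two, hT, OrderLE.pd] using h1

theorem pd_u_one_pd_re_one : pd (.u 1) (pd (.re 1) T) = 0 := by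
  rw [pd_comm, H.pd_re_one_pd_u_one]

theorem pd_u_one_pd_im_one : pd (.u 1) (pd (.im 1) T) = 0 := by
  rw [pd_comm, H.pd_im_one_pd_u_one]

theorem pd_u_two_eulerU : pd (.u 2) (eulerU T) = -pd (.u 1) (pd (.u 1) T) := by
  simp [eulerU, OrderLE.pd_u_two, H.order, OrderLE.pd]

theorem pd_re_two_eulerU : pd (.re 2) (eulerU T) = 0 := by
  simp [eulerU, OrderLE.pd_re_two, H.order, OrderLE.pd, H.pd_re_one_pd_u_one]

theorem pd_im_two_eulerU : pd (.im 2) (eulerU T) = 0 := by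
  simp [eulerU, OrderLE.pd_im_two, H.order, OrderLE.pd, H.pd_im_one_pd_u_one]

theorem pd_u_two_eulerRe : pd (.u 2) (eulerRe T) = 0 := by
  simp [eulerRe, OrderLE.pd_u_two, H.order, OrderLE.pd, H.pd_u_one_pd_re_one]

theorem pd_u_two_eulerIm : pd (.u 2) (eulerIm T) = 0 := by
  simp [eulerIm, OrderLE.pd_u_two, H.order, OrderLE.pd, H.pd_u_one_pd_im_one]

theorem pd_u_one_flux :
    pd (.u 1) Y = -totalX (eulerU T) + pd (.u 1) (pd (.u 1) T) * utFun h := by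
  have h1 := congrArg (pd (.u 2)) H.eq
  have hT := H.order
  simp [OrderLE.pd_u_two, hT, OrderLE.pd, H.pd_u_two_flux, H.pd_u_two_eulerU, H.pd_u_two_eulerRe,
    H.pd_u_two_eulerIm] at h1
  linear_combination h1

theorem pd_re_one_flux : pd (.re 1) Y = pd (.re 1) (pd (.re 1) T) * reψtFun P I +
    pd (.re 1) (pd (.im 1) T) * imψtFun P I - eulerIm T := by
  have h1 := congrArg (pd (.re 2)) H.eq
  have hT := H.order
  simp [OrderLE.pd_re_two, hT, OrderLE.pd, H.pd_re_flux, H.pd_re_two_eulerU] at h1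
  have h2 : pd (.re 2) (eulerRe T) = -pd (.re 1) (pd (.re 1) T) := by
    simp [eulerRe, OrderLE.pd_re_two, H.order, OrderLE.pd]
  have h3 : pd (.re 2) (eulerIm T) = -pd (.re 1) (pd (.im 1) T) := by
    simp [eulerIm, OrderLE.pd_re_two, H.order, OrderLE.pd]
  linear_combination h1 - reψtFun P I * h2 - imψtFun P I * h3

theorem pd_im_one_flux : pd (.im 1) Y = pd (.im 1) (pd (.re 1) T) * reψtFun P I +
    pd (.im 1) (pd (.im 1) T) * imψtFun P I + eulerRe T := by
  have h1 := congrArg (pd (.im 2)) H.eq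
  have hT := H.order
  simp [OrderLE.pd_im_two, hT, OrderLE.pd, H.pd_im_flux, H.pd_im_two_eulerU] at h1
  have h2 : pd (.im 2) (eulerRe T) = -pd (.im 1) (pd (.re 1) T) := by
    simp [eulerRe, OrderLE.pd_im_two, H.order, OrderLE.pd]
  have h3 : pd (.im 2) (eulerIm T) = -pd (.im 1) (pd (.im 1) T) := by
    simp [eulerIm, OrderLE.pd_im_two, H.order, OrderLE.pd]
  linear_combination h1 - reψtFun P I * h2 - imψtFun P I * h3

theorem orderLE_pd_pd (c d : Coord) : OrderLE 1 (pd c (pd d T)) := (H.order.pd d).pd c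

theorem pd_re_one_pd_im_one : pd (.re 1) (pd (.im 1) T) = 0 := by
  have h1 := pd_comm (.re 2) (.re 1) Y
  simp [H.pd_re_one_flux, H.pd_re_flux, eulerIm, OrderLE.pd_re_two, H.order, OrderLE.pd,
    H.orderLE_pd_pd] at h1
  exact eq_zero_of_two_mul (by linear_combination h1)

theorem pd_im_one_pd_im_one : pd (.im 1) (pd (.im 1) T) = pd (.re 1) (pd (.re 1) T) := by
  have h1 := pd_comm (.re 2) (.im 1) Y
  simp [H.pd_im_one_flux, H.pd_re_flux, eulerRe, OrderLE.pd_re_two, H.order, OrderLE.pd,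
    H.orderLE_pd_pd] at h1
  linear_combination h1

theorem pd_im_one_pd_re_one : pd (.im 1) (pd (.re 1) T) = 0 := by
  rw [pd_comm, H.pd_re_one_pd_im_one]

theorem totalX_pd_u_one_pd_u_one : totalX (pd (.u 1) (pd (.u 1) T)) = 0 := by
  have h1 := pd_comm (.u 1) (.u 2) Y
  simp [H.pd_u_one_flux, H.pd_u_two_flux, OrderLE.pd_u_two, H.orderLE_pd_pd,
    H.pd_u_two_eulerU] at h1
  simp [eulerU, pd_comm (.u 1) (.u 0)] at h1
  exact eq_zero_of_three_mul (by linear_combination -h1)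

theorem totalX_pd_re_one_pd_re_one : totalX (pd (.re 1) (pd (.re 1) T)) = 0 := by
  have h1 := pd_comm (.re 1) (.im 1) Y
  have h2 : pd (.re 1) (pd (.re 1) (pd (.re 1) T)) = 0 := by
    rw [← H.pd_im_one_pd_im_one, pd_comm, H.pd_re_one_pd_im_one, map_zero]
  have h3 : pd (.im 1) (pd (.re 1) (pd (.re 1) T)) = 0 := by
    rw [pd_comm, H.pd_im_one_pd_re_one, map_zero]
  simp [H.pd_re_one_flux, H.pd_im_one_flux, H.pd_im_one_pd_im_one, H.pd_re_one_pd_im_one,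
    H.pd_im_one_pd_re_one, h2, h3] at h1
  simp [eulerRe, eulerIm, pd_comm (.re 1) (.re 0), pd_comm (.im 1) (.im 0),
    H.pd_im_one_pd_im_one] at h1
  exact eq_zero_of_two_mul (by linear_combination -h1)

theorem pd_re_one_eulerU : pd (.re 1) (eulerU T) = 0 := by
  have h1 := pd_comm (.re 2) (.u 1) Y
  have h2 : pd (.re 2) (eulerU T) = 0 := H.pd_re_two_eulerU
  simpa [H.pd_u_one_flux, H.pd_re_flux, OrderLE.pd_re_two, H.orderLE_pd_pd, h2] using h1

theorem pd_im_one_eulerU : pd (.im 1) (eulerU T) = 0 := by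
  have h1 := pd_comm (.im 2) (.u 1) Y
  have h2 : pd (.im 2) (eulerU T) = 0 := H.pd_im_two_eulerU
  simpa [H.pd_u_one_flux, H.pd_im_flux, OrderLE.pd_im_two, H.orderLE_pd_pd, h2] using h1

theorem pd_re_zero_pd_u_one : pd (.re 0) (pd (.u 1) T) = pd (.u 0) (pd (.re 1) T) := by
  have h1 := H.pd_re_one_eulerU
  simp [eulerU, H.pd_re_one_pd_u_one, pd_comm (.re 1) (.u 0)] at h1
  linear_combination -h1

theorem pd_im_zero_pd_u_one : pd (.im 0) (pd (.u 1) T) = pd (.u 0) (pd (.im 1) T) := by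
  have h1 := H.pd_im_one_eulerU
  simp [eulerU, H.pd_im_one_pd_u_one, pd_comm (.im 1) (.u 0)] at h1
  linear_combination -h1

theorem pd_u_one_eulerU : pd (.u 1) (eulerU T) = 0 := by
  simp [eulerU, H.totalX_pd_u_one_pd_u_one, pd_comm (.u 1) (.u 0)]

theorem pd_u_one_eulerRe : pd (.u 1) (eulerRe T) = 0 := by
  simp [eulerRe, H.pd_u_one_pd_re_one, pd_comm (.u 1) (.re 0), H.pd_re_zero_pd_u_one]

theorem pd_u_one_eulerIm : pd (.u 1) (eulerIm T) = 0 := by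
  simp [eulerIm, H.pd_u_one_pd_im_one, pd_comm (.u 1) (.im 0), H.pd_im_zero_pd_u_one]

theorem pd_re_one_eulerRe : pd (.re 1) (eulerRe T) = 0 := by
  simp [eulerRe, H.totalX_pd_re_one_pd_re_one, pd_comm (.re 1) (.re 0)]

theorem pd_im_one_eulerIm : pd (.im 1) (eulerIm T) = 0 := by
  simp [eulerIm, H.pd_im_one_pd_im_one, H.totalX_pd_re_one_pd_re_one, pd_comm (.im 1) (.im 0)]

end ReducedLaw
end DiffFun

namespace DiffFun

/-! ### The coefficients of the Euler operators -/

variable {I : Set ℝ} [OpenInterval I] {P : Params} {h : AdmissibleRange P.p I}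

/-- The coefficient of `u_x² / 2` in a density. -/
noncomputable def quadU (T : DiffFun I) : DiffFun I := pd (.u 1) (pd (.u 1) T)

/-- The coefficient of `|ψ_x|² / 2` in a density. -/
noncomputable def quadψ (T : DiffFun I) : DiffFun I := pd (.re 1) (pd (.re 1) T)

/-- The curl with respect to `ψ` of the coefficient of `ψ_x` in a density. -/
noncomputable def curlψ (T : DiffFun I) : DiffFun I := pd (.im 1) (eulerRe T)

/-- The coefficient of `u` in the Euler operator of `u`, apart from the powers of `u`. -/
noncomputable def linU (h : AdmissibleRange P.p I) (T : DiffFun I) : DiffFun I :=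
  pd (.u 0) (eulerU T) + const I P.s₁ * quadU T * upow h

theorem pd_im_one_eulerRe (T : DiffFun I) : pd (.im 1) (eulerRe T) = curlψ T := rfl

namespace ReducedLaw

variable {T Y : DiffFun I} (H : ReducedLaw h T Y)
include H

theorem pd_quadU {c : Coord} (hc : c ≠ .t) : pd c (quadU T) = 0 :=
  pd_eq_zero_of_totalX_eq_zero H.totalX_pd_u_one_pd_u_one hc

theorem pd_quadψ {c : Coord} (hc : c ≠ .t) : pd c (quadψ T) = 0 :=
  pd_eq_zero_of_totalX_eq_zero H.totalX_pd_re_one_pd_re_one hc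

theorem totalX_quadU : totalX (quadU T) = 0 := H.totalX_pd_u_one_pd_u_one
theorem totalX_quadψ : totalX (quadψ T) = 0 := H.totalX_pd_re_one_pd_re_one

theorem flux_u_one : pd (.u 1) Y = -totalX (eulerU T) + quadU T * utFun h := H.pd_u_one_flux
theorem flux_re_one : pd (.re 1) Y = quadψ T * reψtFun P I - eulerIm T := by
  rw [H.pd_re_one_flux, H.pd_re_one_pd_im_one, quadψ]; ring
theorem flux_im_one : pd (.im 1) Y = quadψ T * imψtFun P I + eulerRe T := by
  rw [H.pd_im_one_flux, H.pd_im_one_pd_re_one, H.pd_im_one_pd_im_one, quadψ]; ring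

theorem pd_u_two_eulerU_eq : pd (.u 2) (eulerU T) = -quadU T := H.pd_u_two_eulerU
theorem pd_re_two_eulerRe : pd (.re 2) (eulerRe T) = -quadψ T := by
  simp [eulerRe, OrderLE.pd_re_two, H.order, OrderLE.pd, quadψ]
theorem pd_im_two_eulerIm : pd (.im 2) (eulerIm T) = -quadψ T := by
  simp [eulerIm, OrderLE.pd_im_two, H.order, OrderLE.pd, quadψ, H.pd_im_one_pd_im_one]
theorem pd_im_two_eulerRe : pd (.im 2) (eulerRe T) = 0 := by
  simp [eulerRe, OrderLE.pd_im_two, H.order, OrderLE.pd, H.pd_im_one_pd_re_one]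
theorem pd_re_two_eulerIm : pd (.re 2) (eulerIm T) = 0 := by
  simp [eulerIm, OrderLE.pd_re_two, H.order, OrderLE.pd, H.pd_re_one_pd_im_one]

theorem curlψ_eq : curlψ T = pd (.re 0) (pd (.im 1) T) - pd (.im 0) (pd (.re 1) T) := by
  simp [curlψ, eulerRe, H.pd_im_one_pd_re_one, pd_comm (.im 1) (.re 0)]

theorem pd_re_one_eulerIm : pd (.re 1) (eulerIm T) = -curlψ T := by
  rw [H.curlψ_eq]
  simp [eulerIm, H.pd_re_one_pd_im_one, pd_comm (.re 1) (.im 0)]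

theorem pd_u_zero_eulerRe : pd (.u 0) (eulerRe T) = pd (.re 0) (eulerU T) := by
  simp [eulerU, eulerRe, H.pd_re_zero_pd_u_one, pd_comm (.re 0) (.u 0)]

theorem pd_u_zero_eulerIm : pd (.u 0) (eulerIm T) = pd (.im 0) (eulerU T) := by
  simp [eulerU, eulerIm, H.pd_im_zero_pd_u_one, pd_comm (.im 0) (.u 0)]

theorem orderLE_eulerU : OrderLE 2 (eulerU T) :=
  ((H.order.pd _).mono (by simp)).sub (H.order.pd _).totalX
theorem orderLE_eulerRe : OrderLE 2 (eulerRe T) :=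
  ((H.order.pd _).mono (by simp)).sub (H.order.pd _).totalX
theorem orderLE_eulerIm : OrderLE 2 (eulerIm T) :=
  ((H.order.pd _).mono (by simp)).sub (H.order.pd _).totalX

theorem pd_u_zero_curlψ : pd (.u 0) (curlψ T) = 0 := by
  rw [curlψ, pd_comm, H.pd_u_zero_eulerRe, pd_comm, H.pd_im_one_eulerU, map_zero]

theorem pd_re_one_curlψ : pd (.re 1) (curlψ T) = 0 := by
  rw [curlψ, pd_comm, H.pd_re_one_eulerRe, map_zero]

theorem pd_im_one_curlψ : pd (.im 1) (curlψ T) = 0 := by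
  rw [← neg_neg (curlψ T), ← H.pd_re_one_eulerIm, map_neg, pd_comm, H.pd_im_one_eulerIm, map_zero,
    neg_zero]

theorem pd_re_zero_eulerU :
    pd (.re 0) (eulerU T) = -(2 * const I P.s₂ * coord (.re 0) * quadU T) := by
  have h1 := pd_comm (.re 1) (.u 1) Y
  simp [H.flux_u_one, H.flux_re_one, H.pd_quadU, H.pd_quadψ, H.pd_re_one_eulerU,
    H.pd_u_one_eulerIm] at h1
  linear_combination -h1

theorem pd_im_zero_eulerU :
    pd (.im 0) (eulerU T) = -(2 * const I P.s₂ * coord (.im 0) * quadU T) := by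
  have h1 := pd_comm (.im 1) (.u 1) Y
  simp [H.flux_u_one, H.flux_im_one, H.pd_quadU, H.pd_quadψ, H.pd_im_one_eulerU,
    H.pd_u_one_eulerRe] at h1
  linear_combination -h1

theorem flux_u_zero : pd (.u 0) Y = -pd .t (pd (.u 1) T) + const I P.s₁ * upow h * eulerU T +
    totalX (totalX (eulerU T)) - quadU T * totalX (utFun h) := by
  have h1 := congrArg (pd (.u 1)) H.eq
  simp [H.flux_u_one, H.pd_u_one_eulerU, H.pd_u_one_eulerRe, H.pd_u_one_eulerIm, H.totalX_quadU,
    pd_comm (.u 1) .t] at h1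
  linear_combination h1

theorem flux_re_zero : pd (.re 0) Y = -pd .t (pd (.re 1) T) +
    2 * const I P.s₂ * coord (.re 0) * eulerU T + curlψ T * imψtFun P I -
    quadψ T * totalX (reψtFun P I) + totalX (eulerIm T) := by
  have h1 := congrArg (pd (.re 1)) H.eq
  simp [H.flux_re_one, H.pd_re_one_eulerU, H.pd_re_one_eulerRe, H.pd_re_one_eulerIm,
    H.totalX_quadψ, pd_comm (.re 1) .t] at h1
  linear_combination h1

theorem flux_im_zero : pd (.im 0) Y = -pd .t (pd (.im 1) T) +
    2 * const I P.s₂ * coord (.im 0) * eulerU T - curlψ T * reψtFun P I -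
    quadψ T * totalX (imψtFun P I) - totalX (eulerRe T) := by
  have h1 := congrArg (pd (.im 1)) H.eq
  simp [H.flux_im_one, H.pd_im_one_eulerU, pd_im_one_eulerRe, H.pd_im_one_eulerIm,
    H.totalX_quadψ, pd_comm (.im 1) .t] at h1
  linear_combination h1

theorem three_mul_totalX_linU :
    3 * totalX (linU h T) = pd .t (quadU T) := by
  rw [linU]
  have h1 := pd_comm (.u 0) (.u 1) Y
  simp [H.flux_u_one, H.flux_u_zero, H.pd_quadU, H.pd_u_one_eulerU, H.totalX_quadU,
    pd_comm (.u 1) .t] at h1 ⊢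
  rw [quadU] at h1 ⊢
  linear_combination -h1

/-- The coefficients of `u_x²` and `|ψ_x|²` are in the ratio of those of the energy. -/
theorem const_mul_quadψ : const I P.k * quadψ T = 2 * const I P.s₂ * quadU T := by
  have h1 := congrArg (pd (.im 0)) (pd_comm (.u 0) (.re 1) Y)
  simp [H.flux_re_one, H.flux_u_zero, H.pd_quadU, H.pd_quadψ, H.pd_re_one_eulerU, H.totalX_quadU,
    pd_comm (.re 1) .t, H.pd_u_zero_eulerIm, H.pd_im_zero_eulerU, H.pd_re_zero_eulerU,
    H.pd_re_one_pd_u_one] at h1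
  linear_combination -h1

theorem two_mul_pd_re_zero_eulerIm :
    2 * pd (.re 0) (eulerIm T) = pd .t (quadψ T) + totalX (curlψ T) := by
  have h1 := pd_comm (.re 0) (.re 1) Y
  simp [H.flux_re_one, H.flux_re_zero, H.pd_quadψ, H.pd_re_one_eulerU, H.pd_re_one_eulerIm,
    H.pd_re_one_curlψ, pd_comm (.re 1) .t] at h1
  rw [quadψ]
  linear_combination -h1

theorem two_mul_pd_im_zero_eulerRe :
    2 * pd (.im 0) (eulerRe T) = -pd .t (quadψ T) - totalX (curlψ T) := by
  have h1 := pd_comm (.im 0) (.im 1) Y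
  simp [H.flux_im_one, H.flux_im_zero, H.pd_quadψ, H.pd_im_one_eulerU, pd_im_one_eulerRe,
    H.pd_im_one_curlψ, pd_comm (.im 1) .t, H.pd_im_one_pd_im_one] at h1
  rw [quadψ]
  linear_combination h1

theorem pd_t_quadψ : pd .t (quadψ T) = -(2 * totalX (curlψ T)) := by
  have h1 := H.two_mul_pd_re_zero_eulerIm
  have h2 := H.two_mul_pd_im_zero_eulerRe
  have h3 : pd (.im 0) (eulerRe T) - pd (.re 0) (eulerIm T) = totalX (curlψ T) := by
    rw [H.curlψ_eq]
    simp [eulerRe, eulerIm, pd_comm (.im 0) (.re 0)]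
  refine sub_eq_zero.1 (eq_zero_of_two_mul ?_)
  linear_combination -2 * h3 + h2 - h1

theorem pd_im_zero_eulerIm : pd (.im 0) (eulerIm T) = pd (.re 0) (eulerRe T) := by
  have h1 := pd_comm (.im 0) (.re 1) Y
  simp [H.flux_re_one, H.flux_im_zero, H.pd_quadψ, H.pd_re_one_eulerU, H.pd_re_one_eulerRe,
    H.pd_re_one_curlψ, pd_comm (.re 1) .t, H.pd_re_one_pd_im_one] at h1
  exact h1

theorem pd_re_zero_curlψ : pd (.re 0) (curlψ T) = 0 := by
  have h1 := congrArg (pd (.re 1)) H.pd_t_quadψ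
  simp [pd_comm (.re 1) .t, H.pd_quadψ, H.pd_re_one_curlψ] at h1
  exact eq_zero_of_two_mul h1

theorem pd_im_zero_curlψ : pd (.im 0) (curlψ T) = 0 := by
  have h1 := congrArg (pd (.im 1)) H.pd_t_quadψ
  simp [pd_comm (.im 1) .t, H.pd_quadψ, H.pd_im_one_curlψ] at h1
  exact eq_zero_of_two_mul h1

end ReducedLaw
end DiffFun

namespace DiffFun

/-! ### The determining equations -/

variable {I : Set ℝ} [OpenInterval I] {P : Params} {h : AdmissibleRange P.p I}

theorem pd_eq_zero_of_forall_pd_totalX {f : DiffFun I}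
    (hf : ∀ c, c ≠ .t → c ≠ .x → pd c (totalX f) = 0) {c : Coord} (ht : c ≠ .t) (hx : c ≠ .x) :
    pd c f = 0 := by
  cases c with
  | t => exact absurd rfl ht
  | x => exact absurd rfl hx
  | u m => exact pd_u_eq_zero_of_totalX (n := 0) (fun _ _ => hf _ (by simp) (by simp)) m m.zero_le
  | re m => exact pd_re_eq_zero_of_totalX (n := 0) (fun _ _ => hf _ (by simp) (by simp)) m m.zero_le
  | im m => exact pd_im_eq_zero_of_totalX (n := 0) (fun _ _ => hf _ (by simp) (by simp)) m m.zero_le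

/-- The coefficient of `ψ` in the Euler operator of `ψ`. -/
noncomputable def linψ (P : Params) (T : DiffFun I) : DiffFun I :=
  pd (.re 0) (eulerRe T) + const I P.k * quadψ T * coord (.u 0)

/-- The part of the Euler operator of `u` which depends on `t`, `x` only. -/
noncomputable def freeU (h : AdmissibleRange P.p I) (T : DiffFun I) : DiffFun I :=
  eulerU T + quadU T * coord (.u 2) +
    const I P.s₁ * const I (P.p + 1)⁻¹ * quadU T * (upow h * coord (.u 0)) +
    const I P.s₂ * quadU T * (coord (.re 0) * coord (.re 0) + coord (.im 0) * coord (.im 0)) -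
    linU h T * coord (.u 0)

/-- The part of the Euler operator of `Re ψ` which depends on `t`, `x` only. -/
noncomputable def freeRe (P : Params) (T : DiffFun I) : DiffFun I :=
  eulerRe T + quadψ T * coord (.re 2) - curlψ T * coord (.im 1) -
    (linψ P T - const I P.k * quadψ T * coord (.u 0)) * coord (.re 0)

/-- The part of the Euler operator of `Im ψ` which depends on `t`, `x` only. -/
noncomputable def freeIm (P : Params) (T : DiffFun I) : DiffFun I :=
  eulerIm T + quadψ T * coord (.im 2) + curlψ T * coord (.re 1) -
    (linψ P T - const I P.k * quadψ T * coord (.u 0)) * coord (.im 0)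

namespace ReducedLaw

variable {T Y : DiffFun I} (H : ReducedLaw h T Y)
include H

theorem pd_re_zero_linU : pd (.re 0) (linU h T) = 0 := by
  simp [linU, pd_comm (.re 0) (.u 0), H.pd_re_zero_eulerU, H.pd_quadU]

/-- The coefficients of `u²` and of `Im (ψ̄ ψ_x)` are in the ratio of those of the momentum. -/
theorem two_mul_linU : 2 * const I P.s₂ * linU h T + const I P.k * curlψ T = 0 := by
  have h1 := pd_comm (.u 0) (.re 0) Y
  simp [H.flux_re_zero, H.flux_u_zero, H.pd_quadU, H.pd_quadψ, pd_comm (.re 0) .t,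
    pd_comm (.u 0) .t, H.pd_u_zero_eulerIm, H.pd_im_zero_eulerU, H.pd_re_zero_eulerU,
    H.pd_re_zero_pd_u_one, H.pd_u_zero_curlψ, H.totalX_quadU] at h1
  have h2 : coord (.re 0) * (2 * const I P.s₂ * linU h T + const I P.k * curlψ T) = 0 := by
    rw [linU]
    linear_combination h1 - coord (.im 1) * H.const_mul_quadψ
  have h3 := congrArg (pd (.re 0)) h2
  simp only [Derivation.leibniz, map_add, pd_const, H.pd_re_zero_linU, H.pd_re_zero_curlψ, pd_coord,
    if_true, smul_eq_mul, pd_two, map_zero] at h3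
  linear_combination h3

theorem two_mul_totalX_linψ : 2 * totalX (linψ P T) = -pd .t (curlψ T) := by
  have h1 := pd_comm (.im 0) (.re 0) Y
  simp [H.flux_re_zero, H.flux_im_zero, H.pd_quadψ, pd_comm (.re 0) .t,
    pd_comm (.im 0) .t, H.pd_im_zero_eulerU, H.pd_re_zero_eulerU,
    H.pd_re_zero_curlψ, H.pd_im_zero_curlψ, H.pd_im_zero_eulerIm] at h1
  have h2 := congrArg (pd .t) H.curlψ_eq
  simp at h2
  simp [linψ, H.totalX_quadψ]
  linear_combination h1 + h2

theorem const_mul_pd_t_quadU : const I P.s₂ * pd .t (quadU T) = 0 := by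
  have h1 := congrArg totalX H.two_mul_linU
  have h2 := congrArg (pd .t) H.const_mul_quadψ
  simp at h1 h2
  refine eq_zero_of_two_mul ?_
  linear_combination -6 * h1 - 3 * h2 + 4 * const I P.s₂ * H.three_mul_totalX_linU +
    3 * const I P.k * H.pd_t_quadψ

theorem const_mul_totalX_linψ :
    const I P.k * totalX (linψ P T) = const I P.s₂ * pd .t (linU h T) := by
  have h1 := congrArg (pd .t) H.two_mul_linU
  simp at h1
  refine sub_eq_zero.1 (eq_zero_of_two_mul ?_)
  linear_combination const I P.k * H.two_mul_totalX_linψ - h1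

variable (hs₂ : P.s₂ ≠ 0) (hk : P.k ≠ 0)
include hs₂

theorem pd_quadU_eq_zero (c : Coord) : pd c (quadU T) = 0 := by
  by_cases hc : c = .t
  · subst hc
    exact eq_zero_of_const_mul hs₂ H.const_mul_pd_t_quadU
  · exact H.pd_quadU hc

theorem totalX_linU : totalX (linU h T) = 0 :=
  eq_zero_of_three_mul (by rw [H.three_mul_totalX_linU, H.pd_quadU_eq_zero hs₂])

theorem pd_linU {c : Coord} (hc : c ≠ .t) : pd c (linU h T) = 0 :=
  pd_eq_zero_of_totalX_eq_zero (H.totalX_linU hs₂) hc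

/-- The Euler operator of `u` is a polynomial in `u`, `u ^ (p + 1)`, `ψ` and their derivatives with
coefficients that depend on `t`, `x` only. -/
theorem pd_freeU (hp0 : P.p ≠ 0) (hp1 : P.p ≠ -1) {c : Coord} (ht : c ≠ .t) (hx : c ≠ .x) :
    pd c (freeU h T) = 0 := by
  have hpc := const_inv_add_one_mul (I := I) hp1
  by_cases hc : 2 < c.order
  · have h2 : OrderLE 2 (freeU h T) := by
      have ho (f : DiffFun I) (hf : ∀ c, c ≠ .t → pd c f = 0) : OrderLE 2 f := fun c hc => hf c (by
        rintro rfl; simp [Coord.order] at hc)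
      have hq := ho _ fun _ => H.pd_quadU
      refine OrderLE.sub (((H.orderLE_eulerU.add (hq.mul (orderLE_coord _ (by decide)))).add
        ((((orderLE_const _).mul (orderLE_const _)).mul hq).mul (((orderLE_upow h).mono (by simp)).mul
          (orderLE_coord _ (by decide))))).add (((orderLE_const _).mul hq).mul
          (((orderLE_coord _ (by decide)).mul (orderLE_coord _ (by decide))).add
          ((orderLE_coord _ (by decide)).mul (orderLE_coord _ (by decide))))))
        ((ho _ fun _ => H.pd_linU hs₂).mul (orderLE_coord _ (by decide)))
    exact h2 c hc
  cases c with
  | t => exact absurd rfl ht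
  | x => exact absurd rfl hx
  | u m =>
    obtain rfl | rfl | rfl : m = 0 ∨ m = 1 ∨ m = 2 := by simp only [Coord.order] at hc; omega
    · simp [freeU, H.pd_quadU, H.pd_linU hs₂]
      rw [linU]
      linear_combination const I P.s₁ * const I (P.p + 1)⁻¹ * quadU T * coord_mul_pd_upow h hp0 +
        const I P.s₁ * upow h * quadU T * hpc
    · simp [freeU, H.pd_quadU, H.pd_linU hs₂, H.pd_u_one_eulerU]
    · simp [freeU, H.pd_quadU, H.pd_linU hs₂, H.pd_u_two_eulerU_eq]
  | re m =>
    obtain rfl | rfl | rfl : m = 0 ∨ m = 1 ∨ m = 2 := by simp only [Coord.order] at hc; omega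
    · simp [freeU, H.pd_quadU, H.pd_linU hs₂, H.pd_re_zero_eulerU]
      ring
    · simp [freeU, H.pd_quadU, H.pd_linU hs₂, H.pd_re_one_eulerU]
    · simp [freeU, H.pd_quadU, H.pd_linU hs₂, H.pd_re_two_eulerU]
  | im m =>
    obtain rfl | rfl | rfl : m = 0 ∨ m = 1 ∨ m = 2 := by simp only [Coord.order] at hc; omega
    · simp [freeU, H.pd_quadU, H.pd_linU hs₂, H.pd_im_zero_eulerU]
      ring
    · simp [freeU, H.pd_quadU, H.pd_linU hs₂, H.pd_im_one_eulerU]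
    · simp [freeU, H.pd_quadU, H.pd_linU hs₂, H.pd_im_two_eulerU]

theorem totalX_eulerU (hp0 : P.p ≠ 0) (hp1 : P.p ≠ -1) : totalX (eulerU T) =
    quadU T * utFun h + linU h T * coord (.u 1) + totalX (freeU h T) := by
  have hpc := const_inv_add_one_mul (I := I) hp1
  simp [freeU, H.totalX_quadU, H.totalX_linU hs₂, utFun]
  linear_combination -const I P.s₁ * const I (P.p + 1)⁻¹ * quadU T * coord (.u 1) *
    coord_mul_pd_upow h hp0 -
    const I P.s₁ * upow h * quadU T * coord (.u 1) * hpc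

/-- The determining equation for the coefficients of the Euler operator of `u`. -/
theorem determining_u_add (hp0 : P.p ≠ 0) (hp1 : P.p ≠ -1) :
    pd .t (freeU h T) + pd .t (linU h T) * coord (.u 0) +
      const I P.s₁ * upow h * totalX (freeU h T) + totalX (totalX (totalX (freeU h T))) +
      const I P.k * (coord (.re 0) * freeIm P T - coord (.im 0) * freeRe P T) = 0 := by
  have h1 := congrArg (pd (.u 0)) H.eq
  have h0 : pd (.u 0) (eulerU T) = linU h T - const I P.s₁ * quadU T * upow h := by
    rw [linU]; ring
  simp [H.flux_u_zero, h0, pd_comm (.u 0) .t, H.totalX_eulerU hs₂ hp0 hp1, H.totalX_linU hs₂,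
    H.totalX_quadU, H.pd_u_zero_eulerRe, H.pd_re_zero_eulerU, H.pd_u_zero_eulerIm,
    H.pd_im_zero_eulerU] at h1
  have h2 : pd .t (eulerU T) = pd .t (pd (.u 0) T) - totalX (pd .t (pd (.u 1) T)) := by
    simp [eulerU]
  have h3 : pd .t (eulerU T) = pd .t (freeU h T) + pd .t (linU h T) * coord (.u 0) := by
    simp [freeU, H.pd_quadU_eq_zero hs₂]
    ring
  have h4 : eulerRe T = freeRe P T - quadψ T * coord (.re 2) + curlψ T * coord (.im 1) +
    (linψ P T - const I P.k * quadψ T * coord (.u 0)) * coord (.re 0) := by rw [freeRe]; ring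
  have h5 : eulerIm T = freeIm P T - quadψ T * coord (.im 2) - curlψ T * coord (.re 1) +
    (linψ P T - const I P.k * quadψ T * coord (.u 0)) * coord (.im 0) := by rw [freeIm]; ring
  rw [h4, h5] at h1
  simp only [utFun, reψtFun, imψtFun] at h1
  linear_combination h1 - h3 + h2 + (coord (.re 0) * coord (.im 2) - coord (.im 0) * coord (.re 2)) *
    H.const_mul_quadψ + (coord (.re 0) * coord (.re 1) + coord (.im 0) * coord (.im 1)) *
    H.two_mul_linU

include hk

theorem pd_quadψ_eq_zero (c : Coord) : pd c (quadψ T) = 0 := by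
  have h1 := congrArg (pd c) H.const_mul_quadψ
  simp [H.pd_quadU_eq_zero hs₂] at h1
  exact eq_zero_of_const_mul hk h1

theorem totalX_curlψ : totalX (curlψ T) = 0 := by
  have := H.pd_t_quadψ
  rw [H.pd_quadψ_eq_zero hs₂ hk] at this
  exact eq_zero_of_two_mul (by linear_combination this)

theorem pd_curlψ {c : Coord} (hc : c ≠ .t) : pd c (curlψ T) = 0 :=
  pd_eq_zero_of_totalX_eq_zero (H.totalX_curlψ hs₂ hk) hc

theorem pd_re_zero_eulerIm : pd (.re 0) (eulerIm T) = 0 := by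
  have := H.two_mul_pd_re_zero_eulerIm
  rw [H.pd_quadψ_eq_zero hs₂ hk, H.totalX_curlψ hs₂ hk] at this
  exact eq_zero_of_two_mul (by linear_combination this)

theorem pd_im_zero_eulerRe : pd (.im 0) (eulerRe T) = 0 := by
  have := H.two_mul_pd_im_zero_eulerRe
  rw [H.pd_quadψ_eq_zero hs₂ hk, H.totalX_curlψ hs₂ hk] at this
  exact eq_zero_of_two_mul (by linear_combination this)

theorem pd_linψ {c : Coord} (ht : c ≠ .t) (hx : c ≠ .x) : pd c (linψ P T) = 0 := by
  refine pd_eq_zero_of_forall_pd_totalX (fun c ht _ => eq_zero_of_two_mul ?_) ht hx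
  have h1 := congrArg (pd c) H.two_mul_totalX_linψ
  simpa [pd_comm c .t, H.pd_curlψ hs₂ hk ht] using h1

theorem pd_freeRe {c : Coord} (ht : c ≠ .t) (hx : c ≠ .x) : pd c (freeRe P T) = 0 := by
  have hq (c) := H.pd_quadψ_eq_zero hs₂ hk c
  by_cases hc : 2 < c.order
  · have hc' : ∀ d : Coord, d.order ≤ 2 → c ≠ d := by rintro d hd rfl; omega
    simp [freeRe, hq, H.pd_curlψ hs₂ hk ht, H.pd_linψ hs₂ hk ht hx, H.orderLE_eulerRe c hc,
      hc' (.re 2) (by decide), hc' (.im 1) (by decide), hc' (.re 0) (by decide),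
      hc' (.u 0) (by decide)]
  cases c with
  | t => exact absurd rfl ht
  | x => exact absurd rfl hx
  | u m =>
    obtain rfl | rfl | rfl : m = 0 ∨ m = 1 ∨ m = 2 := by simp only [Coord.order] at hc; omega
    · simp [freeRe, hq, H.pd_curlψ hs₂ hk, H.pd_linψ hs₂ hk, H.pd_u_zero_eulerRe,
        H.pd_re_zero_eulerU]
      linear_combination coord (.re 0) * H.const_mul_quadψ
    · simp [freeRe, hq, H.pd_curlψ hs₂ hk, H.pd_linψ hs₂ hk, H.pd_u_one_eulerRe]
    · simp [freeRe, hq, H.pd_curlψ hs₂ hk, H.pd_linψ hs₂ hk, H.pd_u_two_eulerRe]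
  | re m =>
    obtain rfl | rfl | rfl : m = 0 ∨ m = 1 ∨ m = 2 := by simp only [Coord.order] at hc; omega
    · simp [freeRe, hq, H.pd_curlψ hs₂ hk, H.pd_linψ hs₂ hk]
      rw [linψ]
      ring
    · simp [freeRe, hq, H.pd_curlψ hs₂ hk, H.pd_linψ hs₂ hk, H.pd_re_one_eulerRe]
    · simp [freeRe, hq, H.pd_curlψ hs₂ hk, H.pd_linψ hs₂ hk, H.pd_re_two_eulerRe]
  | im m =>
    obtain rfl | rfl | rfl : m = 0 ∨ m = 1 ∨ m = 2 := by simp only [Coord.order] at hc; omega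
    · simp [freeRe, hq, H.pd_curlψ hs₂ hk, H.pd_linψ hs₂ hk, H.pd_im_zero_eulerRe hs₂ hk]
    · simp [freeRe, hq, H.pd_curlψ hs₂ hk, H.pd_linψ hs₂ hk, pd_im_one_eulerRe]
    · simp [freeRe, hq, H.pd_curlψ hs₂ hk, H.pd_linψ hs₂ hk, H.pd_im_two_eulerRe]

theorem pd_freeIm {c : Coord} (ht : c ≠ .t) (hx : c ≠ .x) : pd c (freeIm P T) = 0 := by
  have hq (c) := H.pd_quadψ_eq_zero hs₂ hk c
  by_cases hc : 2 < c.order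
  · have hc' : ∀ d : Coord, d.order ≤ 2 → c ≠ d := by rintro d hd rfl; omega
    simp [freeIm, hq, H.pd_curlψ hs₂ hk ht, H.pd_linψ hs₂ hk ht hx, H.orderLE_eulerIm c hc,
      hc' (.im 2) (by decide), hc' (.re 1) (by decide), hc' (.im 0) (by decide),
      hc' (.u 0) (by decide)]
  cases c with
  | t => exact absurd rfl ht
  | x => exact absurd rfl hx
  | u m =>
    obtain rfl | rfl | rfl : m = 0 ∨ m = 1 ∨ m = 2 := by simp only [Coord.order] at hc; omega
    · simp [freeIm, hq, H.pd_curlψ hs₂ hk, H.pd_linψ hs₂ hk, H.pd_u_zero_eulerIm,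
        H.pd_im_zero_eulerU]
      linear_combination coord (.im 0) * H.const_mul_quadψ
    · simp [freeIm, hq, H.pd_curlψ hs₂ hk, H.pd_linψ hs₂ hk, H.pd_u_one_eulerIm]
    · simp [freeIm, hq, H.pd_curlψ hs₂ hk, H.pd_linψ hs₂ hk, H.pd_u_two_eulerIm]
  | re m =>
    obtain rfl | rfl | rfl : m = 0 ∨ m = 1 ∨ m = 2 := by simp only [Coord.order] at hc; omega
    · simp [freeIm, hq, H.pd_curlψ hs₂ hk, H.pd_linψ hs₂ hk, H.pd_re_zero_eulerIm hs₂ hk]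
    · simp [freeIm, hq, H.pd_curlψ hs₂ hk, H.pd_linψ hs₂ hk, H.pd_re_one_eulerIm]
    · simp [freeIm, hq, H.pd_curlψ hs₂ hk, H.pd_linψ hs₂ hk, H.pd_re_two_eulerIm]
  | im m =>
    obtain rfl | rfl | rfl : m = 0 ∨ m = 1 ∨ m = 2 := by simp only [Coord.order] at hc; omega
    · simp [freeIm, hq, H.pd_curlψ hs₂ hk, H.pd_linψ hs₂ hk, H.pd_im_zero_eulerIm]
      rw [linψ]
      ring
    · simp [freeIm, hq, H.pd_curlψ hs₂ hk, H.pd_linψ hs₂ hk, H.pd_im_one_eulerIm]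
    · simp [freeIm, hq, H.pd_curlψ hs₂ hk, H.pd_linψ hs₂ hk, H.pd_im_two_eulerIm]

/-- The determining equation contains the term `k Re ψ * freeIm`. -/
theorem freeIm_eq_zero (hp0 : P.p ≠ 0) (hp1 : P.p ≠ -1) : freeIm P T = 0 := by
  have h1 := congrArg (pd (.re 0)) (H.determining_u_add hs₂ hp0 hp1)
  have h2 {c : Coord} (ht : c ≠ .t) (hx : c ≠ .x) := H.pd_freeU hs₂ hp0 hp1 ht hx
  simp [pd_comm (.re 0) .t, h2, H.pd_linU hs₂, H.pd_freeRe hs₂ hk, H.pd_freeIm hs₂ hk] at h1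
  exact eq_zero_of_const_mul hk h1

/-- The determining equation contains the term `-k Im ψ * freeRe`. -/
theorem freeRe_eq_zero (hp0 : P.p ≠ 0) (hp1 : P.p ≠ -1) : freeRe P T = 0 := by
  have h1 := congrArg (pd (.im 0)) (H.determining_u_add hs₂ hp0 hp1)
  have h2 {c : Coord} (ht : c ≠ .t) (hx : c ≠ .x) := H.pd_freeU hs₂ hp0 hp1 ht hx
  simp [pd_comm (.im 0) .t, h2, H.pd_linU hs₂, H.pd_freeRe hs₂ hk, H.pd_freeIm hs₂ hk] at h1
  exact eq_zero_of_const_mul hk h1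

/-- The determining equation without the terms in `ψ`. -/
theorem determining_u (hp0 : P.p ≠ 0) (hp1 : P.p ≠ -1) :
    pd .t (freeU h T) + pd .t (linU h T) * coord (.u 0) +
      const I P.s₁ * upow h * totalX (freeU h T) + totalX (totalX (totalX (freeU h T))) = 0 := by
  have h1 := H.determining_u_add hs₂ hp0 hp1
  rw [H.freeIm_eq_zero hs₂ hk hp0 hp1, H.freeRe_eq_zero hs₂ hk hp0 hp1] at h1
  linear_combination h1

theorem eulerRe_eq (hp0 : P.p ≠ 0) (hp1 : P.p ≠ -1) : eulerRe T =
    -(quadψ T * coord (.re 2)) + curlψ T * coord (.im 1) +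
    (linψ P T - const I P.k * quadψ T * coord (.u 0)) * coord (.re 0) := by
  have h1 := H.freeRe_eq_zero hs₂ hk hp0 hp1
  rw [freeRe] at h1
  linear_combination h1

theorem eulerIm_eq (hp0 : P.p ≠ 0) (hp1 : P.p ≠ -1) : eulerIm T =
    -(quadψ T * coord (.im 2)) - curlψ T * coord (.re 1) +
    (linψ P T - const I P.k * quadψ T * coord (.u 0)) * coord (.im 0) := by
  have h1 := H.freeIm_eq_zero hs₂ hk hp0 hp1
  rw [freeIm] at h1
  linear_combination h1

/-- The determining equation for the coefficient of `ψ` in the Euler operator of `ψ`. -/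
theorem determining_ψ (hp0 : P.p ≠ 0) (hp1 : P.p ≠ -1) :
    pd .t (linψ P T) + 2 * const I P.s₂ * totalX (freeU h T) = 0 := by
  have h1 := congrArg (pd (.re 0)) H.eq
  have h2 {c : Coord} (ht : c ≠ .t) (hx : c ≠ .x) := H.pd_freeU hs₂ hp0 hp1 ht hx
  have h3 : pd .t (eulerRe T) = pd .t (pd (.re 0) T) - totalX (pd .t (pd (.re 1) T)) := by
    simp [eulerRe]
  have h4 : pd .t (eulerRe T) = pd .t (curlψ T) * coord (.im 1) +
      pd .t (linψ P T) * coord (.re 0) := by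
    rw [H.eulerRe_eq hs₂ hk hp0 hp1]
    simp [H.pd_quadψ_eq_zero hs₂ hk]
    ring
  have h5 : pd (.re 0) (eulerRe T) = linψ P T - const I P.k * quadψ T * coord (.u 0) := by
    rw [linψ]; ring
  simp [H.flux_re_zero, pd_comm (.re 0) .t, H.totalX_eulerU hs₂ hp0 hp1, H.totalX_quadψ,
    H.totalX_curlψ hs₂ hk, H.pd_re_zero_eulerU, H.pd_re_zero_eulerIm hs₂ hk, h5] at h1
  rw [H.eulerIm_eq hs₂ hk hp0 hp1] at h1
  have h6 := H.two_mul_totalX_linψ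
  have h7 := congrArg totalX h6
  have h8 : totalX (pd .t (curlψ T)) = 0 := by
    rw [← pd_t_totalX, H.totalX_curlψ hs₂ hk, map_zero]
  simp [h8] at h7
  have h9 := eq_zero_of_two_mul h7
  simp [H.totalX_quadψ, H.totalX_curlψ hs₂ hk, h9] at h1
  simp [utFun, reψtFun, imψtFun] at h1
  have h10 : coord (.re 0) * (pd .t (linψ P T) + 2 * const I P.s₂ * totalX (freeU h T)) = 0 := by
    linear_combination h1 - h4 + h3 - coord (.re 0) * coord (.u 1) * H.two_mul_linU -
      coord (.im 1) * h6
  have h11 := congrArg (pd (.re 0)) h10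
  simpa [pd_comm (.re 0) .t, h2, H.pd_linψ hs₂ hk] using h11

end ReducedLaw
end DiffFun

namespace DiffFun

variable {I : Set ℝ} {P : Params} (h : AdmissibleRange P.p I)

/-! ### The five currents in the ring of differential functions -/

/-- `|ψ|²` -/
noncomputable def absSq (I : Set ℝ) : DiffFun I :=
  coord (.re 0) * coord (.re 0) + coord (.im 0) * coord (.im 0)

/-- `|ψ_x|²` -/
noncomputable def absSqX (I : Set ℝ) : DiffFun I :=
  coord (.re 1) * coord (.re 1) + coord (.im 1) * coord (.im 1)

/-- `Im (ψ̄ ψ_x)` -/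
noncomputable def angX (I : Set ℝ) : DiffFun I :=
  coord (.re 0) * coord (.im 1) - coord (.im 0) * coord (.re 1)

/-- `Im (ψ̄ ψ_t)` -/
noncomputable def angT (P : Params) (I : Set ℝ) : DiffFun I :=
  coord (.re 0) * imψtFun P I - coord (.im 0) * reψtFun P I

/-- Mass density. -/
noncomputable def massT (I : Set ℝ) : DiffFun I := coord (.u 0)

/-- Mass flux. -/
noncomputable def massX : DiffFun I :=
  coord (.u 2) + const I P.s₁ * const I (P.p + 1)⁻¹ * (upow h * coord (.u 0)) +
    const I P.s₂ * absSq I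

/-- Charge density. -/
noncomputable def chargeT (I : Set ℝ) : DiffFun I := const I 2⁻¹ * absSq I

/-- Momentum density. -/
noncomputable def momentumT (P : Params) (I : Set ℝ) : DiffFun I :=
  const I 2⁻¹ * const I P.k * (coord (.u 0) * coord (.u 0)) - const I P.s₂ * angX I

/-- Momentum flux. -/
noncomputable def momentumX : DiffFun I :=
  const I P.k * (coord (.u 0) * coord (.u 2) - const I 2⁻¹ * (coord (.u 1) * coord (.u 1)) +
    const I P.s₁ * const I (P.p + 2)⁻¹ * (upow h * coord (.u 0) * coord (.u 0))) -
    const I P.s₂ * absSqX I + const I P.s₂ * angT P I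

/-- Energy density. -/
noncomputable def energyT : DiffFun I :=
  const I 2⁻¹ * (coord (.u 1) * coord (.u 1)) -
    const I P.s₁ * const I (P.p + 1)⁻¹ * const I (P.p + 2)⁻¹ *
      (upow h * coord (.u 0) * coord (.u 0)) +
    const I P.s₂ * const I P.k⁻¹ * absSqX I - const I P.s₂ * coord (.u 0) * absSq I

/-- Energy flux. -/
noncomputable def energyX : DiffFun I :=
  -(const I 2⁻¹ * (massX h * massX h)) - utFun h * coord (.u 1) -
    const I P.s₂ * const I P.k⁻¹ *
      (2 * (reψtFun P I * coord (.re 1) + imψtFun P I * coord (.im 1)))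

/-- Galilean-momentum density. -/
noncomputable def galileanT (P : Params) (I : Set ℝ) : DiffFun I :=
  const I P.s₂ * const I P.k * (const I 2⁻¹ * coord .t * (coord (.u 0) * coord (.u 0)) -
    const I P.s₁ * coord .x * coord (.u 0)) - coord .t * angX I +
    (const I P.s₁ * const I P.k * coord .t + const I 2⁻¹ * coord .x) * absSq I

/-- The part of the Galilean-momentum flux apart from the power of `u`. -/
noncomputable def galileanX (P : Params) (I : Set ℝ) : DiffFun I :=
  const I P.s₂ * const I P.k * ((coord .t * coord (.u 0) - const I P.s₁ * coord .x) *
      coord (.u 2) + const I P.s₁ * coord (.u 1) -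
      const I 2⁻¹ * coord .t * (coord (.u 1) * coord (.u 1)) -
      const I 2⁻¹ * coord .x * (coord (.u 0) * coord (.u 0)) +
      const I P.s₁ * const I 3⁻¹ * coord .t * (coord (.u 0) * coord (.u 0) * coord (.u 0))) -
    coord .t * absSqX I - const I P.s₁ * const I P.k * coord .x * absSq I +
    coord .t * angT P I +
    (const I P.s₁ * 2 * const I P.k * coord .t + coord .x) * angX I

/-- The flux which makes the Galilean-momentum density conserved up to the term
`s₂ k (u² / 2 - u^(p+1) / (p+1))`. -/
noncomputable def galileanX' : DiffFun I :=
  const I P.s₂ * const I P.k * ((coord .t * coord (.u 0) - const I P.s₁ * coord .x) *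
      coord (.u 2) + const I P.s₁ * coord (.u 1) -
      const I 2⁻¹ * coord .t * (coord (.u 1) * coord (.u 1)) +
      const I P.s₁ * const I (P.p + 2)⁻¹ * coord .t * (upow h * coord (.u 0) * coord (.u 0)) -
      const I (P.p + 1)⁻¹ * coord .x * (upow h * coord (.u 0))) -
    coord .t * absSqX I - const I P.s₁ * const I P.k * coord .x * absSq I +
    coord .t * angT P I +
    (const I P.s₁ * 2 * const I P.k * coord .t + coord .x) * angX I

theorem const_inv_mul {a : ℝ} (ha : a ≠ 0) : const I a⁻¹ * const I a = 1 := by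
  rw [← map_mul, inv_mul_cancel₀ ha, map_one]

theorem const_half : const I 2⁻¹ * 2 = 1 := by
  rw [← const_inv_mul (I := I) (two_ne_zero (α := ℝ)),
    show const I 2 = 2 from map_ofNat (algebraMap ℝ (DiffFun I)) 2]

theorem const_third : const I 3⁻¹ * 3 = 1 := by
  rw [← const_inv_mul (I := I) (three_ne_zero (α := ℝ)),
    show const I 3 = 3 from map_ofNat (algebraMap ℝ (DiffFun I)) 3]

theorem const_inv_add_two_mul {p : ℝ} (hp2 : p ≠ -2) :
    const I (p + 2)⁻¹ * (const I p + 2) = 1 := by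
  have : p + 2 ≠ 0 := fun h => hp2 (by linarith)
  have h2 : const I 2 = 2 := map_ofNat (algebraMap ℝ (DiffFun I)) 2
  have h3 : const I (p + 2) = const I p + const I 2 := map_add _ _ _
  rw [← const_inv_mul (I := I) this, h3, h2]

variable [OpenInterval I]

theorem totalT_upow : totalT h (upow h) = utFun h * pd (.u 0) (upow h) := by
  rw [totalT_eq_of_orderLE_one h ((orderLE_upow h).mono (by simp))]
  simp

section Conserved

variable (hp0 : P.p ≠ 0)
include hp0

theorem totalX_massX (hp1 : P.p ≠ -1) : totalX (massX h) = -utFun h := by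
  simp [massX, absSq, utFun]
  linear_combination const I P.s₁ * const I (P.p + 1)⁻¹ * coord (.u 1) * coord_mul_pd_upow h hp0 +
    const I P.s₁ * upow h * coord (.u 1) * const_inv_add_one_mul (I := I) hp1

theorem mass_conserved (hp1 : P.p ≠ -1) : totalT h (massT I) + totalX (massX h) = 0 := by
  simp [totalX_massX h hp0 hp1, massT]

theorem momentum_conserved (hp2 : P.p ≠ -2) :
    totalT h (momentumT P I) + totalX (momentumX h) = 0 := by
  simp [momentumT, momentumX, angX, angT, absSqX]
  simp [utFun, reψtFun, imψtFun]
  linear_combination (const I P.k * coord (.u 0) * -(const I P.s₁ * upow h * coord (.u 1) +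
      coord (.u 3) + const I P.s₂ * (2 * (coord (.re 0) * coord (.re 1) +
        coord (.im 0) * coord (.im 1)))) - const I P.k * coord (.u 1) * coord (.u 2)) *
      const_half (I := I) +
    const I P.s₁ * const I P.k * const I (P.p + 2)⁻¹ * coord (.u 1) * coord (.u 0) *
      coord_mul_pd_upow h hp0 +
    const I P.s₁ * const I P.k * coord (.u 0) * coord (.u 1) * upow h *
      const_inv_add_two_mul (I := I) hp2

theorem energy_conserved (hp1 : P.p ≠ -1) (hp2 : P.p ≠ -2) (hk : P.k ≠ 0) :
    totalT h (energyT h) + totalX (energyX h) = 0 := by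
  simp [energyT, energyX, totalX_massX h hp0 hp1, absSqX, absSq, totalT_upow]
  have hm : massX h = coord (.u 2) + const I P.s₁ * const I (P.p + 1)⁻¹ *
    (upow h * coord (.u 0)) + const I P.s₂ *
      (coord (.re 0) * coord (.re 0) + coord (.im 0) * coord (.im 0)) := rfl
  have hr : reψtFun P I = -(coord (.im 2) + const I P.k * coord (.u 0) * coord (.im 0)) := rfl
  have hi : imψtFun P I = coord (.re 2) + const I P.k * coord (.u 0) * coord (.re 0) := rfl
  linear_combination (coord (.u 1) * totalX (utFun h) + massX h * utFun h) * const_half (I := I) -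
    const I P.s₁ * const I (P.p + 1)⁻¹ * const I (P.p + 2)⁻¹ * utFun h * coord (.u 0) *
      coord_mul_pd_upow h hp0 -
    const I P.s₁ * const I (P.p + 1)⁻¹ * upow h * coord (.u 0) * utFun h *
      const_inv_add_two_mul (I := I) hp2 +
    2 * const I P.s₂ * (coord (.u 0) * coord (.re 0) * reψtFun P I +
      coord (.u 0) * coord (.im 0) * imψtFun P I) * const_inv_mul (I := I) hk +
    utFun h * hm + 2 * const I P.s₂ * const I P.k⁻¹ * (reψtFun P I * hi - imψtFun P I * hr)

/-- The Galilean-momentum density is conserved up to a function of `u` which vanishes only for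
`p = 1`. -/
theorem galilean_conserved_up_to (hp1 : P.p ≠ -1) (hp2 : P.p ≠ -2) (hs₁ : P.s₁ * P.s₁ = 1)
    (hs₂ : P.s₂ * P.s₂ = 1) :
    totalT h (galileanT P I) + totalX (galileanX' h) = const I P.s₂ * const I P.k *
      (const I 2⁻¹ * (coord (.u 0) * coord (.u 0)) -
        const I (P.p + 1)⁻¹ * (upow h * coord (.u 0))) := by
  have hs₁' : const I P.s₁ * const I P.s₁ = 1 := by rw [← map_mul, hs₁, map_one]
  have hs₂' : const I P.s₂ * const I P.s₂ = 1 := by rw [← map_mul, hs₂, map_one]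
  simp [galileanT, galileanX', absSqX, absSq, angX, angT]
  simp [utFun, reψtFun, imψtFun]
  linear_combination (const I P.s₂ * const I P.k * (coord .t * coord (.u 0) *
      -(const I P.s₁ * upow h * coord (.u 1) +
      coord (.u 3) + const I P.s₂ * (2 * (coord (.re 0) * coord (.re 1) +
        coord (.im 0) * coord (.im 1)))) - coord .t * coord (.u 1) * coord (.u 2)) +
      coord .x * (coord (.im 0) * coord (.re 2) - coord (.re 0) * coord (.im 2))) *
      const_half (I := I) +
    const I P.s₂ * const I P.k * const I P.s₁ * const I (P.p + 2)⁻¹ * coord .t * coord (.u 1) *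
      coord (.u 0) * coord_mul_pd_upow h hp0 +
    const I P.s₂ * const I P.k * const I P.s₁ * coord .t * coord (.u 0) * coord (.u 1) * upow h *
      const_inv_add_two_mul (I := I) hp2 -
    const I P.s₂ * const I P.k * const I (P.p + 1)⁻¹ * coord .x * coord (.u 1) *
      coord_mul_pd_upow h hp0 -
    const I P.s₂ * const I P.k * coord .x * coord (.u 1) * upow h *
      const_inv_add_one_mul (I := I) hp1 +
    const I P.s₂ * const I P.k * coord .x * coord (.u 1) * upow h * hs₁' +
    2 * const I P.k * (const I P.s₁ * coord .x - coord .t * coord (.u 0)) *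
      (coord (.re 0) * coord (.re 1) + coord (.im 0) * coord (.im 1)) * hs₂'

end Conserved

theorem galilean_conserved (hp : P.p = 1) (hs₁ : P.s₁ * P.s₁ = 1) (hs₂ : P.s₂ * P.s₂ = 1) :
    totalT h (galileanT P I) + totalX (galileanX P I) = 0 := by
  have hs₁' : const I P.s₁ * const I P.s₁ = 1 := by rw [← map_mul, hs₁, map_one]
  have hs₂' : const I P.s₂ * const I P.s₂ = 1 := by rw [← map_mul, hs₂, map_one]
  simp [galileanT, galileanX, absSqX, absSq, angX, angT]
  simp [utFun, reψtFun, imψtFun, upow_eq_coord h hp]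
  linear_combination (const I P.s₂ * const I P.k * (coord .t * coord (.u 0) *
      -(const I P.s₁ * coord (.u 0) * coord (.u 1) +
      coord (.u 3) + const I P.s₂ * (2 * (coord (.re 0) * coord (.re 1) +
        coord (.im 0) * coord (.im 1)))) - coord .t * coord (.u 1) * coord (.u 2) -
        coord .x * coord (.u 0) * coord (.u 1)) +
      coord .x * (coord (.im 0) * coord (.re 2) - coord (.re 0) * coord (.im 2))) *
      const_half (I := I) +
    const I P.s₂ * const I P.k * const I P.s₁ * coord .t * coord (.u 0) * coord (.u 0) *
      coord (.u 1) * const_third (I := I) +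
    const I P.s₂ * const I P.k * coord .x * coord (.u 0) * coord (.u 1) * hs₁' +
    2 * const I P.k * (const I P.s₁ * coord .x - coord .t * coord (.u 0)) *
      (coord (.re 0) * coord (.re 1) + coord (.im 0) * coord (.im 1)) * hs₂'

theorem charge_conserved : totalT h (chargeT I) + totalX (angX I) = 0 := by
  simp [chargeT, absSq, angX]
  simp [reψtFun, imψtFun]
  linear_combination (coord (.im 0) * coord (.re 2) - coord (.re 0) * coord (.im 2)) *
    const_half (I := I)

end DiffFun

namespace DiffFun

variable {I : Set ℝ} [OpenInterval I] {P : Params} (h : AdmissibleRange P.p I)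

/-! ### The five densities as a basis -/

/-- The linear combination of the five densities with coefficients `c`. -/
noncomputable def combination (c : Fin 5 → ℝ) : DiffFun I :=
  const I (c 0) * massT I + const I (c 1) * chargeT I + const I (c 2) * momentumT P I +
    const I (c 3) * energyT h + const I (c 4) * galileanT P I

section Euler

variable (c : Fin 5 → ℝ)

theorem orderLE_combination : OrderLE 1 (combination h c) := by
  have hw := (orderLE_upow h).mono (m := 1) (by simp)
  have hc (a : ℝ) : OrderLE 1 (const I a) := orderLE_const a
  have hx {c : Coord} (hc : c.order ≤ 1) : OrderLE 1 (coord c : DiffFun I) := orderLE_coord c hc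
  have ha : OrderLE 1 (absSq I) :=
    ((hx (by decide)).mul (hx (by decide))).add ((hx (by decide)).mul (hx (by decide)))
  have hb : OrderLE 1 (absSqX I) :=
    ((hx (by decide)).mul (hx (by decide))).add ((hx (by decide)).mul (hx (by decide)))
  have hd : OrderLE 1 (angX I) :=
    ((hx (by decide)).mul (hx (by decide))).sub ((hx (by decide)).mul (hx (by decide)))
  have h0 := hx (c := .u 0) (by decide)
  have h1 := hx (c := .u 1) (by decide)
  have ht := hx (c := .t) (by decide)
  have hx := hx (c := .x) (by decide)
  refine ((((hc _).mul h0).add ((hc _).mul ((hc _).mul ha))).add ((hc _).mul ?_)).add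
    ((hc _).mul ?_) |>.add ((hc _).mul ?_)
  · exact (((hc _).mul (hc _)).mul (h0.mul h0)).sub ((hc _).mul hd)
  · exact ((((hc _).mul (h1.mul h1)).sub ((((hc _).mul (hc _)).mul (hc _)).mul
      ((hw.mul h0).mul h0))).add (((hc _).mul (hc _)).mul hb)).sub (((hc _).mul h0).mul ha)
  · exact ((((hc _).mul (hc _)).mul ((((hc _).mul ht).mul (h0.mul h0)).sub
      (((hc _).mul hx).mul h0))).sub (ht.mul hd)).add
      (((((hc _).mul (hc _)).mul ht).add ((hc _).mul hx)).mul ha)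

/-- The Euler operators of the five densities; that of `u` at the energy density uses
`(p + 2)⁻¹ ∂(u ^ (p + 2))/∂u = u ^ (p + 1)`. -/
theorem eulerU_combination (hp0 : P.p ≠ 0) (hp2 : P.p ≠ -2) : eulerU (combination h c) =
    const I (c 0) + const I (c 2) * const I P.k * coord (.u 0) -
      const I (c 3) * (const I P.s₁ * const I (P.p + 1)⁻¹ * (upow h * coord (.u 0)) +
        const I P.s₂ * absSq I + coord (.u 2)) +
      const I (c 4) * const I P.s₂ * const I P.k *
        (coord .t * coord (.u 0) - const I P.s₁ * coord .x) := by
  simp [eulerU, combination, massT, chargeT, momentumT, energyT, galileanT, absSq, absSqX, angX]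
  linear_combination (const I (c 2) * const I P.k * coord (.u 0) - const I (c 3) * coord (.u 2) +
      const I (c 4) * const I P.s₂ * const I P.k * coord .t * coord (.u 0)) * const_half (I := I) -
    const I (c 3) * const I P.s₁ * const I (P.p + 1)⁻¹ * const I (P.p + 2)⁻¹ * coord (.u 0) *
      coord_mul_pd_upow h hp0 -
    const I (c 3) * const I P.s₁ * const I (P.p + 1)⁻¹ * upow h * coord (.u 0) *
      const_inv_add_two_mul (I := I) hp2

theorem eulerRe_combination : eulerRe (combination h c) =
    const I (c 1) * coord (.re 0) - 2 * const I (c 2) * const I P.s₂ * coord (.im 1) -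
      2 * const I (c 3) * const I P.s₂ *
        (coord (.u 0) * coord (.re 0) + const I P.k⁻¹ * coord (.re 2)) +
      const I (c 4) * (-(2 * coord .t * coord (.im 1)) +
        (2 * const I P.s₁ * const I P.k * coord .t + coord .x) * coord (.re 0)) := by
  simp [eulerRe, combination, massT, chargeT, momentumT, energyT, galileanT, absSq, absSqX, angX]
  linear_combination (const I (c 1) * coord (.re 0) + const I (c 4) * coord .x * coord (.re 0)) *
    const_half (I := I)

theorem eulerIm_combination : eulerIm (combination h c) =
    const I (c 1) * coord (.im 0) + 2 * const I (c 2) * const I P.s₂ * coord (.re 1) -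
      2 * const I (c 3) * const I P.s₂ *
        (coord (.u 0) * coord (.im 0) + const I P.k⁻¹ * coord (.im 2)) +
      const I (c 4) * (2 * coord .t * coord (.re 1) +
        (2 * const I P.s₁ * const I P.k * coord .t + coord .x) * coord (.im 0)) := by
  simp [eulerIm, combination, massT, chargeT, momentumT, energyT, galileanT, absSq, absSqX, angX]
  linear_combination (const I (c 1) * coord (.im 0) + const I (c 4) * coord .x * coord (.im 0)) *
    const_half (I := I)

end Euler

theorem eq_zero_of_const_eq_zero {a : ℝ} (ha : const I a = 0) : a = 0 := by
  obtain ⟨v, hv⟩ := OpenInterval.nonempty (I := I)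
  exact DFunLike.congr_fun ha ⟨(0, 0, fun _ => v, fun _ => 0), hv⟩

/-- The five densities are linearly independent modulo total `x`-derivatives. -/
theorem eq_zero_of_combination_eq_totalX (hp0 : P.p ≠ 0) (hp2 : P.p ≠ -2) (hk : P.k ≠ 0)
    (hs₂ : P.s₂ ≠ 0) {c : Fin 5 → ℝ} {Θ : DiffFun I} (hc : combination h c = totalX Θ) : c = 0 := by
  have hN : IsNull (combination h c) := by
    have := orderLE_combination h c
    rw [hc] at this ⊢
    exact isNull_totalX this
  have hU : eulerU (combination h c) = 0 := sub_eq_zero.2 hN.u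
  have hR : eulerRe (combination h c) = 0 := sub_eq_zero.2 hN.re
  rw [eulerU_combination h c hp0 hp2] at hU
  rw [eulerRe_combination] at hR
  have h3 : c 3 = 0 := eq_zero_of_const_eq_zero (I := I) (by
    simpa [absSq] using congrArg (pd (.u 2)) hU)
  simp only [h3, map_zero, zero_mul, mul_zero, sub_zero] at hU hR
  have hu := congrArg (pd (.u 0)) hU
  simp at hu
  have h4 : c 4 = 0 := by
    have ht := congrArg (pd .t) hu
    simp at ht
    have := eq_zero_of_const_eq_zero (I := I) (a := c 4 * P.s₂ * P.k) (by simpa using ht)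
    simpa [hs₂, hk] using this
  simp only [h4, map_zero, zero_mul, add_zero] at hU hR hu
  have h2 : c 2 = 0 := by
    have := eq_zero_of_const_eq_zero (I := I) (a := c 2 * P.k) (by simpa using hu)
    simpa [hk] using this
  simp only [h2, map_zero, zero_mul, mul_zero, add_zero, sub_zero] at hU hR
  have h0 : c 0 = 0 := eq_zero_of_const_eq_zero hU
  have h1 : c 1 = 0 := eq_zero_of_const_eq_zero (I := I) (by
    simpa using congrArg (pd (.re 0)) hR)
  funext i
  fin_cases i <;> assumption

theorem exists_eq_const {f : DiffFun I} (ht : pd .t f = 0) (hx : totalX f = 0) :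
    ∃ a, f = const I a :=
  eq_algebraMap_of_pd_eq_zero fun c => by
    by_cases hc : c = .t
    · rw [hc, ht]
    · exact pd_eq_zero_of_totalX_eq_zero hx hc

/-- A conserved current whose density is a total `x`-derivative is trivial. -/
theorem exists_potential {T X Θ : DiffFun I} (hT : totalT h T + totalX X = 0)
    (hΘ : T = totalX Θ) : ∃ Θ', T = totalX Θ' ∧ X = -totalT h Θ' := by
  have h1 : totalX (X + totalT h Θ) = 0 := by
    rw [map_add, ← totalT_totalX, ← hΘ, add_comm, hT]
  -- the flux is determined up to a function of `t`, which is the time derivative of its primitive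
  set f := X + totalT h Θ with hf
  have h2 {c : Coord} (hc : c ≠ .t) : pd c (primitive .t f) = 0 := by
    rw [pd_primitive_of_ne hc, pd_eq_zero_of_totalX_eq_zero h1 hc, primitive_zero]
  have h3 : OrderLE 1 (primitive .t f) := fun c hc => h2 (by rintro rfl; simp [Coord.order] at hc)
  have h4 : totalT h (primitive .t f) = f := by
    rw [totalT_eq_of_orderLE_one h h3, pd_primitive_self]
    simp [h2]
  have h5 : totalX (primitive .t f) = 0 := by
    rw [totalX_eq_pd_x fun c hc _ => h2 hc, h2 (by simp)]
  exact ⟨Θ - primitive .t f, by rw [map_sub, h5, sub_zero, hΘ], by rw [map_sub, h4, hf]; ring⟩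

namespace ReducedLaw

variable {h} {T Y : DiffFun I} (H : ReducedLaw h T Y)
include H

section Combination

variable (hp0 : P.p ≠ 0) (hp1 : P.p ≠ -1) (hp2 : P.p ≠ -2) (hk : P.k ≠ 0)
  (hs₂ : P.s₂ * P.s₂ = 1)
include hp0 hp1 hp2 hk hs₂

/-- A conserved density is determined, up to a total `x`-derivative, by the coefficients of its Euler
operators. -/
theorem exists_eq_combination_add_totalX {c : Fin 5 → ℝ} (hA : quadU T = const I (c 3))
    (hL : linU h T = const I P.k * const I (c 2) + const I (c 4) * const I P.s₂ * const I P.k *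
      coord .t)
    (hF : freeU h T = const I (c 0) - const I (c 4) * const I P.s₂ * const I P.k * const I P.s₁ *
      coord .x)
    (hS : linψ P T = const I (c 1) + const I (c 4) * (2 * const I P.s₁ * const I P.k * coord .t +
      coord .x)) :
    ∃ Θ, T = combination h c + totalX Θ := by
  have hs₂' : const I P.s₂ * const I P.s₂ = 1 := by rw [← map_mul, hs₂, map_one]
  have hs : P.s₂ ≠ 0 := by rintro h; simp [h] at hs₂
  have hC : quadψ T = 2 * const I P.s₂ * const I P.k⁻¹ * const I (c 3) := by
    rw [← hA]
    linear_combination const I P.k⁻¹ * H.const_mul_quadψ - quadψ T * const_inv_mul (I := I) hk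
  have hκ : curlψ T = -(2 * const I P.s₂ * const I (c 2)) - 2 * const I (c 4) * coord .t := by
    have := H.two_mul_linU
    rw [hL] at this
    linear_combination const I P.k⁻¹ * this - (curlψ T + 2 * const I P.s₂ * (const I (c 2) +
      const I (c 4) * const I P.s₂ * coord .t)) * const_inv_mul (I := I) hk -
      2 * const I (c 4) * coord .t * hs₂'
  have hU : eulerU T = eulerU (combination h c) := by
    rw [eulerU_combination h c hp0 hp2]
    rw [freeU, hL, hA] at hF
    rw [absSq]
    linear_combination hF
  have hR : eulerRe T = eulerRe (combination h c) := by
    rw [eulerRe_combination, H.eulerRe_eq hs hk hp0 hp1, hC, hκ, hS]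
    linear_combination -2 * const I P.s₂ * const I (c 3) * coord (.u 0) * coord (.re 0) *
      const_inv_mul (I := I) hk
  have hJ : eulerIm T = eulerIm (combination h c) := by
    rw [eulerIm_combination, H.eulerIm_eq hs hk hp0 hp1, hC, hκ, hS]
    linear_combination -2 * const I P.s₂ * const I (c 3) * coord (.u 0) * coord (.im 0) *
      const_inv_mul (I := I) hk
  have hN : IsNull (T - combination h c) := by
    rw [eulerU, eulerU] at hU
    rw [eulerRe, eulerRe] at hR
    rw [eulerIm, eulerIm] at hJ
    refine ⟨H.order.sub (orderLE_combination h c), ?_, ?_, ?_⟩ <;> simp only [map_sub]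
    · linear_combination hU
    · linear_combination hR
    · linear_combination hJ
  obtain ⟨Θ, hΘ⟩ := hN.exists_eq_totalX
  exact ⟨Θ, by rw [← hΘ]; ring⟩

theorem exists_combination_of_ne_one (hs₁ : P.s₁ * P.s₁ = 1) (hp : P.p ≠ 1) :
    ∃ c : Fin 5 → ℝ, c 4 = 0 ∧ ∃ Θ, T = combination h c + totalX Θ := by
  have hs : P.s₂ ≠ 0 := by rintro h; simp [h] at hs₂
  have hs' : P.s₁ ≠ 0 := by rintro h; simp [h] at hs₁
  have hU := H.determining_u hs hk hp0 hp1
  have hF {c : Coord} (ht : c ≠ .t) (hx : c ≠ .x) := H.pd_freeU hs hp0 hp1 ht hx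
  have hL {c : Coord} (ht : c ≠ .t) := H.pd_linU hs ht
  -- as `1`, `u`, `u ^ p` are linearly independent, each coefficient vanishes
  have h1 := congrArg (pd (.u 0)) hU
  simp [pd_comm (.u 0) .t, hF, hL] at h1
  have h2 : pd .t (linU h T) * coord (.u 0) + const I P.s₁ * const I P.p * upow h *
      totalX (freeU h T) = 0 := by
    linear_combination coord (.u 0) * h1 -
      const I P.s₁ * totalX (freeU h T) * coord_mul_pd_upow h hp0
  have h3 := congrArg (pd (.u 0)) h2
  simp [pd_comm (.u 0) .t, hF, hL] at h3
  have h4 : const I ((P.p - 1) * P.s₁ * P.p) * (upow h * totalX (freeU h T)) = 0 := by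
    simp only [map_mul, map_sub, map_one]
    linear_combination coord (.u 0) * (h3 - h1) - const I P.s₁ * totalX (freeU h T) *
      (const I P.p - 1) * coord_mul_pd_upow h hp0
  have h5 : totalX (freeU h T) = 0 := eq_zero_of_upow_mul_eq_zero h
    (eq_zero_of_const_mul (mul_ne_zero (mul_ne_zero (sub_ne_zero.2 hp) hs') hp0) h4)
  rw [h5] at h1 hU
  have h6 : pd .t (linU h T) = 0 := by linear_combination h1
  simp [h6] at hU
  have h7 := H.determining_ψ hs hk hp0 hp1
  have h8 := H.const_mul_totalX_linψ
  rw [h5, mul_zero, add_zero] at h7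
  rw [h6, mul_zero] at h8
  obtain ⟨c₀, hc₀⟩ := exists_eq_const hU h5
  obtain ⟨c₁, hc₁⟩ := exists_eq_const h7 (eq_zero_of_const_mul hk h8)
  obtain ⟨c₂, hc₂⟩ := exists_eq_const h6 (H.totalX_linU hs)
  obtain ⟨c₃, hc₃⟩ := eq_algebraMap_of_pd_eq_zero fun c => H.pd_quadU_eq_zero hs c
  refine ⟨![c₀, c₁, c₂ / P.k, c₃, 0], rfl, H.exists_eq_combination_add_totalX hp0 hp1 hp2 hk hs₂
    hc₃ ?_ ?_ ?_⟩
  · rw [hc₂]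
    simp [← map_mul, mul_div_cancel₀ c₂ hk]
  · simp [hc₀]
  · simp [hc₁]

theorem exists_combination_of_eq_one (hs₁ : P.s₁ * P.s₁ = 1) (hp : P.p = 1) :
    ∃ c : Fin 5 → ℝ, ∃ Θ, T = combination h c + totalX Θ := by
  have hs : P.s₂ ≠ 0 := by rintro h; simp [h] at hs₂
  have hs₁' : const I P.s₁ * const I P.s₁ = 1 := by rw [← map_mul, hs₁, map_one]
  have hs₂' : const I P.s₂ * const I P.s₂ = 1 := by rw [← map_mul, hs₂, map_one]
  have hU := H.determining_u hs hk hp0 hp1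
  rw [upow_eq_coord h hp] at hU
  have hF {c : Coord} (ht : c ≠ .t) (hx : c ≠ .x) := H.pd_freeU hs hp0 hp1 ht hx
  have hL {c : Coord} (ht : c ≠ .t) := H.pd_linU hs ht
  -- for `p = 1` there is one more solution, with `linU` linear in `t` and `freeU` linear in `x`
  have h1 := congrArg (pd (.u 0)) hU
  simp [pd_comm (.u 0) .t, hF, hL] at h1
  have h2 : totalX (pd .t (linU h T)) = 0 := by
    rw [← pd_t_totalX, (H.totalX_linU hs), map_zero]
  have h3 : totalX (totalX (freeU h T)) = 0 := by
    have := congrArg totalX h1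
    simp [h2] at this
    linear_combination const I P.s₁ * this - totalX (totalX (freeU h T)) * hs₁'
  rw [h3, map_zero] at hU
  have h4 : pd .t (freeU h T) = 0 := by linear_combination hU - coord (.u 0) * h1
  have h5 : pd .t (pd .t (linU h T)) = 0 := by
    have := congrArg (pd .t) h1
    simpa [h4] using this
  obtain ⟨d, hd⟩ := exists_eq_const h5 h2
  rw [hd] at h1
  have h7 := H.determining_ψ hs hk hp0 hp1
  have h8 := H.const_mul_totalX_linψ
  rw [hd] at h8
  have hkk := const_inv_mul (I := I) hk
  obtain ⟨c₀, hc₀⟩ := exists_eq_const (f := freeU h T + const I P.s₁ * const I d * coord .x)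
    (by simp [h4]) (by simp; linear_combination const I P.s₁ * h1 - totalX (freeU h T) * hs₁')
  obtain ⟨c₁, hc₁⟩ := exists_eq_const (f := linψ P T - const I P.s₂ * const I P.k⁻¹ * const I d *
    (2 * const I P.s₁ * const I P.k * coord .t + coord .x))
    (by simp
        linear_combination h7 - 2 * const I P.s₂ * const I P.s₁ * h1 -
          2 * const I P.s₁ * const I P.s₂ * const I d * hkk +
          2 * const I P.s₂ * totalX (freeU h T) * hs₁')
    (by simp; linear_combination const I P.k⁻¹ * h8 - totalX (linψ P T) * hkk)
  obtain ⟨c₂, hc₂⟩ := exists_eq_const (f := linU h T - const I d * coord .t)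
    (by simp [hd]) (by simp [(H.totalX_linU hs)])
  obtain ⟨c₃, hc₃⟩ := eq_algebraMap_of_pd_eq_zero fun c => H.pd_quadU_eq_zero hs c
  refine ⟨![c₀, c₁, P.k⁻¹ * c₂, c₃, P.s₂ * P.k⁻¹ * d], H.exists_eq_combination_add_totalX hp0 hp1
    hp2 hk hs₂ hc₃ ?_ ?_ ?_⟩ <;> simp
  · linear_combination hc₂ - const I c₂ * hkk - const I d * coord .t * hkk -
      const I P.k * const I P.k⁻¹ * const I d * coord .t * hs₂'
  · linear_combination hc₀ + const I P.s₁ * const I d * coord .x * hkk +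
      const I P.k * const I P.k⁻¹ * const I d * const I P.s₁ * coord .x * hs₂'
  · linear_combination hc₁

end Combination

end ReducedLaw

/-- For `p ≠ 1` the Galilean-momentum density is not conserved: otherwise
`u² / 2 - u ^ (p + 1) / (p + 1)` would be a null Lagrangian, hence `u = u ^ p`. -/
theorem galilean_not_conserved (hp0 : P.p ≠ 0) (hp1 : P.p ≠ -1) (hp2 : P.p ≠ -2) (hk : P.k ≠ 0)
    (hs₁ : P.s₁ * P.s₁ = 1) (hs₂ : P.s₂ * P.s₂ = 1) (hp : P.p ≠ 1) (X : DiffFun I) :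
    totalT h (galileanT P I) + totalX X ≠ 0 := by
  intro hX
  have h1 := galilean_conserved_up_to h hp0 hp1 hp2 hs₁ hs₂
  set f : DiffFun I := const I P.s₂ * const I P.k * (const I 2⁻¹ * (coord (.u 0) * coord (.u 0)) -
    const I (P.p + 1)⁻¹ * (upow h * coord (.u 0))) with hf
  have h2 : f = totalX (galileanX' h - X) := by
    rw [map_sub]
    linear_combination hX - h1
  have h3 : OrderLE 1 f := by
    have hu : OrderLE 1 (coord (.u 0) : DiffFun I) := orderLE_coord _ (by decide)
    exact ((orderLE_const _).mul (orderLE_const _)).mul (((orderLE_const _).mul (hu.mul hu)).sub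
      ((orderLE_const _).mul (((orderLE_upow h).mono (by simp)).mul hu)))
  have h4 : IsNull f := by
    rw [h2] at h3 ⊢
    exact isNull_totalX h3
  have h5 := h4.u
  simp [hf] at h5
  have hs : P.s₂ ≠ 0 := by rintro h; simp [h] at hs₂
  have h6 : const I (P.s₂ * P.k) * (coord (.u 0) - upow h) = 0 := by
    rw [show const I (P.s₂ * P.k) = const I P.s₂ * const I P.k from map_mul _ _ _]
    linear_combination h5 - const I P.s₂ * const I P.k * coord (.u 0) * const_half (I := I) +
      const I P.s₂ * const I P.k * const I (P.p + 1)⁻¹ * coord_mul_pd_upow h hp0 +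
      const I P.s₂ * const I P.k * upow h * const_inv_add_one_mul (I := I) hp1
  have h7 := eq_zero_of_const_mul (mul_ne_zero hs hk) h6
  have h8 := congrArg (pd (.u 0)) h7
  simp at h8
  have h9 : const I (1 - P.p) * coord (.u 0) = 0 := by
    simp only [map_sub, map_one]
    linear_combination coord (.u 0) * h8 - const I P.p * h7 + coord_mul_pd_upow h hp0
  have h10 := congrArg (pd (.u 0)) (eq_zero_of_const_mul (sub_ne_zero.2 (Ne.symm hp)) h9)
  simp at h10
  exact one_ne_zero (eq_zero_of_const_eq_zero (I := I) (by simpa using h10))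

end DiffFun

namespace DiffFun

section Representation

variable {I : Set ℝ} {P : Params} (h : AdmissibleRange P.p I)

/-! ### Currents in the ring of differential functions -/

/-- On `jetDomain I`, the density and the flux of the current `C` are `T` and `X`. -/
def Represents (C : Current) (T X : DiffFun I) : Prop :=
  ∀ j : jetDomain I, C.1 j = T j ∧ C.2 j = X j

theorem isDiffFunction_of_eq {F : Jet → ℝ} {f : DiffFun I} (hF : ∀ j : jetDomain I, F j = f j) :
    ∃ N, IsDiffFunction I N F :=
  f.exists_isDiffFunction.imp fun _ hN => hN.congr fun j hj =>
    (hF ⟨j, hj⟩).trans (extend_of_mem _ hj).symm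

namespace Represents

variable {C C' : Current} {T X T' X' : DiffFun I}

theorem add (hC : Represents C T X) (hC' : Represents C' T' X') :
    Represents (C + C') (T + T') (X + X') := fun j =>
  ⟨congrArg₂ (· + ·) (hC j).1 (hC' j).1, congrArg₂ (· + ·) (hC j).2 (hC' j).2⟩

theorem sub (hC : Represents C T X) (hC' : Represents C' T' X') :
    Represents (C - C') (T - T') (X - X') := fun j =>
  ⟨congrArg₂ (· - ·) (hC j).1 (hC' j).1, congrArg₂ (· - ·) (hC j).2 (hC' j).2⟩

theorem smul (hC : Represents C T X) (a : ℝ) :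
    Represents (a • C) (const I a * T) (const I a * X) := fun j =>
  ⟨congrArg (a * ·) (hC j).1, congrArg (a * ·) (hC j).2⟩

end Represents

theorem exists_represents {C : Current} (hT : ∃ N, IsDiffFunction I N C.1)
    (hX : ∃ N, IsDiffFunction I N C.2) : Represents C (ofJet C.1 hT) (ofJet C.2 hX) :=
  fun _ => ⟨rfl, rfl⟩

theorem ut_eq (j : jetDomain I) : ut P j = utFun h j := by
  have h1 : utFun h j = -(P.s₁ * j.1.u 0 ^ P.p * j.1.u 1 + j.1.u 3 + P.s₂ * (2 *
    ((j.1.ψ 0).re * (j.1.ψ 1).re + (j.1.ψ 0).im * (j.1.ψ 1).im))) := rfl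
  rw [h1, ut]
  simp

theorem ψt_eq (j : jetDomain I) : ψt P j = ⟨reψtFun P I j, imψtFun P I j⟩ := by
  have h1 : reψtFun P I j = -((j.1.ψ 2).im + P.k * j.1.u 0 * (j.1.ψ 0).im) := rfl
  have h2 : imψtFun P I j = (j.1.ψ 2).re + P.k * j.1.u 0 * (j.1.ψ 0).re := rfl
  rw [h1, h2, ψt]
  apply Complex.ext <;> simp

/-- At `u = 0` this holds because `0 ∈ I` forces `p > 0`. -/
theorem rpow_add_one_eq (hp0 : P.p ≠ 0) (j : jetDomain I) :
    j.1.u 0 ^ (P.p + 1) = upow h j * j.1.u 0 := by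
  have hj : j.1.u 0 ∈ I := j.2
  rw [upow_apply]
  rcases eq_or_ne (j.1.u 0) 0 with h0 | h0
  · rw [h0] at hj ⊢
    rw [mul_zero, Real.zero_rpow (by linarith [h.pos_of_mem_zero hp0 hj])]
  · exact Real.rpow_add_one h0 _

theorem rpow_add_two_eq (hp0 : P.p ≠ 0) (j : jetDomain I) :
    j.1.u 0 ^ (P.p + 2) = upow h j * j.1.u 0 * j.1.u 0 := by
  have hj : j.1.u 0 ∈ I := j.2
  rw [upow_apply]
  rcases eq_or_ne (j.1.u 0) 0 with h0 | h0
  · rw [h0] at hj ⊢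
    rw [mul_zero, Real.zero_rpow (by linarith [h.pos_of_mem_zero hp0 hj])]
  · rw [mul_assoc, ← pow_two]
    exact_mod_cast Real.rpow_add_natCast h0 P.p 2

theorem norm_sq_eq (z : ℂ) : ‖z‖ ^ 2 = z.re * z.re + z.im * z.im := by
  rw [← Complex.normSq_eq_norm_sq, Complex.normSq_apply]

theorem absSqDArg_eq_sub (z z' : ℂ) : absSqDArg z z' = z.re * z'.im - z.im * z'.re := by
  simp [absSqDArg]
  ring

theorem represents_mass (hp0 : P.p ≠ 0) :
    Represents (massCurrent P) (massT I) (massX h) := fun j => by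
  refine ⟨rfl, ?_⟩
  simp only [massCurrent, massX, absSq, add_apply, mul_apply, algebraMap_apply, coord_apply,
    Coord.val, rpow_add_one_eq h hp0, norm_sq_eq, one_div]

theorem represents_charge : Represents chargeCurrent (chargeT I) (angX I) := fun j => by
  simp only [chargeCurrent, chargeT, angX, absSq, add_apply, sub_apply, mul_apply,
    algebraMap_apply, coord_apply, Coord.val, norm_sq_eq, absSqDArg_eq_sub, one_div, and_self]

theorem represents_momentum (hp0 : P.p ≠ 0) :
    Represents (momentumCurrent P) (momentumT P I) (momentumX h) := fun j => by
  simp only [momentumCurrent, momentumT, momentumX, angX, angT, absSqX, add_apply, sub_apply,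
    mul_apply, algebraMap_apply, coord_apply, Coord.val, norm_sq_eq, absSqDArg_eq_sub, one_div,
    rpow_add_two_eq h hp0, ψt_eq]
  exact ⟨by ring, by ring⟩

theorem represents_energy (hp0 : P.p ≠ 0) :
    Represents (energyCurrent P) (energyT h) (energyX h) := fun j => by
  have h2 : (2 : DiffFun I) j = 2 := rfl
  simp only [energyCurrent, energyT, energyX, massX, absSq, absSqX, add_apply, sub_apply,
    mul_apply, neg_apply, algebraMap_apply, coord_apply, Coord.val, norm_sq_eq,
    rpow_add_one_eq h hp0, rpow_add_two_eq h hp0, ψt_eq, ut_eq h, h2, mul_inv, one_div,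
    Complex.add_re, Complex.mul_re, Complex.conj_re, Complex.conj_im]
  exact ⟨by ring, by ring⟩

theorem represents_galilean :
    Represents (galileanCurrent P) (galileanT P I) (galileanX P I) := fun j => by
  have h2 : (2 : DiffFun I) j = 2 := rfl
  simp only [galileanCurrent, galileanT, galileanX, angX, angT, absSq, absSqX, add_apply, sub_apply,
    mul_apply, algebraMap_apply, coord_apply, Coord.val, norm_sq_eq, absSqDArg_eq_sub, one_div,
    ψt_eq, h2]
  exact ⟨by ring, by ring⟩

/-- The flux of the linear combination of the five currents with coefficients `c`. -/
noncomputable def combinationFlux (c : Fin 5 → ℝ) : DiffFun I :=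
  const I (c 0) * massX h + const I (c 1) * angX I + const I (c 2) * momentumX h +
    const I (c 3) * energyX h + const I (c 4) * galileanX P I

theorem represents_combination (hp0 : P.p ≠ 0) (c : Fin 5 → ℝ) :
    Represents (c 0 • massCurrent P + c 1 • chargeCurrent + c 2 • momentumCurrent P +
      c 3 • energyCurrent P + c 4 • galileanCurrent P) (combination h c) (combinationFlux h c) :=
  (((((represents_mass h hp0).smul _).add (represents_charge.smul _)).add
    ((represents_momentum h hp0).smul _)).add ((represents_energy h hp0).smul _)).add
    (represents_galilean.smul _)

end Representation

variable {I : Set ℝ} [OpenInterval I]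

/-! ### Differential functions of given order -/

theorem contDiff_trunc_padZero (n N : ℕ) : ContDiff ℝ ∞ fun q => trunc N (padZero n q) := by
  refine contDiff_fst.prodMk ((contDiff_fst.comp contDiff_snd).prodMk
    (ContDiff.prodMk (contDiff_pi.2 fun m => ?_) (contDiff_pi.2 fun m => ?_)))
  all_goals
    simp only [padZero]
    split_ifs <;> fun_prop

/-- A differential function which does not depend on the coordinates of order greater than `n` is a
smooth function of the coordinates of order at most `n`. -/
theorem OrderLE.isDiffFunction {f : DiffFun I} {n : ℕ} (hf : OrderLE n f) :
    IsDiffFunction I n (extend f) := by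
  obtain ⟨N, G, hG, hF⟩ := f.exists_eq
  refine isDiffFunction_iff.2 ⟨fun q => G (trunc N (padZero n q)),
    hG.comp (contDiff_trunc_padZero n N).contDiffOn fun q hq => hq, fun j hj => ?_⟩
  have hj' : padZero n (trunc n j) ∈ jetDomain I := hj
  change extend f j = G (trunc N (padZero n (trunc n j)))
  rw [← hF _ hj']
  -- the function is constant along the segment which removes the higher coordinates
  set v : Jet := padZero n (trunc n j) - j with hv
  have hv0 (c : Coord) (hc : c.order ≤ n) : c.val v = 0 := by
    rw [hv, sub_eq_add_neg, ← neg_one_smul ℝ, Coord.val_add, Coord.val_smul, neg_one_mul,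
      ← sub_eq_add_neg, sub_eq_zero]
    cases c with
    | t => rfl
    | x => rfl
    | u m | re m | im m =>
      have : m ≤ n := hc
      simp [Coord.val, Jet.u, Jet.ψ, padZero, trunc, this]
  have hline (s : ℝ) : j + s • v ∈ jetDomain I := by
    have : Coord.val (.u 0) (j + s • v) = Coord.val (.u 0) j := by
      rw [Coord.val_add, Coord.val_smul, hv0 (.u 0) (Nat.zero_le n), mul_zero, add_zero]
    change Coord.val (.u 0) (j + s • v) ∈ I
    rw [this]
    exact hj
  have hder (s : ℝ) : HasDerivAt (fun r : ℝ => extend f (j + r • v)) 0 s := by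
    have h1 : HasDerivAt (fun r : ℝ => extend f (j + s • v + r • v)) _ 0 :=
      f.hasLineDerivAt_vectorField (fun c => algebraMap ℝ _ (c.val v)) (hline s) fun c => rfl
    have h2 : vectorField (fun c => algebraMap ℝ (DiffFun I) (c.val v)) f = 0 := by
      rw [vectorField_eq_sum _ hf]
      refine Finset.sum_eq_zero fun c hc => ?_
      rw [hv0 c (Coord.mem_upTo.1 hc), map_zero, zero_mul]
    rw [h2, zero_apply] at h1
    have h3 := HasDerivAt.comp_sub_const s s
      (f := fun r : ℝ => extend f (j + s • v + r • v)) (f' := 0) (by simpa using h1)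
    refine h3.congr_of_eventuallyEq (Filter.Eventually.of_forall fun r => ?_)
    simp only [add_assoc, ← add_smul, add_sub_cancel]
  have := is_const_of_deriv_eq_zero (fun s => (hder s).differentiableAt)
    (fun s => (hder s).deriv) 0 1
  simpa [hv] using this

/-! ### Total derivatives of functions on the jet space -/

variable {P : Params} (h : AdmissibleRange P.p I)

/-- `Dx` of a function on the jet space is `totalX` of the differential function it defines. -/
theorem Dx_eq {F : Jet → ℝ} {f : DiffFun I} (hF : ∀ j : jetDomain I, F j = f j)
    (j : jetDomain I) : Dx F j = totalX f j := by
  rw [Dx, lineDeriv_congr (F' := extend f)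
    (fun j hj => (hF ⟨j, hj⟩).trans (extend_of_mem _ hj).symm) j.2]
  refine (f.hasLineDerivAt_vectorField (shift I) j.2 fun c => ?_).lineDeriv
  cases c <;> rfl

theorem Dx_complex_eq {F : Jet → ℂ} {f g : DiffFun I}
    (hF : ∀ j : jetDomain I, F j = ⟨f j, g j⟩) (j : jetDomain I) :
    Dx F j = ⟨totalX f j, totalX g j⟩ := by
  have h1 : ∀ j ∈ jetDomain I, F j = extend f j + extend g j * Complex.I := fun j hj => by
    rw [hF ⟨j, hj⟩, extend_of_mem _ hj, extend_of_mem _ hj, Complex.mk_eq_add_mul_I]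
  rw [Dx, lineDeriv_congr h1 j.2, Complex.mk_eq_add_mul_I]
  have hf : HasDerivAt _ _ _ := f.hasLineDerivAt_vectorField (shift I) j.2
    (v := (0, 1, fun n => j.1.u (n + 1), fun n => j.1.ψ (n + 1))) fun c => by cases c <;> rfl
  have hg : HasDerivAt _ _ _ := g.hasLineDerivAt_vectorField (shift I) j.2
    (v := (0, 1, fun n => j.1.u (n + 1), fun n => j.1.ψ (n + 1))) fun c => by cases c <;> rfl
  exact (hf.ofReal_comp.add (hg.ofReal_comp.mul_const Complex.I)).deriv

theorem Dx_iterate_ut (n : ℕ) (j : jetDomain I) : (Dx^[n] (ut P)) j = totalX^[n] (utFun h) j := by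
  induction n generalizing j with
  | zero => exact ut_eq h j
  | succ n ih => rw [Function.iterate_succ_apply', Function.iterate_succ_apply', Dx_eq ih]

theorem Dx_iterate_ψt (n : ℕ) (j : jetDomain I) :
    (Dx^[n] (ψt P)) j = ⟨totalX^[n] (reψtFun P I) j, totalX^[n] (imψtFun P I) j⟩ := by
  induction n generalizing j with
  | zero => exact ψt_eq j
  | succ n ih => simp only [Function.iterate_succ_apply', Dx_complex_eq ih]

/-- `Dt` of a function on the jet space is `totalT` of the differential function it defines. -/
theorem Dt_eq {F : Jet → ℝ} {f : DiffFun I} (hF : ∀ j : jetDomain I, F j = f j)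
    (j : jetDomain I) : Dt P F j = totalT h f j := by
  rw [Dt, lineDeriv_congr (F' := extend f)
    (fun j hj => (hF ⟨j, hj⟩).trans (extend_of_mem _ hj).symm) j.2]
  refine (f.hasLineDerivAt_vectorField (evolution h) j.2 fun c => ?_).lineDeriv
  cases c with
  | t => rfl
  | x => rfl
  | u n => exact Dx_iterate_ut h n j
  | re n => exact congrArg Complex.re (Dx_iterate_ψt n j)
  | im n => exact congrArg Complex.im (Dx_iterate_ψt n j)

theorem orderLE_ofJet {F : Jet → ℝ} {n : ℕ} (hF : IsDiffFunction I n F) :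
    OrderLE n (ofJet F ⟨n, hF⟩) :=
  orderLE_of_isDiffFunction (hF.congr fun _ hj => extend_of_mem _ hj)

namespace Represents

variable {C : Current} {T X : DiffFun I}

theorem isConservationLaw_iff (hC : Represents C T X) :
    IsConservationLaw P I C ↔ totalT h T + totalX X = 0 := by
  constructor
  · rintro ⟨-, -, hD⟩
    refine DFunLike.ext _ _ fun j => ?_
    rw [add_apply, ← Dt_eq h (fun j => (hC j).1), ← Dx_eq (fun j => (hC j).2), hD j j.2, zero_apply]
  · refine fun hD => ⟨isDiffFunction_of_eq fun j => (hC j).1,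
      isDiffFunction_of_eq fun j => (hC j).2, fun j hj => ?_⟩
    rw [Dt_eq h (fun j => (hC j).1) ⟨j, hj⟩, Dx_eq (fun j => (hC j).2) ⟨j, hj⟩, ← add_apply, hD,
      zero_apply]

theorem isTrivial_iff (hC : Represents C T X) :
    IsTrivial P I C ↔ ∃ Θ, T = totalX Θ ∧ X = -totalT h Θ := by
  constructor
  · rintro ⟨F, hF, hD⟩
    have hF' (j : jetDomain I) : F j = ofJet F hF j := rfl
    refine ⟨ofJet F hF, DFunLike.ext _ _ fun j => ?_, DFunLike.ext _ _ fun j => ?_⟩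
    · rw [← (hC j).1, (hD j j.2).1, Dx_eq hF']
    · rw [← (hC j).2, (hD j j.2).2, Dt_eq h hF', neg_apply]
  · rintro ⟨Θ, rfl, rfl⟩
    have hF' (j : jetDomain I) : extend Θ j = Θ j := extend_of_mem _ j.2
    refine ⟨extend Θ, Θ.exists_isDiffFunction, fun j hj => ⟨?_, ?_⟩⟩
    · rw [(hC ⟨j, hj⟩).1, Dx_eq hF' ⟨j, hj⟩]
    · rw [(hC ⟨j, hj⟩).2, Dt_eq h hF' ⟨j, hj⟩, neg_apply]

end Represents

/-! ### Bases of the conservation laws -/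

include h in
theorem eq_zero_of_isTrivial (hp0 : P.p ≠ 0) (hp2 : P.p ≠ -2) (hk : P.k ≠ 0) (hs₂ : P.s₂ ≠ 0)
    {c : Fin 5 → ℝ} (hc : IsTrivial P I (c 0 • massCurrent P +
    c 1 • chargeCurrent + c 2 • momentumCurrent P + c 3 • energyCurrent P +
      c 4 • galileanCurrent P)) : c = 0 := by
  obtain ⟨Θ, hΘ, -⟩ := ((represents_combination h hp0 c).isTrivial_iff h).1 hc
  exact eq_zero_of_combination_eq_totalX h hp0 hp2 hk hs₂ hΘ

section Basis

variable (hp0 : P.p ≠ 0) (hp1 : P.p ≠ -1) (hp2 : P.p ≠ -2) (hk : P.k ≠ 0)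
  (hs₁ : P.s₁ * P.s₁ = 1) (hs₂ : P.s₂ * P.s₂ = 1)
include h hp0 hp1 hp2 hk hs₁ hs₂

theorem combination_conserved {c : Fin 5 → ℝ} (hc : c 4 = 0 ∨ P.p = 1) :
    totalT h (combination h c) + totalX (combinationFlux h c) = 0 := by
  have h5 : const I (c 4) * (totalT h (galileanT P I) + totalX (galileanX P I)) = 0 := by
    rcases hc with hc | hc
    · rw [hc, show const I 0 = 0 from map_zero _, zero_mul]
    · rw [galilean_conserved h hc hs₁ hs₂, mul_zero]
  simp [combination, combinationFlux]
  linear_combination const I (c 0) * mass_conserved h hp0 hp1 +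
    const I (c 1) * charge_conserved h + const I (c 2) * momentum_conserved h hp0 hp2 +
    const I (c 3) * energy_conserved h hp0 hp1 hp2 hk + h5

/-- Every conservation law of order at most one is locally equivalent to a linear combination of the five
currents, with the last one only for `p = 1`. -/
theorem exists_locallyEquivalent {C : Current} (hC : IsConservationLaw P I C)
    (hO : HasOrderLE P I 1 C) : ∃ c : Fin 5 → ℝ, (c 4 = 0 ∨ P.p = 1) ∧
      LocallyEquivalent P I C (c 0 • massCurrent P + c 1 • chargeCurrent + c 2 • momentumCurrent P +
        c 3 • energyCurrent P + c 4 • galileanCurrent P) := by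
  obtain ⟨C', hC', hE, hT'⟩ := hO
  have hR := exists_represents hC.1 hC.2.1
  have hR' := exists_represents ⟨1, hT'⟩ hC'.2.1
  have hD := (hR.isConservationLaw_iff h).1 hC
  obtain ⟨Y, hY⟩ := exists_reducedLaw h (orderLE_ofJet hT') ((hR'.isConservationLaw_iff h).1 hC')
  obtain ⟨Θ, hΘ, -⟩ := ((hR.sub hR').isTrivial_iff h).1 hE
  obtain ⟨c, hc, Θ', hΘ'⟩ : ∃ c : Fin 5 → ℝ, (c 4 = 0 ∨ P.p = 1) ∧
      ∃ Θ, ofJet C'.1 ⟨1, hT'⟩ = combination h c + totalX Θ := by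
    by_cases hp : P.p = 1
    · obtain ⟨c, hc⟩ := hY.exists_combination_of_eq_one hp0 hp1 hp2 hk hs₂ hs₁ hp
      exact ⟨c, Or.inr hp, hc⟩
    · obtain ⟨c, h4, hc⟩ := hY.exists_combination_of_ne_one hp0 hp1 hp2 hk hs₂ hs₁ hp
      exact ⟨c, Or.inl h4, hc⟩
  refine ⟨c, hc, ((hR.sub (represents_combination h hp0 c)).isTrivial_iff h).2
    (exists_potential h (Θ := Θ + Θ') ?_ ?_)⟩
  · rw [map_sub, map_sub]
    linear_combination hD - combination_conserved h hp0 hp1 hp2 hk hs₁ hs₂ hc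
  · rw [map_add]
    linear_combination hΘ + hΘ'

theorem conserved_and_order_le {c : Fin 5 → ℝ} {C : Current} (hc : c 4 = 0 ∨ P.p = 1)
    (hC : c 0 • massCurrent P + c 1 • chargeCurrent + c 2 • momentumCurrent P +
        c 3 • energyCurrent P + c 4 • galileanCurrent P = C) :
    IsConservationLaw P I C ∧ IsDiffFunction I 1 C.1 := by
  have hR := represents_combination h hp0 c
  rw [hC] at hR
  exact ⟨(hR.isConservationLaw_iff h).2 (combination_conserved h hp0 hp1 hp2 hk hs₁ hs₂ hc),
    (orderLE_combination h c).isDiffFunction.congr fun j hj =>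
      (hR ⟨j, hj⟩).1.trans (extend_of_mem _ hj).symm⟩

theorem isBasis_of_ne_one (hp : P.p ≠ 1) : IsBasisOfConservationLaws P I 1
    ![massCurrent P, chargeCurrent, momentumCurrent P, energyCurrent P] := by
  have hB (i : Fin 4) : IsConservationLaw P I
      (![massCurrent P, chargeCurrent, momentumCurrent P, energyCurrent P] i) ∧ IsDiffFunction I 1
      (![massCurrent P, chargeCurrent, momentumCurrent P, energyCurrent P] i).1 := by
    refine conserved_and_order_le h hp0 hp1 hp2 hk hs₁ hs₂ (c := Pi.single i.castSucc 1)
      (Or.inl ?_) ?_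
    · fin_cases i <;> simp
    · fin_cases i <;> simp
  refine ⟨fun i => (hB i).1, fun i => (hB i).2, fun C hC hO => ?_, fun c hc => ?_⟩
  · obtain ⟨c, hc, hE⟩ := exists_locallyEquivalent h hp0 hp1 hp2 hk hs₁ hs₂ hC hO
    refine ⟨fun i => c i.castSucc, ?_⟩
    rw [hc.resolve_right hp, zero_smul, add_zero] at hE
    simpa [Fin.sum_univ_four] using hE
  · have h0 := eq_zero_of_isTrivial h hp0 hp2 hk (by rintro h; simp [h] at hs₂) (c := ![c 0, c 1, c 2, c 3, 0])
      (by simpa [Fin.sum_univ_four] using hc)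
    funext i
    fin_cases i
    exacts [congrFun h0 0, congrFun h0 1, congrFun h0 2, congrFun h0 3]

theorem isBasis_of_eq_one (hp : P.p = 1) : IsBasisOfConservationLaws P I 1
    ![massCurrent P, chargeCurrent, momentumCurrent P, energyCurrent P, galileanCurrent P] := by
  have hB (i : Fin 5) : IsConservationLaw P I
      (![massCurrent P, chargeCurrent, momentumCurrent P, energyCurrent P, galileanCurrent P] i) ∧
      IsDiffFunction I 1 (![massCurrent P, chargeCurrent, momentumCurrent P, energyCurrent P,
        galileanCurrent P] i).1 := by
    refine conserved_and_order_le h hp0 hp1 hp2 hk hs₁ hs₂ (c := Pi.single i 1) (Or.inr hp) ?_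
    fin_cases i <;> simp
  refine ⟨fun i => (hB i).1, fun i => (hB i).2, fun C hC hO => ?_, fun c hc => ?_⟩
  · obtain ⟨c, -, hE⟩ := exists_locallyEquivalent h hp0 hp1 hp2 hk hs₁ hs₂ hC hO
    exact ⟨c, by simpa [Fin.sum_univ_five] using hE⟩
  · exact eq_zero_of_isTrivial h hp0 hp2 hk (by rintro h; simp [h] at hs₂) (by simpa [Fin.sum_univ_five] using hc)

theorem galilean_not_isConservationLaw (hp : P.p ≠ 1) :
    ¬ ∃ X : Jet → ℝ, IsConservationLaw P I ((galileanCurrent P).1, X) := by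
  rintro ⟨X, hX⟩
  have hR : Represents ((galileanCurrent P).1, X) (galileanT P I) (ofJet X hX.2.1) := fun j =>
    ⟨(represents_galilean j).1, rfl⟩
  exact galilean_not_conserved h hp0 hp1 hp2 hk hs₁ hs₂ hp _ ((hR.isConservationLaw_iff h).1 hX)

end Basis

end DiffFun

/-! ### Partial derivatives of smooth functions on the plane -/

section Plane

variable {E : Type*} [NormedAddCommGroup E] [NormedSpace ℝ E]

theorem hasDerivAt_snd_of_contDiff {g : ℝ × ℝ → E} (hg : ContDiff ℝ ∞ g) (t x : ℝ) :
    HasDerivAt (fun x => g (t, x)) (fderiv ℝ g (t, x) (0, 1)) x :=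
  ((hg.differentiable (by simp) (t, x)).hasFDerivAt).comp_hasDerivAt x
    ((hasDerivAt_const x t).prodMk (hasDerivAt_id x))

theorem hasDerivAt_fst_of_contDiff {g : ℝ × ℝ → E} (hg : ContDiff ℝ ∞ g) (t x : ℝ) :
    HasDerivAt (fun t => g (t, x)) (fderiv ℝ g (t, x) (1, 0)) t :=
  ((hg.differentiable (by simp) (t, x)).hasFDerivAt).comp_hasDerivAt t
    ((hasDerivAt_id t).prodMk (hasDerivAt_const t x))

theorem contDiff_iteratedDeriv_snd {g : ℝ → ℝ → E} (hg : ContDiff ℝ ∞ fun q : ℝ × ℝ => g q.1 q.2)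
    (n : ℕ) : ContDiff ℝ ∞ fun q : ℝ × ℝ => iteratedDeriv n (g q.1) q.2 := by
  induction n with
  | zero => simpa using hg
  | succ n ih =>
    have : (fun q : ℝ × ℝ => iteratedDeriv (n + 1) (g q.1) q.2) =
        fun q => fderiv ℝ (fun q : ℝ × ℝ => iteratedDeriv n (g q.1) q.2) q (0, 1) := by
      funext q
      rw [iteratedDeriv_succ]
      exact (hasDerivAt_snd_of_contDiff ih q.1 q.2).deriv
    rw [this]
    exact (ih.fderiv_right (m := ∞) (by simp)).clm_apply contDiff_const

theorem hasDerivAt_iteratedDeriv_snd {g : ℝ → ℝ → E}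
    (hg : ContDiff ℝ ∞ fun q : ℝ × ℝ => g q.1 q.2) (n : ℕ) (t x : ℝ) :
    HasDerivAt (iteratedDeriv n (g t)) (iteratedDeriv (n + 1) (g t) x) x := by
  rw [iteratedDeriv_succ]
  exact (hasDerivAt_snd_of_contDiff (contDiff_iteratedDeriv_snd hg n) t x).differentiableAt.hasDerivAt

/-- Symmetry of the mixed second derivatives. -/
theorem hasDerivAt_swap {g gx gt : ℝ × ℝ → E} (hg : ContDiff ℝ ∞ g)
    (hx : ∀ t x, HasDerivAt (fun x => g (t, x)) (gx (t, x)) x)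
    (ht : ∀ t x, HasDerivAt (fun t => g (t, x)) (gt (t, x)) t) {t x : ℝ} {l : E}
    (hl : HasDerivAt (fun x => gt (t, x)) l x) : HasDerivAt (fun t => gx (t, x)) l t := by
  have hgx : gx = fun q => fderiv ℝ g q (0, 1) := funext fun q =>
    (hx q.1 q.2).unique (hasDerivAt_snd_of_contDiff hg q.1 q.2)
  have hgt : gt = fun q => fderiv ℝ g q (1, 0) := funext fun q =>
    (ht q.1 q.2).unique (hasDerivAt_fst_of_contDiff hg q.1 q.2)
  have hf : ContDiff ℝ ∞ (fderiv ℝ g) := hg.fderiv_right (by simp)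
  have hd : DifferentiableAt ℝ (fderiv ℝ g) (t, x) := hf.differentiable (by simp) _
  have h1 := hasDerivAt_fst_of_contDiff (g := gx)
    (by rw [hgx]; exact hf.clm_apply contDiff_const) t x
  have h2 := hasDerivAt_snd_of_contDiff (g := gt)
    (by rw [hgt]; exact hf.clm_apply contDiff_const) t x
  rw [hl.unique h2]
  convert h1 using 1
  rw [hgx, hgt, fderiv_clm_apply hd (differentiableAt_const _),
    fderiv_clm_apply hd (differentiableAt_const _)]
  simpa using (hg.contDiffAt.isSymmSndFDerivAt
    (by simpa using WithTop.coe_le_coe.2 (le_top : (2 : ℕ∞) ≤ ⊤))).eq _ _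

theorem hasDerivAt_re {f : ℝ → ℂ} {f' : ℂ} {x : ℝ} (hf : HasDerivAt f f' x) :
    HasDerivAt (fun y => (f y).re) f'.re x := Complex.reCLM.hasFDerivAt.comp_hasDerivAt x hf

theorem hasDerivAt_im {f : ℝ → ℂ} {f' : ℂ} {x : ℝ} (hf : HasDerivAt f f' x) :
    HasDerivAt (fun y => (f y).im) f'.im x := Complex.imCLM.hasFDerivAt.comp_hasDerivAt x hf

end Plane

/-! ### Differential functions along a solution -/

/-- The chain rule along a curve of jets whose velocity is given by a vector field. -/
theorem DiffFun.hasDerivAt_comp {I : Set ℝ} [OpenInterval I] (f : DiffFun I)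
    (V : Coord → DiffFun I) {γ : ℝ → Jet} (hγ : ∀ s, γ s ∈ jetDomain I) {s : ℝ}
    (hV : ∀ c : Coord, HasDerivAt (fun r => c.val (γ r)) (V c ⟨γ s, hγ s⟩) s) :
    HasDerivAt (fun r => f ⟨γ r, hγ r⟩) (vectorField V f ⟨γ s, hγ s⟩) s := by
  obtain ⟨N, G, hG, hF⟩ := f.exists_eq
  have h1 : HasDerivAt (fun r => trunc N (γ r))
      (∑ c ∈ Coord.upTo N, V c ⟨γ s, hγ s⟩ • trunc N c.vec) s := by
    simp_rw [Coord.trunc_eq_sum N (γ _)]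
    exact HasDerivAt.fun_sum fun c _ => (hV c).smul_const _
  have h2 := ((contDiffAt_of_mem hG (trunc_mem_finDomain.2 (hγ s))).differentiableAt
    (by simp)).hasFDerivAt.comp_hasDerivAt s h1
  have h3 : vectorField V f ⟨γ s, hγ s⟩ = fderiv ℝ G (trunc N (γ s))
      (∑ c ∈ Coord.upTo N, V c ⟨γ s, hγ s⟩ • trunc N c.vec) := by
    rw [vectorField_eq_sum V (orderLE_of_isDiffFunction ⟨G, hG, hF⟩), map_sum, sum_apply]
    refine Finset.sum_congr rfl fun c _ => ?_
    rw [mul_apply, map_smul, pd_apply, (hasLineDerivAt_of_eq hG hF (hγ s) c.vec).lineDeriv,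
      smul_eq_mul]
  rw [h3]
  refine h2.congr_of_eventuallyEq (Filter.Eventually.of_forall fun r => ?_)
  exact (extend_of_mem _ (hγ r)).symm.trans (hF _ (hγ r))

namespace IsSolution

variable {I : Set ℝ} {P : Params} {u : ℝ → ℝ → ℝ} {ψ : ℝ → ℝ → ℂ} (S : IsSolution P I u ψ)

include S in
theorem jetOf_mem (t x : ℝ) : jetOf u ψ t x ∈ jetDomain I := by
  simpa [jetOf, jetDomain, Jet.u] using S.range t x

/-- The value of a differential function at the jets of a solution. -/
noncomputable def eval (f : DiffFun I) (q : ℝ × ℝ) : ℝ := f ⟨jetOf u ψ q.1 q.2, S.jetOf_mem q.1 q.2⟩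

include S

theorem contDiff_coord (c : Coord) :
    ContDiff ℝ ∞ fun q : ℝ × ℝ => c.val (jetOf u ψ q.1 q.2) := by
  cases c with
  | t => exact contDiff_fst
  | x => exact contDiff_snd
  | u n => exact contDiff_iteratedDeriv_snd S.smooth_u n
  | re n => exact Complex.reCLM.contDiff.comp (contDiff_iteratedDeriv_snd S.smooth_ψ n)
  | im n => exact Complex.imCLM.contDiff.comp (contDiff_iteratedDeriv_snd S.smooth_ψ n)

theorem hasDerivAt_coord_snd (c : Coord) (t x : ℝ) :
    HasDerivAt (fun x => c.val (jetOf u ψ t x)) (S.eval (DiffFun.shift I c) (t, x)) x := by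
  cases c with
  | t => exact hasDerivAt_const x t
  | x => exact hasDerivAt_id x
  | u n => exact hasDerivAt_iteratedDeriv_snd S.smooth_u n t x
  | re n => exact hasDerivAt_re (hasDerivAt_iteratedDeriv_snd S.smooth_ψ n t x)
  | im n => exact hasDerivAt_im (hasDerivAt_iteratedDeriv_snd S.smooth_ψ n t x)

theorem hasDerivAt_fst_u (t x : ℝ) :
    HasDerivAt (fun t => u t x) (ut P (jetOf u ψ t x)) t := by
  have h1 : HasDerivAt (fun t => u t x) _ t :=
    (hasDerivAt_fst_of_contDiff S.smooth_u t x).differentiableAt.hasDerivAt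
  have hψ := hasDerivAt_iteratedDeriv_snd S.smooth_ψ 0 t x
  rw [iteratedDeriv_zero, zero_add, iteratedDeriv_one] at hψ
  have h2 : deriv (fun x' => ‖ψ t x'‖ ^ 2) x = 2 * (conj (ψ t x) * deriv (ψ t) x).re := by
    simp_rw [DiffFun.norm_sq_eq]
    rw [(((hasDerivAt_re hψ).fun_mul (hasDerivAt_re hψ)).fun_add
      ((hasDerivAt_im hψ).fun_mul (hasDerivAt_im hψ))).deriv]
    simp
    ring
  have h3 := S.eqn_u t x
  have h4 : ut P (jetOf u ψ t x) = deriv (fun t => u t x) t := by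
    rw [h2] at h3
    simp only [ut, jetOf, Jet.u, Jet.ψ, iteratedDeriv_zero, iteratedDeriv_one]
    linarith
  rwa [h4]

theorem hasDerivAt_fst_ψ (t x : ℝ) :
    HasDerivAt (fun t => ψ t x) (ψt P (jetOf u ψ t x)) t := by
  have h1 : HasDerivAt (fun t => ψ t x) _ t :=
    (hasDerivAt_fst_of_contDiff S.smooth_ψ t x).differentiableAt.hasDerivAt
  have h3 := S.eqn_ψ t x
  have h4 : ψt P (jetOf u ψ t x) = deriv (fun t => ψ t x) t := by
    simp only [ψt, jetOf, Jet.u, Jet.ψ, iteratedDeriv_zero]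
    linear_combination Complex.I * h3 - deriv (fun t => ψ t x) t * Complex.I_mul_I
  rwa [h4]

variable [OpenInterval I]

theorem contDiff_eval (f : DiffFun I) : ContDiff ℝ ∞ (S.eval f) := by
  obtain ⟨N, G, hG, hF⟩ := f.exists_eq
  have h1 : S.eval f = fun q => G (trunc N (jetOf u ψ q.1 q.2)) := funext fun q => by
    rw [← hF _ (S.jetOf_mem _ _), extend_of_mem _ (S.jetOf_mem _ _), eval]
  have h2 : ContDiff ℝ ∞ fun q : ℝ × ℝ => trunc N (jetOf u ψ q.1 q.2) := by
    rw [funext fun q : ℝ × ℝ => Coord.trunc_eq_sum N (jetOf u ψ q.1 q.2)]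
    exact ContDiff.sum fun c _ => (S.contDiff_coord c).smul contDiff_const
  rw [h1, contDiff_iff_contDiffAt]
  exact fun q => (DiffFun.contDiffAt_of_mem hG (trunc_mem_finDomain.2 (S.jetOf_mem _ _))).comp
    (f := fun q : ℝ × ℝ => trunc N (jetOf u ψ q.1 q.2)) q h2.contDiffAt

theorem hasDerivAt_eval_snd (f : DiffFun I) (t x : ℝ) :
    HasDerivAt (fun x => S.eval f (t, x)) (S.eval (DiffFun.totalX f) (t, x)) x :=
  f.hasDerivAt_comp (DiffFun.shift I) (S.jetOf_mem t) fun c => S.hasDerivAt_coord_snd c t x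

/-- On a solution, the `t`-derivative of a jet is the one obtained by elimination through the
system. -/
theorem hasDerivAt_coord_fst (h : AdmissibleRange P.p I) (c : Coord) (t x : ℝ) :
    HasDerivAt (fun t => c.val (jetOf u ψ t x)) (S.eval (DiffFun.evolution h c) (t, x)) t := by
  have key (C : ℕ → Coord) (F : DiffFun I) (hC : ∀ n, DiffFun.shift I (C n) = .coord (C (n + 1)))
      (h0 : ∀ t x, HasDerivAt (fun t => (C 0).val (jetOf u ψ t x)) (S.eval F (t, x)) t) (n : ℕ) :
      ∀ t x, HasDerivAt (fun t => (C n).val (jetOf u ψ t x))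
        (S.eval (DiffFun.totalX^[n] F) (t, x)) t := by
    induction n with
    | zero => exact h0
    | succ n ih =>
      intro t x
      have hx (t x) := S.hasDerivAt_coord_snd (C n) t x
      rw [hC] at hx
      rw [Function.iterate_succ_apply']
      exact hasDerivAt_swap (g := fun q => (C n).val (jetOf u ψ q.1 q.2))
        (gx := fun q => (C (n + 1)).val (jetOf u ψ q.1 q.2)) (S.contDiff_coord (C n)) hx ih
        (S.hasDerivAt_eval_snd _ t x)
  cases c with
  | t => exact hasDerivAt_id t
  | x => exact hasDerivAt_const t x
  | u n =>
    refine key .u (DiffFun.utFun h) (fun _ => rfl) (fun t x => ?_) n t x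
    rw [eval, ← DiffFun.ut_eq]
    simpa [Coord.val, jetOf, Jet.u] using S.hasDerivAt_fst_u t x
  | re n =>
    refine key .re (DiffFun.reψtFun P I) (fun _ => rfl) (fun t x => ?_) n t x
    have h1 := congrArg Complex.re (DiffFun.ψt_eq (P := P) ⟨_, S.jetOf_mem t x⟩)
    rw [eval, ← show _ = DiffFun.reψtFun P I _ from h1]
    simpa [Coord.val, jetOf, Jet.ψ] using hasDerivAt_re (S.hasDerivAt_fst_ψ t x)
  | im n =>
    refine key .im (DiffFun.imψtFun P I) (fun _ => rfl) (fun t x => ?_) n t x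
    have h1 := congrArg Complex.im (DiffFun.ψt_eq (P := P) ⟨_, S.jetOf_mem t x⟩)
    rw [eval, ← show _ = DiffFun.imψtFun P I _ from h1]
    simpa [Coord.val, jetOf, Jet.ψ] using hasDerivAt_im (S.hasDerivAt_fst_ψ t x)

theorem hasDerivAt_eval_fst (h : AdmissibleRange P.p I) (f : DiffFun I) (t x : ℝ) :
    HasDerivAt (fun t => S.eval f (t, x)) (S.eval (DiffFun.totalT h f) (t, x)) t :=
  f.hasDerivAt_comp (DiffFun.evolution h) (fun t => S.jetOf_mem t x)
    fun c => S.hasDerivAt_coord_fst h c t x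

/-- The integral of a conserved density over a rectangle, from the fluxes through its sides. -/
theorem integral_rectangle (h : AdmissibleRange P.p I) {T X : DiffFun I}
    (hT : DiffFun.totalT h T + DiffFun.totalX X = 0) (a b R : ℝ) :
    (∫ x in (-R)..R, S.eval T (b, x)) - (∫ x in (-R)..R, S.eval T (a, x)) =
      (∫ t in a..b, S.eval X (t, -R)) - ∫ t in a..b, S.eval X (t, R) := by
  have hc (f : DiffFun I) := S.contDiff_eval f
  have hd (f : DiffFun I) (q : ℝ × ℝ) : HasFDerivAt (S.eval f) (fderiv ℝ (S.eval f) q) q :=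
    ((hc f).differentiable (by simp) q).hasFDerivAt
  have h0 (q : ℝ × ℝ) : fderiv ℝ (S.eval T) q (1, 0) + fderiv ℝ (S.eval X) q (0, 1) = 0 := by
    rw [← (S.hasDerivAt_eval_fst h T q.1 q.2).unique (hasDerivAt_fst_of_contDiff (hc T) q.1 q.2),
      ← (S.hasDerivAt_eval_snd X q.1 q.2).unique (hasDerivAt_snd_of_contDiff (hc X) q.1 q.2)]
    exact DFunLike.congr_fun hT ⟨_, S.jetOf_mem q.1 q.2⟩
  have h1 := MeasureTheory.integral2_divergence_prod_of_hasFDerivAt (S.eval T) (S.eval X)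
    (fderiv ℝ (S.eval T)) (fderiv ℝ (S.eval X)) a (-R) b R (hc T).continuous.continuousOn
    (hc X).continuous.continuousOn (fun q _ => hd T q) (fun q _ => hd X q)
    (by simp only [h0]; exact MeasureTheory.integrableOn_zero)
  simp only [h0, intervalIntegral.integral_zero] at h1
  linarith

end IsSolution

open Filter Topology in
/-- The integral over the line of a conserved density does not depend on time. -/
theorem IsSolution.integral_eq {I : Set ℝ} {P : Params} (h : AdmissibleRange P.p I)
    {C : Current} (hC : IsConservationLaw P I C) {u : ℝ → ℝ → ℝ} {ψ : ℝ → ℝ → ℂ}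
    (S : IsSolution P I u ψ)
    (hi : ∀ t, MeasureTheory.Integrable (fun x => C.1 (jetOf u ψ t x)))
    (hX : ∀ a b : ℝ, TendstoUniformlyOn (fun x t => C.2 (jetOf u ψ t x)) (fun _ => 0)
      (cocompact ℝ) (Set.Icc a b)) (a b : ℝ) :
    ∫ x, C.1 (jetOf u ψ a x) = ∫ x, C.1 (jetOf u ψ b x) := by
  have := h.openInterval
  have hR := DiffFun.exists_represents hC.1 hC.2.1
  have hrect (R : ℝ) : (∫ x in (-R)..R, C.1 (jetOf u ψ b x)) -
      (∫ x in (-R)..R, C.1 (jetOf u ψ a x)) = (∫ t in a..b, C.2 (jetOf u ψ t (-R))) -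
        ∫ t in a..b, C.2 (jetOf u ψ t R) :=
    S.integral_rectangle h ((hR.isConservationLaw_iff h).1 hC) a b R
  have hflux {l : ℝ → ℝ} (hl : Tendsto l atTop (cocompact ℝ)) :
      Tendsto (fun R => ∫ t in a..b, C.2 (jetOf u ψ t (l R))) atTop (𝓝 0) := by
    rw [Metric.tendsto_nhds]
    intro ε hε
    have hpos : 0 < |b - a| + 1 := by positivity
    filter_upwards [hl.eventually
      (Metric.tendstoUniformlyOn_iff.1 (hX (min a b) (max a b)) _ (div_pos hε hpos))] with R hR
    rw [dist_zero_right]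
    refine (intervalIntegral.norm_integral_le_of_norm_le_const (C := ε / (|b - a| + 1))
      fun t ht => ?_).trans_lt ?_
    · have := hR t (Set.uIoc_subset_uIcc ht)
      rw [dist_zero_left] at this
      exact this.le
    · rw [div_mul_eq_mul_div, div_lt_iff₀ hpos]
      nlinarith
  have hint (t : ℝ) := MeasureTheory.intervalIntegral_tendsto_integral (hi t)
    tendsto_neg_atTop_atBot tendsto_id
  have h1 := (hint b).sub (hint a)
  have h2 := (hflux (l := fun R => -R)
    (tendsto_neg_atTop_atBot.mono_right atBot_le_cocompact)).sub
    (hflux (tendsto_id.mono_right atTop_le_cocompact))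
  simp only [id] at h1 h2
  simp only [hrect] at h1
  have h3 := tendsto_nhds_unique h1 h2
  linarith

/-! ### The conserved integrals -/

theorem IsConservationLaw.isConservedIntegral {I : Set ℝ} {P : Params} (h : AdmissibleRange P.p I)
    {C : Current} (hC : IsConservationLaw P I C) {Q : (ℝ → ℝ → ℝ) → (ℝ → ℝ → ℂ) → ℝ → ℝ}
    {a : ℝ} (ha : a ≠ 0) (hQ : ∀ u ψ t, Q u ψ t = a * ∫ x, C.1 (jetOf u ψ t x)) :
    IsConservedIntegral P I C Q :=
  ⟨⟨a, ha, fun u ψ _ => hQ u ψ⟩, fun u ψ S hi hX t t' => by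
    rw [hQ, hQ, S.integral_eq h hC hi hX t t']⟩

theorem massIntegral_eq (P : Params) (u : ℝ → ℝ → ℝ) (ψ : ℝ → ℝ → ℂ) (t : ℝ) :
    massIntegral u ψ t = 1 * ∫ x, (massCurrent P).1 (jetOf u ψ t x) := by
  simp [massIntegral, massCurrent, jetOf, Jet.u]

theorem chargeIntegral_eq (u : ℝ → ℝ → ℝ) (ψ : ℝ → ℝ → ℂ) (t : ℝ) :
    chargeIntegral u ψ t = 1 * ∫ x, chargeCurrent.1 (jetOf u ψ t x) := by
  simp only [chargeIntegral, chargeCurrent, jetOf, Jet.ψ, one_mul, iteratedDeriv_zero]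

theorem momentumIntegral_eq {P : Params} (hk : P.k ≠ 0) (u : ℝ → ℝ → ℝ) (ψ : ℝ → ℝ → ℂ) (t : ℝ) :
    momentumIntegral P u ψ t = P.k⁻¹ * ∫ x, (momentumCurrent P).1 (jetOf u ψ t x) := by
  rw [← MeasureTheory.integral_const_mul, momentumIntegral]
  congr 1
  funext x
  simp only [momentumCurrent, jetOf, Jet.u, Jet.ψ, iteratedDeriv_zero, iteratedDeriv_one]
  field_simp

theorem energyIntegral_eq (P : Params) (u : ℝ → ℝ → ℝ) (ψ : ℝ → ℝ → ℂ) (t : ℝ) :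
    energyIntegral P u ψ t = 1 * ∫ x, (energyCurrent P).1 (jetOf u ψ t x) := by
  simp only [energyIntegral, energyCurrent, jetOf, Jet.u, Jet.ψ, one_mul, iteratedDeriv_zero,
    iteratedDeriv_one, mul_one_div]

theorem galileanIntegral_eq (P : Params) (u : ℝ → ℝ → ℝ) (ψ : ℝ → ℝ → ℂ) (t : ℝ) :
    galileanIntegral P u ψ t = 1 * ∫ x, (galileanCurrent P).1 (jetOf u ψ t x) := by
  simp only [galileanIntegral, galileanCurrent, jetOf, Jet.u, Jet.ψ, Jet.t, Jet.x, one_mul,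
    iteratedDeriv_zero, iteratedDeriv_one]

end GKdVLS

open GKdVLS in
theorem proposition3 (P : GKdVLS.Params) (I : Set ℝ)
    (hp0 : P.p ≠ 0) (hp1 : P.p ≠ -1) (hp2 : P.p ≠ -2) (hk : P.k ≠ 0)
    (hs₁ : P.s₁ = 1 ∨ P.s₁ = -1) (hs₂ : P.s₂ = 1 ∨ P.s₂ = -1)
    (hI : GKdVLS.AdmissibleRange P.p I) :
    (P.p ≠ 1 → GKdVLS.IsBasisOfConservationLaws P I 1
      ![GKdVLS.massCurrent P, GKdVLS.chargeCurrent, GKdVLS.momentumCurrent P,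
        GKdVLS.energyCurrent P]) ∧
    (P.p = 1 → GKdVLS.IsBasisOfConservationLaws P I 1
      ![GKdVLS.massCurrent P, GKdVLS.chargeCurrent, GKdVLS.momentumCurrent P,
        GKdVLS.energyCurrent P, GKdVLS.galileanCurrent P]) ∧
    (P.p ≠ 1 → ¬ ∃ X : GKdVLS.Jet → ℝ,
      GKdVLS.IsConservationLaw P I ((GKdVLS.galileanCurrent P).1, X)) ∧
    GKdVLS.IsConservedIntegral P I (GKdVLS.massCurrent P) GKdVLS.massIntegral ∧
    GKdVLS.IsConservedIntegral P I GKdVLS.chargeCurrent GKdVLS.chargeIntegral ∧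
    GKdVLS.IsConservedIntegral P I (GKdVLS.momentumCurrent P) (GKdVLS.momentumIntegral P) ∧
    GKdVLS.IsConservedIntegral P I (GKdVLS.energyCurrent P) (GKdVLS.energyIntegral P) ∧
    (P.p = 1 → GKdVLS.IsConservedIntegral P I (GKdVLS.galileanCurrent P)
      (GKdVLS.galileanIntegral P)) := by
  have := hI.openInterval
  have hs₁' : P.s₁ * P.s₁ = 1 := mul_self_eq_one_iff.2 hs₁
  have hs₂' : P.s₂ * P.s₂ = 1 := mul_self_eq_one_iff.2 hs₂
  have hB := DiffFun.isBasis_of_ne_one hI hp0 hp1 hp2 hk hs₁' hs₂'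
  have hB' := DiffFun.isBasis_of_eq_one hI hp0 hp1 hp2 hk hs₁' hs₂'
  have hC (i : Fin 5) (hi : i ≠ 4 ∨ P.p = 1) : IsConservationLaw P I
      (![massCurrent P, chargeCurrent, momentumCurrent P, energyCurrent P,
        galileanCurrent P] i) := by
    by_cases hp : P.p = 1
    · exact (hB' hp).conserved i
    · have h4 : i ≠ 4 := hi.resolve_right hp
      have := (hB hp).conserved
      fin_cases i
      exacts [this 0, this 1, this 2, this 3, absurd rfl h4]
  exact ⟨hB, hB', DiffFun.galilean_not_isConservationLaw hI hp0 hp1 hp2 hk hs₁' hs₂',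
    (hC 0 (by simp)).isConservedIntegral hI one_ne_zero (massIntegral_eq P),
    (hC 1 (by simp)).isConservedIntegral hI one_ne_zero chargeIntegral_eq,
    (hC 2 (by simp)).isConservedIntegral hI (inv_ne_zero hk) (momentumIntegral_eq hk),
    (hC 3 (by simp)).isConservedIntegral hI one_ne_zero (energyIntegral_eq P),
    fun hp => (hC 4 (Or.inr hp)).isConservedIntegral hI one_ne_zero (galileanIntegral_eq P)⟩
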